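/- Theorem (local central limit theorem for $N$). Let $\Gamma$ and $\zeta$ be the Euler gamma function and the Riemann zeta function, and put $$X=\left(\tfrac19\,\Gamma(\tfrac13)^2\,\zeta(\tfrac53)\right)^{3/10},\qquad Y=-\sqrt{\pi}\,\zeta(\tfrac12)\,\zeta(\tfrac32),$$ $$\tau_1=2X^2,\qquad \tau_2=\tfrac{3}{10}X^{-1}Y,\qquad \tau_3=\tfrac{3}{400}X^{-4}Y^2,$$ $$t_n=\tau_1 n^{-3/5}-\tau_2 n^{-7/10}-\tau_3 n^{-4/5}\qquad(n\ge 1).$$ For each $t>0$ let $(X_{j,k})_{j,k\ge1}$ be independent random variables on a probability space with probability measure $\mathbb{P}_t$, where $X_{j,k}$ has the geometric distribution $$\mathbb{P}_t(X_{j,k}=m)=\left(1-e^{-jk(j+k)t/2}\right)e^{-jk(j+k)mt/2}\qquad(m=0,1,2,\dots),$$ and let $$N=\sum_{j,k=1}^\infty \tfrac12\,jk(j+k)\,X_{j,k}$$ (the total dimension of the random representation $\bigoplus_{j,k} X_{j,k}W_{j,k}$ of $SU(3)$, where $W_{j,k}$ is the irreducible representation of dimension $\tfrac12 jk(j+k)$).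 Then for every $t>0$ the variable $N$ is almost surely finite and has finite second moment under $\mathbb{P}_t$; moreover $t_n>0$ for all sufficiently large $n$, and, as $n\to\infty$, $$\mathbb{P}_{t_n}(N=n)=\frac{1+o(1)}{\sqrt{2\pi\operatorname{Var}_{t_n}(N)}}=(1+o(1))\,\frac{\sqrt3\,X}{\sqrt{5\pi}}\;n^{-4/5}.$$ -/

import Mathlib

open Filter Topology MeasureTheory ProbabilityTheory Asymptotics

open scoped ENNReal

namespace SU3

/-- The dimension `j k (j + k) / 2` of the irreducible representation `W_{j,k}` of `SU(3)`, for
`j, k ≥ 1`. The division is exact, see `two_mul_irrepDim`. -/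
def irrepDim (jk : ℕ+ × ℕ+) : ℕ :=
  (jk.1 : ℕ) * (jk.2 : ℕ) * ((jk.1 : ℕ) + (jk.2 : ℕ)) / 2

theorem two_mul_irrepDim (jk : ℕ+ × ℕ+) :
    2 * irrepDim jk = (jk.1 : ℕ) * (jk.2 : ℕ) * ((jk.1 : ℕ) + (jk.2 : ℕ)) := by
  apply Nat.mul_div_cancel'
  rw [← even_iff_two_dvd]
  rcases Nat.even_or_odd (jk.1 : ℕ) with h | h <;> rcases Nat.even_or_odd (jk.2 : ℕ) with h' | h' <;>
    simp [Nat.even_add, h, h', Nat.not_even_iff_odd.mpr]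

/-- The random representation model with parameter `t`: under the probability measure `P`, the
multiplicities `M (j, k)` are independent, and `M (j, k)` is geometrically distributed on
`{0, 1, 2, …}` with success probability `1 - exp (- j k (j + k) t / 2)`. -/
structure IsRandomRepresentation {Ω : Type*} [MeasurableSpace Ω] (t : ℝ) (P : Measure Ω)
    (M : ℕ+ × ℕ+ → Ω → ℕ) : Prop where
  isProbabilityMeasure : IsProbabilityMeasure P
  measurable : ∀ jk, Measurable (M jk)
  indep : iIndepFun M P
  law : ∀ jk m, P.real {ω | M jk ω = m} =
    (1 - Real.exp (-(irrepDim jk * t))) * Real.exp (-(irrepDim jk * t)) ^ m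

/-- The total dimension `N = ∑_{j,k ≥ 1} (j k (j + k) / 2) M (j, k)` of the random
representation `⨁ M (j, k) W_{j,k}`, with values in `[0, ∞]`. -/
noncomputable def totalDim {Ω : Type*} (M : ℕ+ × ℕ+ → Ω → ℕ) (ω : Ω) : ℝ≥0∞ :=
  ∑' jk, (irrepDim jk : ℝ≥0∞) * (M jk ω : ℝ≥0∞)

/-- `X = (Γ(1/3)² ζ(5/3) / 9) ^ (3/10)`. -/
noncomputable def constX : ℝ :=
  (1 / 9 * Real.Gamma (1 / 3) ^ 2 * (riemannZeta (5 / 3)).re) ^ (3 / 10 : ℝ)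

/-- `Y = -√π ζ(1/2) ζ(3/2)`. -/
noncomputable def constY : ℝ :=
  -(√Real.pi * (riemannZeta (1 / 2)).re * (riemannZeta (3 / 2)).re)

/-- `τ₁ = 2 X²`. -/
noncomputable def tau1 : ℝ := 2 * constX ^ 2

/-- `τ₂ = (3/10) X⁻¹ Y`. -/
noncomputable def tau2 : ℝ := 3 / 10 * constX⁻¹ * constY

/-- `τ₃ = (3/400) X⁻⁴ Y²`. -/
noncomputable def tau3 : ℝ := 3 / 400 * (constX ^ 4)⁻¹ * constY ^ 2

/-- The saddle point sequence `t_n = τ₁ n^(-3/5) - τ₂ n^(-7/10) - τ₃ n^(-4/5)`, for `n ≥ 1`. -/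
noncomputable def saddlePoint (n : ℕ) : ℝ :=
  tau1 * (n : ℝ) ^ (-3 / 5 : ℝ) - tau2 * (n : ℝ) ^ (-7 / 10 : ℝ) - tau3 * (n : ℝ) ^ (-4 / 5 : ℝ)

end SU3

namespace SU3

/-! `N` is a sum of independent integer-valued variables, and its point probability is read off by
Fourier inversion. Write σ² for the variance at `t = t_n`. The sequence `t_n` is tuned so that the
mean of `N` equals `n` up to o(σ). After rescaling, 2πσ P(N = n) is the integral over |u| ≤ πσ of E
exp(iu(N - n)/σ). The integrand tends to exp(-u²/2) and is dominated by a fixed integrable function,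
so σ P(N = n) tends to 1/√(2π) (`tendsto_sqrt_totalVar_mul_prob`).

The mean. Expanding q/(1 - q) geometrically turns the mean into ∑ₘ (mt)⁻¹ F(mt), where F(t) = ∑ y
exp(-y) over y = t j k (j + k)/2. A two-term expansion of F with error O(t^(-1/6)), uniform in `t >
0` (`exists_abs_tsum_slice_sub_main_le`), can therefore be summed over m and produces ζ(5/3) and
ζ(3/2). To expand F, fold the sum onto k ≥ j by symmetry and replace the sum over k by an integral
with the trapezoidal rule. The substitution k(j + k) = 2 j² l then separates variables: what remains
is the integral over l > 1 of ∑ⱼ s j⁴ exp(-s j³), at s = t l, against the density `rho`. Replacing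
the sum over j by its integral gives the t^(-2/3) term, whose constant is half a beta integral. The
remainder of that replacement gives the t^(-1/2) term, whose constant is a Mellin transform equal to
Γ(3/2) ζ(1/2) (`integral_rpow_mul_profileRem`).

The variance. The mean is convex in `t` with derivative minus the variance, so its leading
asymptotics may be differentiated (`tendsto_totalVar`): σ² is of order t^(-8/3), that is σ is of
order n^(4/5). The corrections τ₂ and τ₃ cancel the expansion of the mean through relative order
n^(-1/5), which is precisely the scale σ/n (`saddle_expansion`).

The characteristic function. Pointwise convergence to the Gaussian is a Lyapunov argument with third
moments (`norm_integral_exp_sub_gaussian_le`). Domination (`exists_integrable_bound`) splits at |θ|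
= t. For |θ| ≤ t, the pairs with j, k ≤ t^(-1/3) already give Gaussian decay. For t ≤ |θ| ≤ π, the
dimensions (k + 1)(k + 2)/2 of the representations with j = 1 suffice: Weyl differencing shows that
a positive proportion of the phases stays away from the multiples of 2π (`sum_sin_sq_ge`), so the
characteristic function is at most exp(-c t^(-1/2)). -/

/-! ### The value ζ(1/2) as a regularized sum. -/

theorem hasDerivAt_ofReal_cpow_neg (s : ℂ) {y : ℝ} (hy : 0 < y) :
    HasDerivAt (fun y : ℝ => (y : ℂ) ^ s) (s * (y : ℂ) ^ (s - 1)) y := by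
  have h := ((hasDerivAt_id (y : ℂ)).cpow_const (c := s)
    (Or.inl (by simpa using hy) : (id (y : ℂ)) ∈ Complex.slitPlane)).comp_ofReal
  simpa using h

theorem norm_cpow_neg_sub_le {s : ℂ} (hs : 0 < s.re) {a y : ℝ} (ha : 0 < a) (hay : a ≤ y) :
    ‖(y : ℂ) ^ (-s) - (a : ℂ) ^ (-s)‖ ≤ ‖s‖ * a ^ (-s.re - 1) * (y - a) := by
  have h := (convex_Icc a y).norm_image_sub_le_of_norm_hasDerivWithin_le
    (f := fun y : ℝ => (y : ℂ) ^ (-s)) (f' := fun y : ℝ => -s * (y : ℂ) ^ (-s - 1))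
    (C := ‖s‖ * a ^ (-s.re - 1))
    (fun x hx => (hasDerivAt_ofReal_cpow_neg (-s) (ha.trans_le hx.1)).hasDerivWithinAt)
    (fun x hx => by
      rw [norm_mul, norm_neg, Complex.norm_cpow_eq_rpow_re_of_pos (ha.trans_le hx.1)]
      simp only [Complex.sub_re, Complex.neg_re, Complex.one_re]
      exact mul_le_mul_of_nonneg_left
        (Real.rpow_le_rpow_of_nonpos ha hx.1 (by linarith)) (norm_nonneg _))
    (Set.left_mem_Icc.2 hay) (Set.right_mem_Icc.2 hay)
  simpa [Real.norm_eq_abs, abs_of_nonneg (sub_nonneg.2 hay)] using h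

/-- `s - 1` times the difference between `a ^ (-s)` and its integral over `[a, a + 1]`. -/
noncomputable def zetaTerm (n : ℕ) (s : ℂ) : ℂ :=
  (s - 1) * ((n + 1 : ℝ) : ℂ) ^ (-s) + ((n + 2 : ℝ) : ℂ) ^ (1 - s) - ((n + 1 : ℝ) : ℂ) ^ (1 - s)

/-- The term is the increment over [a, a + 1] of y^(1-s) + y (s - 1) a^(-s), whose derivative (1 -
s)(y^(-s) - a^(-s)) is small by `norm_cpow_neg_sub_le`. The gain of one power of a makes the series
converge for Re s > 0. -/
theorem norm_zetaTerm_le {s : ℂ} (hs : 0 < s.re) (n : ℕ) :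
    ‖zetaTerm n s‖ ≤ ‖s - 1‖ * ‖s‖ * (n + 1 : ℝ) ^ (-s.re - 1) := by
  set a : ℝ := n + 1 with ha
  have hapos : 0 < a := by positivity
  have h := (convex_Icc a (a + 1)).norm_image_sub_le_of_norm_hasDerivWithin_le
    (f := fun y : ℝ => (y : ℂ) ^ (1 - s) + (y : ℂ) * ((s - 1) * (a : ℂ) ^ (-s)))
    (f' := fun y : ℝ => (1 - s) * (y : ℂ) ^ (1 - s - 1) + 1 * ((s - 1) * (a : ℂ) ^ (-s)))
    (C := ‖s - 1‖ * ‖s‖ * a ^ (-s.re - 1))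
    (fun x hx => ((hasDerivAt_ofReal_cpow_neg (1 - s) (hapos.trans_le hx.1)).add
      ((Complex.ofRealCLM.hasDerivAt (x := x)).mul_const _)).hasDerivWithinAt)
    (fun x hx => by
      have h1 := norm_cpow_neg_sub_le hs hapos hx.1
      have h2 : (1 - s) * (x : ℂ) ^ (1 - s - 1) + 1 * ((s - 1) * (a : ℂ) ^ (-s))
          = -((s - 1) * ((x : ℂ) ^ (-s) - (a : ℂ) ^ (-s))) := by
        rw [show 1 - s - 1 = -s by ring]; ring
      rw [h2, norm_neg, norm_mul, mul_assoc]
      refine mul_le_mul_of_nonneg_left (h1.trans ?_) (norm_nonneg _)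
      refine mul_le_of_le_one_right (by positivity) (by linarith [hx.2]))
    (Set.left_mem_Icc.2 (by linarith)) (Set.right_mem_Icc.2 (by linarith))
  have h3 : zetaTerm n s = ((a + 1 : ℝ) : ℂ) ^ (1 - s) + ((a + 1 : ℝ) : ℂ) * ((s - 1) * (a : ℂ) ^ (-s))
      - ((a : ℂ) ^ (1 - s) + (a : ℂ) * ((s - 1) * (a : ℂ) ^ (-s))) := by
    rw [zetaTerm, show ((n : ℝ) + 2) = a + 1 by rw [ha]; ring, ← ha, Complex.ofReal_add a 1]
    push_cast; ring
  rw [h3]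
  simpa using h

theorem differentiable_zetaTerm (n : ℕ) : Differentiable ℂ (zetaTerm n) := by
  have h1 : ((n + 1 : ℝ) : ℂ) ≠ 0 := by norm_cast
  have h2 : ((n + 2 : ℝ) : ℂ) ≠ 0 := by norm_cast
  intro s
  unfold zetaTerm
  refine ((DifferentiableAt.mul (by fun_prop) ?_).add ?_).sub ?_
  · exact DifferentiableAt.const_cpow (by fun_prop) (Or.inl h1)
  · exact DifferentiableAt.const_cpow (by fun_prop) (Or.inl h2)
  · exact DifferentiableAt.const_cpow (by fun_prop) (Or.inl h1)

theorem sum_zetaTerm (N : ℕ) (s : ℂ) :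
    ∑ n ∈ Finset.range N, zetaTerm n s =
      (s - 1) * ∑ n ∈ Finset.range N, ((n + 1 : ℝ) : ℂ) ^ (-s) + ((N + 1 : ℝ) : ℂ) ^ (1 - s) - 1 := by
  induction N with
  | zero => simp
  | succ N ih =>
    rw [Finset.sum_range_succ, ih, Finset.sum_range_succ, zetaTerm,
      show (((N + 1 : ℕ) : ℝ) + 1) = (N + 2 : ℝ) by push_cast; ring]
    ring

theorem summable_zetaTerm {s : ℂ} (hs : 0 < s.re) : Summable (fun n => zetaTerm n s) := by
  have h : Summable fun n : ℕ => ((n + 1 : ℕ) : ℝ) ^ (-s.re - 1) :=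
    (summable_nat_add_iff 1).2 (Real.summable_nat_rpow.2 (by linarith))
  refine Summable.of_norm_bounded (h.mul_left (‖s - 1‖ * ‖s‖)) fun n => ?_
  simpa using norm_zetaTerm_le hs n

theorem tsum_zetaTerm_of_one_lt {s : ℂ} (hs : 1 < s.re) :
    ∑' n, zetaTerm n s = (s - 1) * riemannZeta s - 1 := by
  have h1 := (summable_zetaTerm (by linarith : 0 < s.re)).hasSum.tendsto_sum_nat
  refine tendsto_nhds_unique h1 ?_
  simp_rw [sum_zetaTerm]
  have h2 : Tendsto (fun N : ℕ => ∑ n ∈ Finset.range N, ((n + 1 : ℝ) : ℂ) ^ (-s)) atTop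
      (𝓝 (riemannZeta s)) := by
    rw [zeta_eq_tsum_one_div_nat_add_one_cpow hs]
    have hsum : Summable fun n : ℕ => 1 / ((n : ℂ) + 1) ^ s := by
      have := (summable_nat_add_iff 1).2 (Complex.summable_one_div_nat_cpow.2 hs)
      simpa using this
    refine hsum.hasSum.tendsto_sum_nat.congr fun N => Finset.sum_congr rfl fun n _ => ?_
    rw [Complex.cpow_neg]; simp
  have h3 : Tendsto (fun N : ℕ => ((N + 1 : ℝ) : ℂ) ^ (1 - s)) atTop (𝓝 0) := by
    rw [tendsto_zero_iff_norm_tendsto_zero]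
    have h4 : Tendsto (fun N : ℕ => ((N : ℝ) + 1) ^ (-(s.re - 1))) atTop (𝓝 0) :=
      (tendsto_rpow_neg_atTop (by linarith)).comp
        (tendsto_atTop_add_const_right _ _ tendsto_natCast_atTop_atTop)
    refine h4.congr fun N => ?_
    rw [Complex.norm_cpow_eq_rpow_re_of_pos (by positivity)]
    simp
  simpa using ((h2.const_mul (s - 1)).add h3).sub_const 1

/-- The singularity at 1 is removable, and the value 1 there is the residue. Clearing the pole
allows analytic continuation from 2 to 1/2 through a convex set containing 1. -/
theorem differentiable_sub_one_mul_riemannZeta :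
    Differentiable ℂ (fun s => if s = 1 then (1 : ℂ) else (s - 1) * riemannZeta s) := by
  intro s
  have hoff : ∀ s : ℂ, s ≠ 1 → DifferentiableAt ℂ
      (fun s => if s = 1 then (1 : ℂ) else (s - 1) * riemannZeta s) s := fun s hs => by
    refine DifferentiableAt.congr_of_eventuallyEq
      ((differentiableAt_id.sub_const 1).mul (differentiableAt_riemannZeta hs)) ?_
    filter_upwards [isOpen_ne.mem_nhds hs] with z hz
    simp [show z ≠ 1 from hz]
  by_cases hs : s = 1
  · subst hs
    refine (Complex.analyticAt_of_differentiable_on_punctured_nhds_of_continuousAt ?_ ?_).differentiableAt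
    · filter_upwards [self_mem_nhdsWithin] with z hz using hoff z hz
    · rw [continuousAt_iff_punctured_nhds]
      simp only [if_true]
      refine riemannZeta_residue_one.congr' ?_
      filter_upwards [self_mem_nhdsWithin] with z hz
      simp [show z ≠ 1 from hz]
  · exact hoff s hs

theorem tsum_zetaTerm_half :
    ∑' n, zetaTerm n (1 / 2) = (1 / 2 - 1) * riemannZeta (1 / 2) - 1 := by
  -- A convex set containing 2 and 1/2. The bound Re s > 1/4 makes the series uniformly summable
  -- with exponent -5/4, and the ball bounds ‖s - 1‖ ‖s‖ by 11 · 10.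
  set U : Set ℂ := {s | 1 / 4 < s.re} ∩ Metric.ball 0 10 with hU
  have hUo : IsOpen U := (isOpen_lt continuous_const Complex.continuous_re).inter Metric.isOpen_ball
  have hUc : Convex ℝ U := (convex_halfSpace_re_gt (1 / 4)).inter (convex_ball 0 10)
  have h1 : DifferentiableOn ℂ (fun s => ∑' n, zetaTerm n s) U := by
    have hsum : Summable fun n : ℕ => 11 * 10 * ((n + 1 : ℕ) : ℝ) ^ (-(5 / 4) : ℝ) :=
      ((summable_nat_add_iff 1).2 (Real.summable_nat_rpow.2 (by norm_num))).mul_left _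
    refine Complex.differentiableOn_tsum_of_summable_norm hsum
      (fun n => (differentiable_zetaTerm n).differentiableOn) hUo fun n s hs => ?_
    have hs1 : 1 / 4 < s.re := hs.1
    have hs2 : ‖s‖ < 10 := by simpa using hs.2
    refine (norm_zetaTerm_le (by linarith) n).trans ?_
    have h3 : ‖s - 1‖ ≤ 11 := (norm_sub_le _ _).trans (by simp; linarith)
    push_cast
    gcongr
    · linarith
    · linarith
  have h2 : DifferentiableOn ℂ
      (fun s => (if s = 1 then (1 : ℂ) else (s - 1) * riemannZeta s) - 1) U :=
    (differentiable_sub_one_mul_riemannZeta.sub_const 1).differentiableOn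
  have h3 := (h1.analyticOnNhd hUo).eqOn_of_preconnected_of_eventuallyEq (h2.analyticOnNhd hUo)
    hUc.isPreconnected (z₀ := 2) ⟨by norm_num, by simp; norm_num⟩ (by
      have : ∀ᶠ s : ℂ in 𝓝 2, 1 < s.re :=
        (isOpen_lt continuous_const Complex.continuous_re).mem_nhds (by norm_num : (1 : ℝ) < (2 : ℂ).re)
      filter_upwards [this] with s hs
      have hs1 : s ≠ 1 := by rintro rfl; simp at hs
      simp [hs1, tsum_zetaTerm_of_one_lt hs])
  have h4 : (1 / 2 : ℂ) ∈ U := ⟨by norm_num, by simp; norm_num⟩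
  have h5 := h3 h4
  have h6 : (1 / 2 : ℂ) ≠ 1 := by norm_num
  simpa only [if_neg h6] using h5

/-- The value `ζ(1/2)` as a regularized sum. -/
theorem tendsto_sum_rpow_neg_half :
    Tendsto (fun N : ℕ => ∑ n ∈ Finset.range N, ((n : ℝ) + 1) ^ (-(1 / 2) : ℝ) - 2 * √N) atTop
      (𝓝 (riemannZeta (1 / 2)).re) := by
  have h1 := (summable_zetaTerm (s := 1 / 2) (by norm_num)).hasSum.tendsto_sum_nat
  rw [tsum_zetaTerm_half] at h1
  have h2 := (Complex.continuous_re.tendsto _).comp h1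
  have h3 : Tendsto (fun N : ℕ => √((N : ℝ) + 1) - √N) atTop (𝓝 0) := by
    have h5 : Tendsto (fun N : ℕ => (√((N : ℝ) + 1))⁻¹) atTop (𝓝 0) :=
      tendsto_inv_atTop_zero.comp (Real.tendsto_sqrt_atTop.comp
        (tendsto_atTop_add_const_right _ _ tendsto_natCast_atTop_atTop))
    refine squeeze_zero (fun N => sub_nonneg.2 (Real.sqrt_le_sqrt (by linarith))) (fun N => ?_) h5
    have ha : 0 < √((N : ℝ) + 1) := Real.sqrt_pos.2 (by positivity)
    rw [← sub_nonneg, ← mul_nonneg_iff_of_pos_left ha]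
    have e1 : √((N : ℝ) + 1) * √((N : ℝ) + 1) = N + 1 := Real.mul_self_sqrt (by positivity)
    have e2 : √(N : ℝ) * √N = N := Real.mul_self_sqrt (by positivity)
    have e3 : √(N : ℝ) ≤ √((N : ℝ) + 1) := Real.sqrt_le_sqrt (by linarith)
    rw [mul_sub, mul_inv_cancel₀ ha.ne', mul_sub, e1]
    nlinarith [Real.sqrt_nonneg (N : ℝ)]
  -- At s = 1/2 the partial sums are -(1/2) ∑ (n+1)^(-1/2) + √(N+1) - 1. Multiplying by -2 and
  -- correcting √(N+1) to √N leaves the regularized sum.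
  have h4 := ((h2.const_mul (-2)).add (h3.const_mul 2)).add_const (-2)
  have e : -2 * ((1 / 2 - 1) * riemannZeta (1 / 2) - 1 : ℂ).re + 2 * 0 + -2
      = (riemannZeta (1 / 2)).re := by
    rw [show ((1 / 2 - 1) * riemannZeta (1 / 2) - 1 : ℂ)
      = ((-1 / 2 : ℝ) : ℂ) * riemannZeta (1 / 2) - 1 by push_cast; ring]
    simp only [Complex.sub_re, Complex.re_ofReal_mul, Complex.one_re]
    ring
  rw [e] at h4
  refine h4.congr fun N => ?_
  simp only [Function.comp]
  rw [sum_zetaTerm]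
  have e1 : ∀ n : ℕ, ((n + 1 : ℝ) : ℂ) ^ (-(1 / 2) : ℂ) = (((n : ℝ) + 1) ^ (-(1 / 2) : ℝ) : ℝ) := fun n => by
    rw [Complex.ofReal_cpow (by positivity)]; push_cast; rfl
  have e2 : ((N + 1 : ℝ) : ℂ) ^ (1 - 1 / 2 : ℂ) = (√((N : ℝ) + 1) : ℝ) := by
    rw [Real.sqrt_eq_rpow, Complex.ofReal_cpow (by positivity)]
    congr 1; push_cast; ring
  simp_rw [e1]
  rw [e2, ← Complex.ofReal_sum, show ((1 / 2 : ℂ) - 1) = ((-1 / 2 : ℝ) : ℂ) by push_cast; ring]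
  simp only [Complex.add_re, Complex.sub_re, Complex.re_ofReal_mul, Complex.ofReal_re, Complex.one_re]
  ring

/-! ### The trapezoidal rule on a unit interval, and power bounds for decaying exponentials. -/

/-- Both the trapezoid and the integral are compared with the tangent line at a, for which they
agree. The errors are at most M/2 and M, so the constant is not sharp. -/
theorem abs_trapezoid_sub_integral_le {φ φ' φ'' : ℝ → ℝ} {a M : ℝ}
    (h1 : ∀ x ∈ Set.Icc a (a + 1), HasDerivAt φ (φ' x) x)
    (h2 : ∀ x ∈ Set.Icc a (a + 1), HasDerivAt φ' (φ'' x) x)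
    (hM : ∀ x ∈ Set.Icc a (a + 1), |φ'' x| ≤ M) :
    |(φ a + φ (a + 1)) / 2 - ∫ x in a..a + 1, φ x| ≤ 2 * M := by
  have hM0 : 0 ≤ M := (abs_nonneg _).trans (hM a (Set.left_mem_Icc.2 (by linarith)))
  have hd : ∀ x ∈ Set.Icc a (a + 1), |φ' x - φ' a| ≤ M := fun x hx => by
    have h := (convex_Icc a (a + 1)).norm_image_sub_le_of_norm_hasDerivWithin_le
      (f := φ') (fun y hy => (h2 y hy).hasDerivWithinAt) (fun y hy => by simpa using hM y hy)
      (Set.left_mem_Icc.2 (by linarith)) hx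
    rw [Real.norm_eq_abs, Real.norm_eq_abs, abs_of_nonneg (sub_nonneg.2 hx.1)] at h
    exact h.trans (mul_le_of_le_one_right hM0 (by linarith [hx.2]))
  have hT : ∀ x ∈ Set.Icc a (a + 1), |φ x - (φ a + (x - a) * φ' a)| ≤ M := fun x hx => by
    have h := (convex_Icc a (a + 1)).norm_image_sub_le_of_norm_hasDerivWithin_le
      (f := fun y => φ y - (φ a + (y - a) * φ' a)) (f' := fun y => φ' y - (1 * φ' a))
      (fun y hy => ((h1 y hy).sub
        ((((hasDerivAt_id y).sub_const a).mul_const (φ' a)).const_add (φ a))).hasDerivWithinAt)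
      (fun y hy => by simpa using hd y hy) (Set.left_mem_Icc.2 (by linarith)) hx
    simp only [sub_self, zero_mul, add_zero, sub_zero] at h
    rw [Real.norm_eq_abs, Real.norm_eq_abs, abs_of_nonneg (sub_nonneg.2 hx.1)] at h
    exact h.trans (mul_le_of_le_one_right hM0 (by linarith [hx.2]))
  have hc : ContinuousOn φ (Set.uIcc a (a + 1)) := by
    rw [Set.uIcc_of_le (by linarith)]
    exact fun x hx => (h1 x hx).continuousAt.continuousWithinAt
  have hi : IntervalIntegrable φ volume a (a + 1) := hc.intervalIntegrable
  have hl : ∫ x in a..a + 1, (φ a + (x - a) * φ' a) = φ a + φ' a / 2 := by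
    rw [intervalIntegral.integral_add (by simp) (by
      apply Continuous.intervalIntegrable; fun_prop), intervalIntegral.integral_mul_const,
      intervalIntegral.integral_sub (by simp) (by simp)]
    simp
    ring
  have hI : |∫ x in a..a + 1, (φ x - (φ a + (x - a) * φ' a))| ≤ M := by
    have := intervalIntegral.norm_integral_le_of_norm_le_const (a := a) (b := a + 1) (C := M)
      (f := fun x => φ x - (φ a + (x - a) * φ' a)) (fun x hx => by
        rw [Set.uIoc_of_le (by linarith)] at hx
        exact hT x ⟨hx.1.le, hx.2⟩)
    simpa using this
  rw [intervalIntegral.integral_sub hi (by apply Continuous.intervalIntegrable; fun_prop), hl] at hI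
  have h3 := hT (a + 1) (Set.right_mem_Icc.2 (by linarith))
  rw [abs_le] at *
  constructor <;> linarith

/-- The exponent p is left free: applied to y = s x³ or y = t J x (J + x)/2, it trades powers of the
small parameter against decay in the summation variable. -/
theorem exists_poly_mul_exp_neg_le {p : ℝ} (hp : 0 ≤ p) :
    ∃ C : ℝ, 0 < C ∧ ∀ y : ℝ, 0 < y → (1 + y + y ^ 2) * Real.exp (-y) ≤ C * y ^ (-p) := by
  obtain ⟨n, hn⟩ := exists_nat_ge p
  have key : ∀ y : ℝ, 0 < y → y ^ p * Real.exp (-y) ≤ 1 + n.factorial := fun y hy => by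
    rw [Real.exp_neg, ← div_eq_mul_inv, div_le_iff₀ (Real.exp_pos y)]
    have h1 : y ^ p ≤ 1 + y ^ n := by
      rcases le_total y 1 with h | h
      · have := Real.rpow_le_one hy.le h hp
        have := pow_pos hy n
        linarith
      · have := Real.rpow_le_rpow_of_exponent_le h hn
        rw [Real.rpow_natCast] at this
        linarith
    have h2 : y ^ n ≤ n.factorial * Real.exp y := by
      have := Real.pow_div_factorial_le_exp y hy.le n
      rwa [div_le_iff₀' (by positivity)] at this
    have h3 : 1 ≤ Real.exp y := Real.one_le_exp hy.le
    nlinarith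
  refine ⟨8 * ((1 + n.factorial) * (1 / 2 : ℝ) ^ (-p)), by positivity, fun y hy => ?_⟩
  have h1 : (1 + y + y ^ 2) ≤ 8 * Real.exp (y / 2) := by
    have := Real.quadratic_le_exp_of_nonneg (x := y / 2) (by positivity)
    nlinarith
  have h2 := key (y / 2) (by positivity)
  have h3 : Real.exp (-(y / 2)) ≤ (1 + n.factorial) * (y / 2) ^ (-p) := by
    rw [Real.rpow_neg (by positivity), ← div_eq_mul_inv, le_div_iff₀ (by positivity)]
    linarith
  calc (1 + y + y ^ 2) * Real.exp (-y) ≤ 8 * Real.exp (y / 2) * Real.exp (-y) := by gcongr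
    _ = 8 * Real.exp (-(y / 2)) := by rw [mul_assoc, ← Real.exp_add]; congr 2; ring
    _ ≤ 8 * ((1 + n.factorial) * (y / 2) ^ (-p)) := by gcongr
    _ = _ := by rw [div_eq_mul_one_div y 2, Real.mul_rpow hy.le (by norm_num)]; ring

theorem exists_exp_neg_le {p : ℝ} (hp : 0 ≤ p) :
    ∃ C : ℝ, 0 < C ∧ ∀ y : ℝ, 0 < y → Real.exp (-y) ≤ C * y ^ (-p) := by
  obtain ⟨C, hC, h⟩ := exists_poly_mul_exp_neg_le hp
  exact ⟨C, hC, fun y hy => (le_mul_of_one_le_left (Real.exp_pos _).le (by nlinarith)).trans (h y hy)⟩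

/-! ### Riemann sums of the profile and their remainder. -/

/-- The profile `s x⁴ exp (-s x³)`. -/
noncomputable def profile (s x : ℝ) : ℝ := s * x ^ 4 * Real.exp (-(s * x ^ 3))

noncomputable def profile' (s x : ℝ) : ℝ :=
  (4 * s * x ^ 3 - 3 * s ^ 2 * x ^ 6) * Real.exp (-(s * x ^ 3))

noncomputable def profile'' (s x : ℝ) : ℝ :=
  s * x ^ 2 * (12 - 30 * (s * x ^ 3) + 9 * (s * x ^ 3) ^ 2) * Real.exp (-(s * x ^ 3))

theorem hasDerivAt_profile (s x : ℝ) : HasDerivAt (profile s) (profile' s x) x := by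
  have h := (((hasDerivAt_id x).pow 4).const_mul s).mul
    (((((hasDerivAt_id x).pow 3).const_mul s).neg).exp)
  refine HasDerivAt.congr_deriv h ?_
  simp [profile']
  ring

theorem hasDerivAt_profile' (s x : ℝ) : HasDerivAt (profile' s) (profile'' s x) x := by
  have h := ((((hasDerivAt_id x).pow 3).const_mul (4 * s)).sub
    (((hasDerivAt_id x).pow 6).const_mul (3 * s ^ 2))).mul
    (((((hasDerivAt_id x).pow 3).const_mul s).neg).exp)
  refine HasDerivAt.congr_deriv h ?_
  simp [profile'']
  ring

theorem continuous_profile (s : ℝ) : Continuous (profile s) := by unfold profile; fun_prop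

theorem profile_nonneg {s : ℝ} (hs : 0 ≤ s) (x : ℝ) : 0 ≤ profile s x := by
  unfold profile; have : 0 ≤ x ^ 4 := by positivity
  positivity

theorem profile_eq_rpow (s x : ℝ) :
    profile s x = s * (x ^ (4 : ℝ) * Real.exp (-s * x ^ (3 : ℝ))) := by
  unfold profile; norm_cast; rw [neg_mul, mul_assoc]

theorem exists_profile_le {p : ℝ} (hp : 0 ≤ p) : ∃ C : ℝ, 0 < C ∧ ∀ s x : ℝ, 0 < s → 0 < x →
    profile s x ≤ C * (s ^ (1 - p) * x ^ (4 - 3 * p)) := by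
  obtain ⟨C, hC, h⟩ := exists_exp_neg_le hp
  refine ⟨C, hC, fun s x hs hx => ?_⟩
  have h1 := h (s * x ^ 3) (by positivity)
  calc profile s x ≤ s * x ^ 4 * (C * (s * x ^ 3) ^ (-p)) := by unfold profile; gcongr
    _ = _ := by
      rw [Real.mul_rpow hs.le (by positivity), Real.rpow_sub hs, Real.rpow_sub hx, Real.rpow_one,
        Real.rpow_neg hs.le, Real.rpow_neg (by positivity), ← Real.rpow_natCast x 3,
        ← Real.rpow_mul hx.le, ← Real.rpow_natCast x 4]
      push_cast
      field_simp

theorem exists_profile''_le {p : ℝ} (hp : 0 ≤ p) : ∃ C : ℝ, 0 < C ∧ ∀ s x : ℝ, 0 < s → 0 < x →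
    |profile'' s x| ≤ C * (s ^ (1 - p) * x ^ (2 - 3 * p)) := by
  obtain ⟨C, hC, h⟩ := exists_poly_mul_exp_neg_le hp
  refine ⟨30 * C, by positivity, fun s x hs hx => ?_⟩
  have h1 := h (s * x ^ 3) (by positivity)
  have hy : 0 < s * x ^ 3 := by positivity
  calc |profile'' s x| = s * x ^ 2 * (|12 - 30 * (s * x ^ 3) + 9 * (s * x ^ 3) ^ 2|
        * Real.exp (-(s * x ^ 3))) := by
        unfold profile''
        rw [abs_mul, abs_mul, abs_of_pos (Real.exp_pos _), abs_of_pos (by positivity : 0 < s * x ^ 2)]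
        ring
    _ ≤ s * x ^ 2 * (30 * (1 + s * x ^ 3 + (s * x ^ 3) ^ 2) * Real.exp (-(s * x ^ 3))) := by
        gcongr
        rw [abs_le]; constructor <;> nlinarith [sq_nonneg (s * x ^ 3)]
    _ ≤ s * x ^ 2 * (30 * (C * (s * x ^ 3) ^ (-p))) := by
        rw [mul_assoc 30]; gcongr
    _ = _ := by
      rw [Real.mul_rpow hs.le (by positivity), Real.rpow_sub hs, Real.rpow_sub hx, Real.rpow_one,
        Real.rpow_neg hs.le, Real.rpow_neg (by positivity), ← Real.rpow_natCast x 3,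
        ← Real.rpow_mul hx.le, ← Real.rpow_natCast x 2]
      push_cast
      field_simp

theorem integrableOn_profile {s : ℝ} (hs : 0 < s) : IntegrableOn (profile s) (Set.Ioi 0) := by
  have h := (integrableOn_rpow_mul_exp_neg_mul_rpow (p := 3) (s := 4) (by norm_num) (by norm_num)
    hs).const_mul s
  exact IntegrableOn.congr_fun h (fun x _ => (profile_eq_rpow s x).symm) measurableSet_Ioi

theorem integral_profile {s : ℝ} (hs : 0 < s) :
    ∫ x in Set.Ioi 0, profile s x = Real.Gamma (5 / 3) / 3 * s ^ (-(2 / 3) : ℝ) := by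
  rw [setIntegral_congr_fun measurableSet_Ioi (fun x _ => profile_eq_rpow s x),
    integral_const_mul, integral_rpow_mul_exp_neg_mul_rpow (by norm_num) (by norm_num) hs,
    show (-(2 / 3) : ℝ) = 1 + (-(4 + 1) / 3) by norm_num, Real.rpow_add hs, Real.rpow_one]
  norm_num
  ring

/-- The remainder of the truncated Riemann sum of the profile. -/
noncomputable def profileSub (N : ℕ) (s : ℝ) : ℝ :=
  ∑ j ∈ Finset.range N, profile s (j + 1) - ∫ x in (0 : ℝ)..N, profile s x

theorem summable_profile {s : ℝ} (hs : 0 < s) : Summable fun j : ℕ => profile s (j + 1) := by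
  obtain ⟨C, hC, h⟩ := exists_profile_le (p := 2) (by norm_num)
  have h1 : Summable fun j : ℕ => C * (s ^ (1 - 2 : ℝ) * ((j + 1 : ℕ) : ℝ) ^ (4 - 3 * 2 : ℝ)) :=
    (((summable_nat_add_iff 1).2 (Real.summable_nat_rpow.2 (by norm_num))).mul_left _).mul_left _
  refine h1.of_nonneg_of_le (fun j => profile_nonneg hs.le _) fun j => ?_
  push_cast
  exact h s (j + 1) hs (by positivity)

/-- The sum `∑_{j ≥ 1} s j⁴ exp (-s j³)`. -/
noncomputable def profileSum (s : ℝ) : ℝ := ∑' j : ℕ, profile s (j + 1)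

noncomputable def profileRem (s : ℝ) : ℝ :=
  profileSum s - Real.Gamma (5 / 3) / 3 * s ^ (-(2 / 3) : ℝ)

theorem tendsto_profileSub {s : ℝ} (hs : 0 < s) :
    Tendsto (fun N => profileSub N s) atTop (𝓝 (profileRem s)) := by
  refine (summable_profile hs).hasSum.tendsto_sum_nat.sub ?_
  rw [← integral_profile hs]
  exact intervalIntegral_tendsto_integral_Ioi 0 (integrableOn_profile hs) tendsto_natCast_atTop_atTop

/-- The profile vanishes at 0, so only the endpoint N contributes a half weight. -/
theorem sum_trapezoid_profile (N : ℕ) (s : ℝ) :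
    profileSub N s = profile s N / 2 +
      ∑ j ∈ Finset.range N, ((profile s j + profile s (j + 1)) / 2
        - ∫ x in (j : ℝ)..j + 1, profile s x) := by
  induction N with
  | zero => simp [profileSub, profile]
  | succ N ih =>
    rw [Finset.sum_range_succ, ← add_assoc, ← sub_eq_iff_eq_add'.2 ih, profileSub,
      Finset.sum_range_succ, profileSub, ← intervalIntegral.integral_add_adjacent_intervals
        (b := (N : ℝ)) ((continuous_profile s).intervalIntegrable _ _)
        ((continuous_profile s).intervalIntegrable _ _)]
    push_cast
    ring

/-- For x ≥ 1 the choice p = 7/6 gives exactly s^(-1/6) x^(-3/2), and for x ≤ 1 the choice p = 0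
suffices. The decay in x is summable over unit intervals at the small cost s^(-1/6). -/
theorem exists_profile''_le_of_le_one : ∃ C : ℝ, 0 < C ∧ ∀ s x : ℝ, 0 < s → s ≤ 1 → 0 ≤ x →
    |profile'' s x| ≤ C * (s ^ (-(1 / 6) : ℝ) * (1 + x) ^ (-(3 / 2) : ℝ)) := by
  obtain ⟨C, hC, h⟩ := exists_profile''_le (p := 7 / 6) (by norm_num)
  obtain ⟨D, hD, h'⟩ := exists_profile''_le (p := 0) (by norm_num)
  refine ⟨2 ^ (3 / 2 : ℝ) * (C + D), by positivity, fun s x hs hs1 hx => ?_⟩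
  have hs6 : 1 ≤ s ^ (-(1 / 6) : ℝ) := Real.one_le_rpow_of_pos_of_le_one_of_nonpos hs hs1 (by norm_num)
  rcases hx.eq_or_lt with rfl | hx0
  · simp [profile'']; positivity
  have e : 2 ^ (3 / 2 : ℝ) * (2 : ℝ) ^ (-(3 / 2) : ℝ) = 1 := by
    rw [← Real.rpow_add (by norm_num)]; norm_num
  rcases le_total x 1 with hx1 | hx1
  · have h1 := h' s x hs hx0
    norm_num at h1
    have h2 : (2 : ℝ) ^ (-(3 / 2) : ℝ) ≤ (1 + x) ^ (-(3 / 2) : ℝ) :=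
      Real.rpow_le_rpow_of_nonpos (by positivity) (by linarith) (by norm_num)
    calc |profile'' s x| ≤ D * (s * x ^ 2) := h1
      _ ≤ D * (1 * 1 ^ 2) := by gcongr
      _ = D * (1 * (2 ^ (3 / 2 : ℝ) * (2 : ℝ) ^ (-(3 / 2) : ℝ))) := by rw [e]; ring
      _ ≤ (C + D) * (s ^ (-(1 / 6) : ℝ) * (2 ^ (3 / 2 : ℝ) * (1 + x) ^ (-(3 / 2) : ℝ))) := by
        gcongr; linarith
      _ = _ := by ring
  · have h1 := h s x hs hx0
    norm_num at h1
    have h2 : (2 * x) ^ (-(3 / 2) : ℝ) ≤ (1 + x) ^ (-(3 / 2) : ℝ) :=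
      Real.rpow_le_rpow_of_nonpos (by positivity) (by linarith) (by norm_num)
    rw [Real.mul_rpow (by norm_num) hx] at h2
    calc |profile'' s x| ≤ C * (s ^ (-(1 / 6) : ℝ) * x ^ (-(3 / 2) : ℝ)) := by
          simpa [neg_div] using h1
      _ = C * (s ^ (-(1 / 6) : ℝ) *
          (2 ^ (3 / 2 : ℝ) * (2 ^ (-(3 / 2) : ℝ) * x ^ (-(3 / 2) : ℝ)))) := by
          rw [← mul_assoc (2 ^ (3 / 2 : ℝ)), e, one_mul]
      _ ≤ (C + D) * (s ^ (-(1 / 6) : ℝ) * (2 ^ (3 / 2 : ℝ) * (1 + x) ^ (-(3 / 2) : ℝ))) := by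
        gcongr; linarith
      _ = _ := by ring

theorem exists_profileSub_sub_le : ∃ C : ℝ, 0 < C ∧ ∀ (N : ℕ) (s : ℝ), 0 < s → s ≤ 1 →
    |profileSub N s - profile s N / 2| ≤ C * s ^ (-(1 / 6) : ℝ) := by
  obtain ⟨C, hC, h⟩ := exists_profile''_le_of_le_one
  have hsum : Summable fun j : ℕ => ((j + 1 : ℕ) : ℝ) ^ (-(3 / 2) : ℝ) :=
    (summable_nat_add_iff 1).2 (Real.summable_nat_rpow.2 (by norm_num))
  set K := ∑' j : ℕ, ((j + 1 : ℕ) : ℝ) ^ (-(3 / 2) : ℝ) with hK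
  have hK0 : 0 ≤ K := tsum_nonneg fun j => by positivity
  refine ⟨2 * C * (K + 1), by positivity, fun N s hs hs1 => ?_⟩
  rw [sum_trapezoid_profile, add_sub_cancel_left]
  refine (Finset.abs_sum_le_sum_abs _ _).trans ?_
  have h1 : ∀ j ∈ Finset.range N, |(profile s j + profile s (j + 1)) / 2
        - ∫ x in (j : ℝ)..j + 1, profile s x|
        ≤ 2 * (C * s ^ (-(1 / 6) : ℝ)) * ((j + 1 : ℕ) : ℝ) ^ (-(3 / 2) : ℝ) := fun j _ => by
    rw [mul_assoc]
    refine abs_trapezoid_sub_integral_le (fun x _ => hasDerivAt_profile s x)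
      (fun x _ => hasDerivAt_profile' s x) fun x hx => ?_
    have hj : (0 : ℝ) ≤ j := j.cast_nonneg
    refine (h s x hs hs1 (hj.trans hx.1)).trans ?_
    rw [← mul_assoc]
    refine mul_le_mul_of_nonneg_left ?_ (by positivity)
    refine Real.rpow_le_rpow_of_nonpos (by positivity) ?_ (by norm_num)
    push_cast; linarith [hx.1]
  refine (Finset.sum_le_sum h1).trans ?_
  rw [← Finset.mul_sum]
  have h2 := hsum.sum_le_tsum (Finset.range N) (fun j _ => by positivity)
  rw [← hK] at h2
  have h3 : 0 < s ^ (-(1 / 6) : ℝ) := by positivity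
  calc _ ≤ 2 * (C * s ^ (-(1 / 6) : ℝ)) * (K + 1) := by gcongr; linarith
    _ = _ := by ring

theorem exists_profileSub_le_of_one_le : ∃ C : ℝ, 0 < C ∧ ∀ (N : ℕ) (s : ℝ), 1 ≤ s →
    |profileSub N s| ≤ C * s ^ (-(2 / 3) : ℝ) := by
  obtain ⟨C, hC, h⟩ := exists_profile_le (p := 2) (by norm_num)
  have hsum : Summable fun j : ℕ => ((j + 1 : ℕ) : ℝ) ^ (4 - 3 * 2 : ℝ) :=
    (summable_nat_add_iff 1).2 (Real.summable_nat_rpow.2 (by norm_num))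
  set K := ∑' j : ℕ, ((j + 1 : ℕ) : ℝ) ^ (4 - 3 * 2 : ℝ) with hK
  have hK0 : 0 ≤ K := tsum_nonneg fun j => by positivity
  have hG : 0 < Real.Gamma (5 / 3) := Real.Gamma_pos_of_pos (by norm_num)
  refine ⟨C * K + Real.Gamma (5 / 3) / 3, by positivity, fun N s hs1 => ?_⟩
  have hs : 0 < s := by linarith
  have a1 : 0 ≤ ∑ j ∈ Finset.range N, profile s (j + 1) :=
    Finset.sum_nonneg fun j _ => profile_nonneg hs.le _
  have a2 : ∑ j ∈ Finset.range N, profile s (j + 1) ≤ C * K * s ^ (-(2 / 3) : ℝ) := by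
    calc ∑ j ∈ Finset.range N, profile s (j + 1)
        ≤ ∑ j ∈ Finset.range N, C * s ^ (1 - 2 : ℝ) * ((j + 1 : ℕ) : ℝ) ^ (4 - 3 * 2 : ℝ) := by
          refine Finset.sum_le_sum fun j _ => ?_
          push_cast
          rw [mul_assoc]
          exact h s (j + 1) hs (by positivity)
      _ ≤ C * s ^ (1 - 2 : ℝ) * K := by
          rw [← Finset.mul_sum]
          exact mul_le_mul_of_nonneg_left (hsum.sum_le_tsum _ (fun j _ => by positivity))
            (by positivity)
      _ ≤ C * s ^ (-(2 / 3) : ℝ) * K := by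
          gcongr
          norm_num
      _ = _ := by ring
  have a3 : 0 ≤ ∫ x in (0 : ℝ)..N, profile s x :=
    intervalIntegral.integral_nonneg N.cast_nonneg fun x _ => profile_nonneg hs.le x
  have a4 : ∫ x in (0 : ℝ)..N, profile s x ≤ Real.Gamma (5 / 3) / 3 * s ^ (-(2 / 3) : ℝ) := by
    rw [← integral_profile hs, intervalIntegral.integral_of_le N.cast_nonneg]
    refine setIntegral_mono_set (integrableOn_profile hs)
      (Eventually.of_forall fun x => profile_nonneg hs.le x) ?_
    exact Set.Ioc_subset_Ioi_self.eventuallyLE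
  rw [profileSub, abs_le, add_mul]
  have : 0 ≤ C * K * s ^ (-(2 / 3) : ℝ) := by positivity
  have : 0 ≤ Real.Gamma (5 / 3) / 3 * s ^ (-(2 / 3) : ℝ) := by positivity
  constructor <;> linarith

/-- The endpoint term is controlled uniformly in N by p = 4/3, for which the power of x in
`exists_profile_le` is x⁰. The resulting s^(-1/3) is worse than s^(-1/6), but stays integrable
against s^(-1/2) near 0. -/
theorem exists_profileSub_le : ∃ C : ℝ, 0 < C ∧ ∀ (N : ℕ) (s : ℝ), 0 < s → s ≤ 1 →
    |profileSub N s| ≤ C * s ^ (-(1 / 3) : ℝ) := by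
  obtain ⟨C, hC, h⟩ := exists_profileSub_sub_le
  obtain ⟨D, hD, h'⟩ := exists_profile_le (p := 4 / 3) (by norm_num)
  refine ⟨C + D, by positivity, fun N s hs hs1 => ?_⟩
  have h1 := h N s hs hs1
  have h2 : profile s N ≤ D * s ^ (-(1 / 3) : ℝ) := by
    rcases N.eq_zero_or_pos with rfl | hN
    · simp [profile]; positivity
    · have := h' s N hs (by exact_mod_cast hN)
      norm_num at this
      simpa [neg_div] using this
  have h3 : s ^ (-(1 / 6) : ℝ) ≤ s ^ (-(1 / 3) : ℝ) :=
    Real.rpow_le_rpow_of_exponent_ge hs hs1 (by norm_num)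
  have h4 := profile_nonneg hs.le (N : ℝ)
  have h5 : C * s ^ (-(1 / 6) : ℝ) ≤ C * s ^ (-(1 / 3) : ℝ) := by gcongr
  rw [abs_le] at *
  constructor <;> linarith

theorem tendsto_profile_atTop {s : ℝ} (hs : 0 < s) :
    Tendsto (fun N : ℕ => profile s N) atTop (𝓝 0) := by
  have := (summable_profile hs).tendsto_atTop_zero
  rw [← tendsto_add_atTop_iff_nat 1]
  simpa using this

/-- As N tends to infinity the endpoint term disappears, which restores the exponent -1/6 for small
s. -/
theorem exists_profileRem_le : ∃ C : ℝ, 0 < C ∧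
    (∀ s : ℝ, 0 < s → |profileRem s| ≤ C * s ^ (-(1 / 6) : ℝ)) ∧
    (∀ s : ℝ, 1 ≤ s → |profileRem s| ≤ C * s ^ (-(2 / 3) : ℝ)) := by
  obtain ⟨C, hC, h⟩ := exists_profileSub_sub_le
  obtain ⟨D, hD, h'⟩ := exists_profileSub_le_of_one_le
  have h2 : ∀ s : ℝ, 1 ≤ s → |profileRem s| ≤ D * s ^ (-(2 / 3) : ℝ) := fun s hs =>
    le_of_tendsto (tendsto_profileSub (by linarith)).abs (Eventually.of_forall fun N => h' N s hs)
  refine ⟨C + D, by positivity, fun s hs => ?_, fun s hs => (h2 s hs).trans (by gcongr; linarith)⟩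
  rcases le_total s 1 with hs1 | hs1
  · have h3 := ((tendsto_profileSub hs).sub ((tendsto_profile_atTop hs).div_const 2)).abs
    simp only [zero_div, sub_zero] at h3
    refine (le_of_tendsto h3 (Eventually.of_forall fun N => h N s hs hs1)).trans ?_
    gcongr; linarith
  · refine (h2 s hs1).trans ?_
    have : s ^ (-(2 / 3) : ℝ) ≤ s ^ (-(1 / 6) : ℝ) :=
      Real.rpow_le_rpow_of_exponent_le hs1 (by norm_num)
    gcongr; linarith

/-! ### The Mellin transform of the remainder and ζ(1/2). -/

theorem rpow_mul_profile_eq {s x : ℝ} (hs : 0 < s) :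
    s ^ (-(1 / 2) : ℝ) * profile s x = x ^ 4 * (s ^ (3 / 2 - 1 : ℝ) * Real.exp (-(x ^ 3 * s))) := by
  have e : s ^ (3 / 2 - 1 : ℝ) = s ^ (-(1 / 2) : ℝ) * s := by
    rw [← Real.rpow_add_one hs.ne']; norm_num
  rw [e, profile, mul_comm (x ^ 3) s]
  ring

theorem integral_rpow_mul_profile {x : ℝ} (hx : 0 < x) :
    ∫ s in Set.Ioi 0, s ^ (-(1 / 2) : ℝ) * profile s x
      = Real.Gamma (3 / 2) * x ^ (-(1 / 2) : ℝ) := by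
  rw [setIntegral_congr_fun measurableSet_Ioi (fun s hs => rpow_mul_profile_eq hs),
    integral_const_mul, Real.integral_rpow_mul_exp_neg_mul_Ioi (by norm_num) (by positivity),
    one_div, Real.inv_rpow (by positivity), ← Real.rpow_natCast x 3, ← Real.rpow_mul hx.le,
    ← Real.rpow_natCast x 4, ← Real.rpow_neg hx.le, ← mul_assoc, ← Real.rpow_add hx, mul_comm]
  norm_num

theorem integrableOn_rpow_mul_profile {x : ℝ} (hx : 0 < x) :
    IntegrableOn (fun s => s ^ (-(1 / 2) : ℝ) * profile s x) (Set.Ioi 0) := by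
  have h := (integrableOn_rpow_mul_exp_neg_mul_rpow (p := 1) (s := 3 / 2 - 1) (b := x ^ 3)
    (by norm_num) (by norm_num) (by positivity)).const_mul (x ^ 4)
  refine IntegrableOn.congr_fun h (fun s hs => ?_) measurableSet_Ioi
  simp only [rpow_mul_profile_eq hs, Real.rpow_one, neg_mul]

theorem integrable_prod_rpow_mul_profile (N : ℕ) :
    Integrable (Function.uncurry fun (x s : ℝ) => s ^ (-(1 / 2) : ℝ) * profile s x)
      ((volume.restrict (Set.Ioc (0 : ℝ) N)).prod (volume.restrict (Set.Ioi (0 : ℝ)))) := by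
  have hm : AEStronglyMeasurable
      (Function.uncurry fun (x s : ℝ) => s ^ (-(1 / 2) : ℝ) * profile s x)
      ((volume.restrict (Set.Ioc (0 : ℝ) N)).prod (volume.restrict (Set.Ioi (0 : ℝ)))) := by
    apply Measurable.aestronglyMeasurable
    unfold profile Function.uncurry
    fun_prop
  rw [integrable_prod_iff hm]
  constructor
  · filter_upwards [ae_restrict_mem measurableSet_Ioc] with x hx
    exact integrableOn_rpow_mul_profile hx.1
  · have h1 : IntegrableOn (fun x : ℝ => Real.Gamma (3 / 2) * x ^ (-(1 / 2) : ℝ)) (Set.Ioc 0 N) := by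
      have := (intervalIntegral.intervalIntegrable_rpow' (a := 0) (b := N) (r := -(1 / 2))
        (by norm_num)).const_mul (Real.Gamma (3 / 2))
      rwa [intervalIntegrable_iff_integrableOn_Ioc_of_le N.cast_nonneg] at this
    refine IntegrableOn.congr_fun h1 (fun x hx => ?_) measurableSet_Ioc
    rw [← integral_rpow_mul_profile hx.1]
    refine setIntegral_congr_fun measurableSet_Ioi fun s hs => ?_
    have := profile_nonneg (le_of_lt hs) x
    have h2 : 0 ≤ s ^ (-(1 / 2) : ℝ) := Real.rpow_nonneg (le_of_lt hs) _
    simp only [Function.uncurry, Real.norm_eq_abs, abs_of_nonneg (mul_nonneg h2 this)]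

theorem integral_rpow_mul_integral_profile (N : ℕ) :
    ∫ s in Set.Ioi 0, s ^ (-(1 / 2) : ℝ) * ∫ x in (0 : ℝ)..N, profile s x
      = Real.Gamma (3 / 2) * (2 * √N) := by
  have h := integral_integral_swap (integrable_prod_rpow_mul_profile N)
  calc _ = ∫ s in Set.Ioi 0, ∫ x in Set.Ioc (0 : ℝ) N, s ^ (-(1 / 2) : ℝ) * profile s x := by
        refine setIntegral_congr_fun measurableSet_Ioi fun s _ => ?_
        simp only [intervalIntegral.integral_of_le N.cast_nonneg, integral_const_mul]
    _ = ∫ x in Set.Ioc (0 : ℝ) N, Real.Gamma (3 / 2) * x ^ (-(1 / 2) : ℝ) := by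
        rw [← h]
        exact setIntegral_congr_fun measurableSet_Ioc fun x hx => integral_rpow_mul_profile hx.1
    _ = _ := by
        rw [integral_const_mul, ← intervalIntegral.integral_of_le N.cast_nonneg,
          integral_rpow (Or.inl (by norm_num)), Real.sqrt_eq_rpow]
        norm_num
        ring_nf
        simp

/-- Truncation at N makes the sum and the integral separately integrable in s, so each can be
transformed by itself: every profile gives Γ(3/2) x^(-1/2). -/
theorem integral_rpow_mul_profileSub (N : ℕ) :
    ∫ s in Set.Ioi 0, s ^ (-(1 / 2) : ℝ) * profileSub N s
      = Real.Gamma (3 / 2) *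
        (∑ n ∈ Finset.range N, ((n : ℝ) + 1) ^ (-(1 / 2) : ℝ) - 2 * √N) := by
  have h2 : IntegrableOn (fun s : ℝ => s ^ (-(1 / 2) : ℝ) * ∫ x in (0 : ℝ)..N, profile s x)
      (Set.Ioi 0) := by
    have := (integrable_prod_rpow_mul_profile N).integral_prod_right
    refine IntegrableOn.congr_fun this (fun s _ => ?_) measurableSet_Ioi
    simp only [intervalIntegral.integral_of_le N.cast_nonneg, integral_const_mul, Function.uncurry]
  have h1 : ∀ j ∈ Finset.range N,
      IntegrableOn (fun s : ℝ => s ^ (-(1 / 2) : ℝ) * profile s (j + 1)) (Set.Ioi 0) :=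
    fun j _ => integrableOn_rpow_mul_profile (by positivity)
  simp_rw [profileSub, mul_sub, Finset.mul_sum]
  rw [integral_sub (integrable_finsetSum _ h1) h2, integral_finsetSum _ h1,
    integral_rpow_mul_integral_profile]
  congr 1
  exact Finset.sum_congr rfl fun j _ => integral_rpow_mul_profile (by positivity)

theorem measurable_profileSub (N : ℕ) : Measurable (profileSub N) := by
  unfold profileSub
  refine Measurable.sub (Finset.measurable_sum _ fun j _ => by unfold profile; fun_prop) ?_
  simp_rw [intervalIntegral.integral_of_le (N.cast_nonneg : (0 : ℝ) ≤ N)]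
  refine StronglyMeasurable.measurable ?_
  refine StronglyMeasurable.integral_prod_right (f := fun s x => profile s x) ?_
  apply Measurable.stronglyMeasurable
  unfold profile Function.uncurry
  fun_prop

/-- Integrable majorant of the normalized remainder. -/
noncomputable def remBound (s : ℝ) : ℝ := if s ≤ 1 then s ^ (-(5 / 6) : ℝ) else s ^ (-(7 / 6) : ℝ)

theorem integrableOn_remBound : IntegrableOn remBound (Set.Ioi 0) := by
  rw [← Set.Ioc_union_Ioi_eq_Ioi (zero_le_one' ℝ)]
  refine IntegrableOn.union ?_ ?_
  · have := intervalIntegral.intervalIntegrable_rpow' (a := 0) (b := 1) (r := -(5 / 6)) (by norm_num)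
    rw [intervalIntegrable_iff_integrableOn_Ioc_of_le zero_le_one] at this
    exact IntegrableOn.congr_fun this (fun s hs => (if_pos hs.2).symm) measurableSet_Ioc
  · exact IntegrableOn.congr_fun (integrableOn_Ioi_rpow_of_lt (by norm_num) zero_lt_one)
      (fun s hs => (if_neg (not_le.2 hs)).symm) measurableSet_Ioi

/-- The exponents -1/2 - 1/3 = -5/6 near 0 and -1/2 - 2/3 = -7/6 near infinity lie on the two sides
of -1, so the majorant is integrable and independent of N. -/
theorem exists_rpow_mul_profileSub_le : ∃ C : ℝ, 0 < C ∧ ∀ (N : ℕ) (s : ℝ), 0 < s →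
    |s ^ (-(1 / 2) : ℝ) * profileSub N s| ≤ C * remBound s := by
  obtain ⟨C, hC, h⟩ := exists_profileSub_le
  obtain ⟨D, hD, h'⟩ := exists_profileSub_le_of_one_le
  refine ⟨C + D, by positivity, fun N s hs => ?_⟩
  have hp : 0 < s ^ (-(1 / 2) : ℝ) := by positivity
  rw [abs_mul, abs_of_pos hp, remBound]
  split_ifs with hs1
  · calc _ ≤ s ^ (-(1 / 2) : ℝ) * ((C + D) * s ^ (-(1 / 3) : ℝ)) := by
          gcongr; refine (h N s hs hs1).trans ?_; gcongr; linarith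
      _ = (C + D) * (s ^ (-(1 / 2) : ℝ) * s ^ (-(1 / 3) : ℝ)) := by ring
      _ = _ := by rw [← Real.rpow_add hs]; norm_num
  · calc _ ≤ s ^ (-(1 / 2) : ℝ) * ((C + D) * s ^ (-(2 / 3) : ℝ)) := by
          gcongr; refine (h' N s (not_le.1 hs1).le).trans ?_; gcongr; linarith
      _ = (C + D) * (s ^ (-(1 / 2) : ℝ) * s ^ (-(2 / 3) : ℝ)) := by ring
      _ = _ := by rw [← Real.rpow_add hs]; norm_num

theorem tendsto_rpow_mul_profileSub {s : ℝ} (hs : s ∈ Set.Ioi (0 : ℝ)) :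
    Tendsto (fun N => s ^ (-(1 / 2) : ℝ) * profileSub N s) atTop
      (𝓝 (s ^ (-(1 / 2) : ℝ) * profileRem s)) :=
  (tendsto_profileSub hs).const_mul _

theorem aestronglyMeasurable_rpow_mul_profileRem : AEStronglyMeasurable
    (fun s => s ^ (-(1 / 2) : ℝ) * profileRem s) (volume.restrict (Set.Ioi 0)) :=
  aestronglyMeasurable_of_tendsto_ae atTop (f := fun N s => s ^ (-(1 / 2) : ℝ) * profileSub N s)
    (fun N => ((measurable_id.pow_const _).mul (measurable_profileSub N)).aestronglyMeasurable)
    (by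
      filter_upwards [ae_restrict_mem measurableSet_Ioi] with s hs
      exact tendsto_rpow_mul_profileSub hs)

theorem integrableOn_rpow_mul_profileRem :
    IntegrableOn (fun s => s ^ (-(1 / 2) : ℝ) * profileRem s) (Set.Ioi 0) := by
  obtain ⟨C, hC, h⟩ := exists_rpow_mul_profileSub_le
  refine Integrable.mono' (integrableOn_remBound.const_mul C)
    aestronglyMeasurable_rpow_mul_profileRem ?_
  filter_upwards [ae_restrict_mem measurableSet_Ioi] with s hs
  exact le_of_tendsto (tendsto_rpow_mul_profileSub hs).norm (Eventually.of_forall fun N => h N s hs)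

/-- Dominated convergence in N turns the truncated Mellin transforms into the regularized sum that
defines ζ(1/2). -/
theorem integral_rpow_mul_profileRem :
    ∫ s in Set.Ioi 0, s ^ (-(1 / 2) : ℝ) * profileRem s
      = Real.Gamma (3 / 2) * (riemannZeta (1 / 2)).re := by
  obtain ⟨C, hC, h⟩ := exists_rpow_mul_profileSub_le
  have h1 := tendsto_integral_of_dominated_convergence (μ := volume.restrict (Set.Ioi 0))
    (F := fun N s => s ^ (-(1 / 2) : ℝ) * profileSub N s)
    (f := fun s => s ^ (-(1 / 2) : ℝ) * profileRem s) (fun s => C * remBound s)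
    (fun N => ((measurable_id.pow_const _).mul (measurable_profileSub N)).aestronglyMeasurable)
    (integrableOn_remBound.const_mul C)
    (fun N => by filter_upwards [ae_restrict_mem measurableSet_Ioi] with s hs using h N s hs)
    (by filter_upwards [ae_restrict_mem measurableSet_Ioi] with s hs
        exact tendsto_rpow_mul_profileSub hs)
  simp_rw [integral_rpow_mul_profileSub] at h1
  exact tendsto_nhds_unique h1 (tendsto_sum_rpow_neg_half.const_mul _)

/-! ### The trapezoidal rule on a half line, and symmetric double sums. -/

theorem sum_trapezoid (φ : ℝ → ℝ) (hc : Continuous φ) (a : ℝ) (N : ℕ) :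
    ∑ m ∈ Finset.range N, ((φ (a + m) + φ (a + m + 1)) / 2 - ∫ x in a + m..a + m + 1, φ x)
      = φ a / 2 + ∑ m ∈ Finset.range N, φ (a + m + 1) - φ (a + N) / 2 - ∫ x in a..a + N, φ x := by
  induction N with
  | zero => simp
  | succ N ih =>
    rw [Finset.sum_range_succ, ih, Finset.sum_range_succ,
      ← intervalIntegral.integral_add_adjacent_intervals (a := a) (b := a + N)
        (c := a + (N + 1 : ℕ)) (hc.intervalIntegrable _ _) (hc.intervalIntegrable _ _)]
    push_cast
    simp only [← add_assoc]
    ring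

/-- The trapezoidal rule on a half line. -/
theorem abs_trapezoid_sub_integral_Ioi_le {φ φ' φ'' : ℝ → ℝ} {a : ℝ} {b : ℕ → ℝ}
    (h1 : ∀ x, HasDerivAt φ (φ' x) x) (h2 : ∀ x, HasDerivAt φ' (φ'' x) x)
    (hb : ∀ (m : ℕ), ∀ x ∈ Set.Icc (a + m) (a + m + 1), |φ'' x| ≤ b m)
    (hbs : Summable b) (hs : Summable fun m : ℕ => φ (a + m + 1)) (hi : IntegrableOn φ (Set.Ioi a)) :
    |φ a / 2 + ∑' m : ℕ, φ (a + m + 1) - ∫ x in Set.Ioi a, φ x| ≤ 2 * ∑' m, b m := by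
  have hc : Continuous φ := continuous_iff_continuousAt.2 fun x => (h1 x).continuousAt
  have hb0 : ∀ m, 0 ≤ b m := fun m =>
    (abs_nonneg _).trans (hb m (a + m) (Set.left_mem_Icc.2 (by linarith)))
  have hbound : ∀ N : ℕ, |φ a / 2 + ∑ m ∈ Finset.range N, φ (a + m + 1) - φ (a + N) / 2
      - ∫ x in a..a + N, φ x| ≤ 2 * ∑' m, b m := fun N => by
    rw [← sum_trapezoid φ hc]
    refine (Finset.abs_sum_le_sum_abs _ _).trans ?_
    refine (Finset.sum_le_sum fun m _ => abs_trapezoid_sub_integral_le (fun x _ => h1 x)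
      (fun x _ => h2 x) (hb m)).trans ?_
    rw [← Finset.mul_sum]
    exact mul_le_mul_of_nonneg_left (hbs.sum_le_tsum _ fun m _ => hb0 m) zero_le_two
  have t1 : Tendsto (fun N : ℕ => φ (a + N)) atTop (𝓝 0) := by
    rw [← tendsto_add_atTop_iff_nat 1]
    simpa [add_assoc] using hs.tendsto_atTop_zero
  have t2 : Tendsto (fun N : ℕ => ∫ x in a..a + N, φ x) atTop (𝓝 (∫ x in Set.Ioi a, φ x)) :=
    intervalIntegral_tendsto_integral_Ioi a hi
      (tendsto_atTop_add_const_left _ _ tendsto_natCast_atTop_atTop)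
  have t3 := (((hs.hasSum.tendsto_sum_nat.const_add (φ a / 2)).sub (t1.div_const 2)).sub t2).abs
  simp only [zero_div, sub_zero] at t3
  exact le_of_tendsto t3 (Eventually.of_forall hbound)

/-- The index set splits into the diagonal and two triangles exchanged by the swap. The diagonal
then has weight 1 against 2, which is the half weight that the trapezoidal rule gives to an
endpoint. -/
theorem tsum_prod_symm {f : ℕ × ℕ → ℝ} (hf : Summable f) (hsymm : ∀ p, f p.swap = f p) :
    ∑' p, f p = ∑' j, (f (j, j) + 2 * ∑' m, f (j, j + m + 1)) := by
  have e1i : Function.Injective (fun j : ℕ => ((j, j) : ℕ × ℕ)) := fun a b h => by simpa using h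
  have e2i : Function.Injective (fun p : ℕ × ℕ => ((p.1, p.1 + p.2 + 1) : ℕ × ℕ)) := by
    rintro ⟨a, b⟩ ⟨c, d⟩ h
    simp only [Prod.mk.injEq] at h ⊢
    omega
  have e3i : Function.Injective (fun p : ℕ × ℕ => ((p.1 + p.2 + 1, p.1) : ℕ × ℕ)) := by
    rintro ⟨a, b⟩ ⟨c, d⟩ h
    simp only [Prod.mk.injEq] at h ⊢
    omega
  set D : Set (ℕ × ℕ) := {p | p.1 = p.2} with hD
  set L : Set (ℕ × ℕ) := {p | p.1 < p.2} with hL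
  set G : Set (ℕ × ℕ) := {p | p.2 < p.1} with hG
  have hsplit : ∀ p, f p = D.indicator f p + L.indicator f p + G.indicator f p := by
    intro p
    rcases lt_trichotomy p.1 p.2 with h | h | h
    · have h1 : p ∉ D := fun h' => h.ne h'
      have h2 : p ∉ G := fun h' => lt_asymm h h'
      simp [h1, h2, show p ∈ L from h]
    · have h1 : p ∉ L := fun h' => h'.ne h
      have h2 : p ∉ G := fun h' => h'.ne' h
      simp [h1, h2, show p ∈ D from h]
    · have h1 : p ∉ D := fun h' => h.ne' h'
      have h2 : p ∉ L := fun h' => lt_asymm h h'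
      simp [h1, h2, show p ∈ G from h]
  have s2 : Summable fun p : ℕ × ℕ => f (p.1, p.1 + p.2 + 1) := hf.comp_injective e2i
  have t1 : ∑' p, D.indicator f p = ∑' j, f (j, j) := by
    rw [← e1i.tsum_eq]
    · exact tsum_congr fun j => Set.indicator_of_mem (show (j, j) ∈ D from rfl) f
    · rintro ⟨a, b⟩ h
      have : a = b := (Set.mem_of_indicator_ne_zero h : (a, b) ∈ D)
      exact ⟨a, by simp [this]⟩
  have t2 : ∑' p, L.indicator f p = ∑' j, ∑' m, f (j, j + m + 1) := by
    rw [← e2i.tsum_eq]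
    · have : ∀ p : ℕ × ℕ, L.indicator f (p.1, p.1 + p.2 + 1) = f (p.1, p.1 + p.2 + 1) := fun p =>
        Set.indicator_of_mem (show (p.1, p.1 + p.2 + 1) ∈ L from Nat.lt_succ_of_le (p.1.le_add_right p.2)) f
      simp_rw [this]
      exact s2.tsum_prod
    · rintro ⟨a, b⟩ h
      have : a < b := (Set.mem_of_indicator_ne_zero h : (a, b) ∈ L)
      exact ⟨(a, b - a - 1), by simp only [Prod.mk.injEq, true_and]; omega⟩
  have t3 : ∑' p, G.indicator f p = ∑' j, ∑' m, f (j, j + m + 1) := by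
    rw [← e3i.tsum_eq]
    · have : ∀ p : ℕ × ℕ, G.indicator f (p.1 + p.2 + 1, p.1) = f (p.1, p.1 + p.2 + 1) := fun p => by
        rw [Set.indicator_of_mem (show (p.1 + p.2 + 1, p.1) ∈ G from
          Nat.lt_succ_of_le (p.1.le_add_right p.2)) f, ← hsymm]
        rfl
      simp_rw [this]
      exact s2.tsum_prod
    · rintro ⟨a, b⟩ h
      have : b < a := (Set.mem_of_indicator_ne_zero h : (a, b) ∈ G)
      exact ⟨(b, a - b - 1), by simp only [Prod.mk.injEq, and_true]; omega⟩
  have s1 : Summable fun j => f (j, j) := hf.comp_injective e1i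
  rw [tsum_congr hsplit, ((hf.indicator D).add (hf.indicator L)).tsum_add (hf.indicator G),
    (hf.indicator D).tsum_add (hf.indicator L), t1, t2, t3, s1.tsum_add (s2.prod.mul_left 2),
    tsum_mul_left]
  ring

/-! ### The inner sum over one index, compared with an integral. -/

/-- The function `x ↦ y exp (-y)` at `y = t J x (J + x) / 2`. -/
noncomputable def slice (t J x : ℝ) : ℝ :=
  (t * (J * x * (J + x) / 2)) * Real.exp (-(t * (J * x * (J + x) / 2)))

noncomputable def slice' (t J x : ℝ) : ℝ :=
  t * J * (J + 2 * x) / 2 * ((1 - t * (J * x * (J + x) / 2)) * Real.exp (-(t * (J * x * (J + x) / 2))))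

noncomputable def slice'' (t J x : ℝ) : ℝ :=
  t * J * ((1 - t * (J * x * (J + x) / 2)) * Real.exp (-(t * (J * x * (J + x) / 2)))) +
  (t * J * (J + 2 * x) / 2) ^ 2 *
    ((t * (J * x * (J + x) / 2) - 2) * Real.exp (-(t * (J * x * (J + x) / 2))))

theorem hasDerivAt_sliceArg (t J x : ℝ) :
    HasDerivAt (fun x => t * (J * x * (J + x) / 2)) (t * J * (J + 2 * x) / 2) x := by
  have h := (((((hasDerivAt_id x).const_mul J).mul ((hasDerivAt_id x).const_add J)).div_const 2).const_mul t)
  refine HasDerivAt.congr_deriv h ?_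
  simp
  ring

theorem hasDerivAt_slice (t J x : ℝ) : HasDerivAt (slice t J) (slice' t J x) x := by
  have h := hasDerivAt_sliceArg t J x
  refine HasDerivAt.congr_deriv (h.mul h.neg.exp) ?_
  simp only [slice', Pi.neg_apply]
  ring

theorem hasDerivAt_slice' (t J x : ℝ) : HasDerivAt (slice' t J) (slice'' t J x) x := by
  have h := hasDerivAt_sliceArg t J x
  have h2 : HasDerivAt (fun x => t * J * (J + 2 * x) / 2) (t * J) x := by
    have := ((((hasDerivAt_id x).const_mul 2).const_add J).const_mul (t * J)).div_const 2
    refine HasDerivAt.congr_deriv this ?_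
    simp
  refine HasDerivAt.congr_deriv (h2.mul ((h.const_sub 1).mul h.neg.exp)) ?_
  simp only [slice'', Pi.neg_apply]
  ring

theorem slice_nonneg {t J x : ℝ} (ht : 0 ≤ t) (hJ : 0 ≤ J) (hx : 0 ≤ x) : 0 ≤ slice t J x := by
  unfold slice; positivity

theorem continuous_slice (t J : ℝ) : Continuous (slice t J) := by unfold slice; fun_prop

theorem exists_slice_le : ∃ C : ℝ, 0 < C ∧ ∀ t J x : ℝ, 0 < t → 0 < J → 0 < x →
    slice t J x ≤ C * (t⁻¹ * (J * x * (J + x))⁻¹) := by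
  obtain ⟨C, hC, h⟩ := exists_poly_mul_exp_neg_le (p := 1) (by norm_num)
  refine ⟨2 * C, by positivity, fun t J x ht hJ hx => ?_⟩
  have hy : 0 < t * (J * x * (J + x) / 2) := by positivity
  have := h _ hy
  rw [Real.rpow_neg_one] at this
  calc slice t J x ≤ (1 + t * (J * x * (J + x) / 2) + (t * (J * x * (J + x) / 2)) ^ 2) *
        Real.exp (-(t * (J * x * (J + x) / 2))) := by
        unfold slice; gcongr; nlinarith
    _ ≤ _ := this
    _ = _ := by field_simp

/-- With p = 7/6 the loss in t is only t^(-1/6). Since J ≤ x, part of the decay in x can be moved to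
J, so that both exponents end up below -1 and the bound is summable in both variables. -/
theorem exists_slice''_le : ∃ C : ℝ, 0 < C ∧ ∀ t J x : ℝ, 0 < t → 0 < J → J ≤ x →
    |slice'' t J x| ≤ C * (t ^ (-(1 / 6) : ℝ) * J ^ (-(4 / 3) : ℝ) * x ^ (-(7 / 6) : ℝ)) := by
  obtain ⟨C, hC, h⟩ := exists_poly_mul_exp_neg_le (p := 7 / 6) (by norm_num)
  refine ⟨10 * (C * 2 ^ (7 / 6 : ℝ)), by positivity, fun t J x ht hJ hJx => ?_⟩
  have hx : 0 < x := hJ.trans_le hJx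
  have hy : 0 < t * (J * x * (J + x) / 2) := by positivity
  have h1 := h _ hy
  set y := t * (J * x * (J + x) / 2) with hy_def
  -- The squared first derivative of the exponent is absorbed by its second derivative tJ times y.
  -- This is where J ≤ x enters.
  have hsq : (t * J * (J + 2 * x) / 2) ^ 2 ≤ t * J * (3 * y) := by
    have e : (t * J * (J + 2 * x) / 2) ^ 2 = t * J * (t * J * ((J + 2 * x) ^ 2 / 4)) := by ring
    have e2 : t * J * (3 * y) = t * J * (t * J * (3 * x * (J + x) / 2)) := by rw [hy_def]; ring
    rw [e, e2]
    refine mul_le_mul_of_nonneg_left (mul_le_mul_of_nonneg_left ?_ (by positivity)) (by positivity)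
    nlinarith
  have h2 : |slice'' t J x| ≤ t * J * (10 * ((1 + y + y ^ 2) * Real.exp (-y))) := by
    have hE := Real.exp_pos (-y)
    calc |slice'' t J x| ≤ |t * J * ((1 - y) * Real.exp (-y))|
          + |(t * J * (J + 2 * x) / 2) ^ 2 * ((y - 2) * Real.exp (-y))| := abs_add_le _ _
      _ = t * J * (|1 - y| * Real.exp (-y))
          + (t * J * (J + 2 * x) / 2) ^ 2 * (|y - 2| * Real.exp (-y)) := by
          rw [abs_mul (t * J), abs_mul (1 - y), abs_mul (_ ^ 2), abs_mul (y - 2), abs_of_pos hE,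
            abs_of_pos (mul_pos ht hJ), abs_of_nonneg (sq_nonneg (t * J * (J + 2 * x) / 2))]
      _ ≤ t * J * ((1 + y) * Real.exp (-y)) + t * J * (3 * y) * ((y + 2) * Real.exp (-y)) := by
          gcongr
          · rw [abs_le]; constructor <;> linarith
          · rw [abs_le]; constructor <;> linarith
      _ ≤ _ := by
          rw [← sub_nonneg]
          have : t * J * (10 * ((1 + y + y ^ 2) * Real.exp (-y))) - (t * J * ((1 + y) * Real.exp (-y))
            + t * J * (3 * y) * ((y + 2) * Real.exp (-y)))
            = t * J * Real.exp (-y) * (9 + 3 * y + 7 * y ^ 2) := by ring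
          rw [this]; positivity
  have h3 : y ^ (-(7 / 6) : ℝ) ≤ (t * J * x ^ 2 / 2) ^ (-(7 / 6) : ℝ) := by
    refine Real.rpow_le_rpow_of_nonpos (by positivity) ?_ (by norm_num)
    have : t * J * x ^ 2 ≤ t * J * (x * (J + x)) := by gcongr; nlinarith
    rw [hy_def]; linarith
  have h4 : x ^ (-(7 / 6) : ℝ) ≤ J ^ (-(7 / 6) : ℝ) :=
    Real.rpow_le_rpow_of_nonpos hJ hJx (by norm_num)
  calc |slice'' t J x| ≤ t * J * (10 * ((1 + y + y ^ 2) * Real.exp (-y))) := h2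
    _ ≤ t * J * (10 * (C * (t * J * x ^ 2 / 2) ^ (-(7 / 6) : ℝ))) := by
      refine mul_le_mul_of_nonneg_left (mul_le_mul_of_nonneg_left ?_ (by norm_num)) (by positivity)
      exact h1.trans (by gcongr)
    _ = 10 * (C * 2 ^ (7 / 6 : ℝ)) * ((t * t ^ (-(7 / 6) : ℝ)) *
          (J * J ^ (-(7 / 6) : ℝ)) * (x ^ (-(7 / 6) : ℝ) * x ^ (-(7 / 6) : ℝ))) := by
      rw [Real.div_rpow (by positivity) (by norm_num), Real.mul_rpow (by positivity) (by positivity),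
        Real.mul_rpow ht.le hJ.le, Real.rpow_neg (by norm_num : (0 : ℝ) ≤ 2), div_inv_eq_mul, pow_two,
        Real.mul_rpow hx.le hx.le]
      ring
    _ ≤ 10 * (C * 2 ^ (7 / 6 : ℝ)) * ((t * t ^ (-(7 / 6) : ℝ)) *
          (J * J ^ (-(7 / 6) : ℝ)) * (J ^ (-(7 / 6) : ℝ) * x ^ (-(7 / 6) : ℝ))) := by gcongr
    _ = _ := by
      have e1 : t * t ^ (-(7 / 6) : ℝ) = t ^ (-(1 / 6) : ℝ) := by
        rw [mul_comm, ← Real.rpow_add_one ht.ne']; norm_num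
      have e2 : J * J ^ (-(7 / 6) : ℝ) * J ^ (-(7 / 6) : ℝ) = J ^ (-(4 / 3) : ℝ) := by
        rw [mul_comm J, ← Real.rpow_add_one hJ.ne', ← Real.rpow_add hJ]; norm_num
      rw [e1, ← e2]; ring

theorem inv_le_rpow_mul_rpow {J x : ℝ} (hJ : 0 < J) (hx : 0 < x) :
    (J * x * (J + x))⁻¹ ≤ J ^ (-(3 / 2) : ℝ) * x ^ (-(3 / 2) : ℝ) := by
  rw [← Real.mul_rpow hJ.le hx.le, Real.rpow_neg (by positivity)]
  gcongr
  have h1 : (J * x) ^ (3 / 2 : ℝ) = (J * x) * √(J * x) := by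
    rw [show (3 / 2 : ℝ) = 1 + 1 / 2 by norm_num, Real.rpow_add (by positivity), Real.rpow_one,
      Real.sqrt_eq_rpow]
  rw [h1]
  gcongr
  rw [Real.sqrt_le_left (by positivity)]
  nlinarith

theorem summable_rpow_mul_rpow {r : ℝ} (hr : r < -1) :
    Summable fun p : ℕ × ℕ => ((p.1 + 1 : ℕ) : ℝ) ^ r * ((p.2 + 1 : ℕ) : ℝ) ^ r := by
  have h : Summable fun j : ℕ => ((j + 1 : ℕ) : ℝ) ^ r :=
    (summable_nat_add_iff 1).2 (Real.summable_nat_rpow.2 hr)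
  exact h.mul_of_nonneg h (fun j => by positivity) (fun j => by positivity)

theorem summable_slice {t : ℝ} (ht : 0 < t) :
    Summable fun p : ℕ × ℕ => slice t (p.1 + 1) (p.2 + 1) := by
  obtain ⟨C, hC, h⟩ := exists_slice_le
  refine ((summable_rpow_mul_rpow (r := -(3 / 2)) (by norm_num)).mul_left (C * t⁻¹)).of_nonneg_of_le
    (fun p => slice_nonneg ht.le (by positivity) (by positivity)) fun p => ?_
  have h1 := h t (p.1 + 1) (p.2 + 1) ht (by positivity) (by positivity)
  rw [← mul_assoc] at h1
  refine h1.trans ?_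
  push_cast
  exact mul_le_mul_of_nonneg_left (inv_le_rpow_mul_rpow (by positivity) (by positivity))
    (by positivity)

theorem exists_setIntegral_slice_le : ∃ C : ℝ, 0 < C ∧ ∀ t J : ℝ, 0 < t → 0 < J →
    IntegrableOn (slice t J) (Set.Ioi J) ∧
    ∫ x in Set.Ioi J, slice t J x ≤ C * (t⁻¹ * (J ^ 2)⁻¹) := by
  obtain ⟨C, hC, h⟩ := exists_slice_le
  refine ⟨C, hC, fun t J ht hJ => ?_⟩
  have hi : IntegrableOn (fun x => C * (t⁻¹ * J⁻¹) * x ^ (-2 : ℝ)) (Set.Ioi J) :=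
    (integrableOn_Ioi_rpow_of_lt (by norm_num) hJ).const_mul _
  have hle : ∀ x ∈ Set.Ioi J, slice t J x ≤ C * (t⁻¹ * J⁻¹) * x ^ (-2 : ℝ) := fun x hx => by
    have hx0 : 0 < x := hJ.trans hx
    refine (h t J x ht hJ hx0).trans ?_
    rw [mul_assoc C, mul_assoc t⁻¹, Real.rpow_neg hx0.le, Real.rpow_two, mul_assoc J, mul_inv J]
    gcongr
    nlinarith
  have hint : IntegrableOn (slice t J) (Set.Ioi J) := by
    refine Integrable.mono' hi (continuous_slice t J).aestronglyMeasurable ?_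
    filter_upwards [ae_restrict_mem measurableSet_Ioi] with x hx
    have hx0 : 0 < x := hJ.trans hx
    rw [Real.norm_of_nonneg (slice_nonneg ht.le hJ.le hx0.le)]
    exact hle x hx
  refine ⟨hint, (setIntegral_mono_on hint hi measurableSet_Ioi hle).trans ?_⟩
  rw [integral_const_mul, integral_Ioi_rpow_of_lt (by norm_num) hJ]
  norm_num
  rw [Real.rpow_neg_one]
  apply le_of_eq
  field_simp

/-- Folding by symmetry and applying the trapezoidal rule on (J, ∞) for each J leaves no diagonal
correction, because the diagonal carries the endpoint weight. The errors, of size t^(-1/6) J^(-4/3),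
are summable over J. -/
theorem exists_abs_tsum_slice_sub_le : ∃ C : ℝ, 0 < C ∧ ∀ t : ℝ, 0 < t →
    |∑' p : ℕ × ℕ, slice t (p.1 + 1) (p.2 + 1)
      - 2 * ∑' j : ℕ, ∫ x in Set.Ioi ((j : ℝ) + 1), slice t (j + 1) x| ≤ C * t ^ (-(1 / 6) : ℝ) := by
  obtain ⟨C, hC, h⟩ := exists_slice''_le
  obtain ⟨D, hD, h'⟩ := exists_setIntegral_slice_le
  have hs1 : Summable fun m : ℕ => ((m + 1 : ℕ) : ℝ) ^ (-(7 / 6) : ℝ) :=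
    (summable_nat_add_iff 1).2 (Real.summable_nat_rpow.2 (by norm_num))
  have hs2 : Summable fun m : ℕ => ((m + 1 : ℕ) : ℝ) ^ (-(4 / 3) : ℝ) :=
    (summable_nat_add_iff 1).2 (Real.summable_nat_rpow.2 (by norm_num))
  set K := ∑' m : ℕ, ((m + 1 : ℕ) : ℝ) ^ (-(7 / 6) : ℝ)
  set K' := ∑' m : ℕ, ((m + 1 : ℕ) : ℝ) ^ (-(4 / 3) : ℝ)
  have hK : 0 ≤ K := tsum_nonneg fun _ => by positivity
  have hK' : 0 ≤ K' := tsum_nonneg fun _ => by positivity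
  refine ⟨4 * C * K * K' + 1, by positivity, fun t ht => ?_⟩
  have hsum := summable_slice ht
  have hsym : ∀ p : ℕ × ℕ, slice t (p.swap.1 + 1) (p.swap.2 + 1) = slice t (p.1 + 1) (p.2 + 1) :=
    fun p => by
      have : ((p.2 : ℝ) + 1) * (p.1 + 1) * (p.2 + 1 + (p.1 + 1))
        = (p.1 + 1) * (p.2 + 1) * (p.1 + 1 + (p.2 + 1)) := by ring
      simp only [slice, Prod.fst_swap, Prod.snd_swap, this]
  have hdiag : Summable fun j : ℕ => slice t (j + 1) (j + 1) :=
    hsum.comp_injective (i := fun j : ℕ => (j, j)) fun a b h => by simpa using h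
  have hoff : Summable fun p : ℕ × ℕ => slice t (p.1 + 1) ((p.1 + p.2 + 1 : ℕ) + 1) :=
    hsum.comp_injective (i := fun p : ℕ × ℕ => (p.1, p.1 + p.2 + 1)) (by
      rintro ⟨a, b⟩ ⟨c, d⟩ h
      simp only [Prod.mk.injEq] at h ⊢
      omega)
  have hI : Summable fun j : ℕ => ∫ x in Set.Ioi ((j : ℝ) + 1), slice t (j + 1) x := by
    have h2 : Summable fun m : ℕ => ((m + 1 : ℕ) : ℝ) ^ (-2 : ℝ) :=
      (summable_nat_add_iff 1).2 (Real.summable_nat_rpow.2 (by norm_num))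
    refine (h2.mul_left (D * t⁻¹)).of_nonneg_of_le (fun j => ?_) fun j => ?_
    · exact setIntegral_nonneg measurableSet_Ioi fun x hx =>
        slice_nonneg ht.le (by positivity) (le_trans (by positivity) (le_of_lt hx))
    · refine (h' t (j + 1) ht (by positivity)).2.trans (le_of_eq ?_)
      rw [Real.rpow_neg (by positivity)]
      norm_cast
      ring
  rw [tsum_prod_symm hsum hsym, ← tsum_mul_left, ← (hdiag.add (hoff.prod.mul_left 2)).tsum_sub
    (hI.mul_left 2)]
  have hterm : ∀ j : ℕ, |slice t (j + 1) (j + 1)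
      + 2 * ∑' m : ℕ, slice t (j + 1) ((j + m + 1 : ℕ) + 1)
      - 2 * ∫ x in Set.Ioi ((j : ℝ) + 1), slice t (j + 1) x|
      ≤ 4 * C * K * t ^ (-(1 / 6) : ℝ) * ((j + 1 : ℕ) : ℝ) ^ (-(4 / 3) : ℝ) := fun j => by
    have hfac : Summable fun m : ℕ => slice t (j + 1) ((j + 1 : ℝ) + m + 1) := by
      refine (hoff.prod_factor j).congr fun m => ?_
      push_cast; ring_nf
    have key := abs_trapezoid_sub_integral_Ioi_le (a := (j : ℝ) + 1)
      (b := fun m => C * t ^ (-(1 / 6) : ℝ) * ((j + 1 : ℕ) : ℝ) ^ (-(4 / 3) : ℝ)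
        * ((m + 1 : ℕ) : ℝ) ^ (-(7 / 6) : ℝ))
      (hasDerivAt_slice t (j + 1)) (hasDerivAt_slice' t (j + 1))
      (fun m x hx => by
        have hj0 : (0 : ℝ) ≤ j := j.cast_nonneg
        have hm0 : (0 : ℝ) ≤ m := m.cast_nonneg
        refine (h t (j + 1) x ht (by positivity) (by linarith [hx.1])).trans ?_
        have : x ^ (-(7 / 6) : ℝ) ≤ ((m + 1 : ℕ) : ℝ) ^ (-(7 / 6) : ℝ) :=
          Real.rpow_le_rpow_of_nonpos (by positivity) (by push_cast; linarith [hx.1]) (by norm_num)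
        push_cast at this ⊢
        rw [mul_assoc C, mul_assoc C]
        gcongr)
      (hs1.mul_left _) hfac (h' t (j + 1) ht (by positivity)).1
    rw [tsum_mul_left] at key
    have e : ∑' m : ℕ, slice t (j + 1) ((j + m + 1 : ℕ) + 1)
        = ∑' m : ℕ, slice t (j + 1) ((j + 1 : ℝ) + m + 1) :=
      tsum_congr fun m => by push_cast; ring_nf
    rw [e]
    calc _ = 2 * |slice t (j + 1) (j + 1) / 2 + ∑' m : ℕ, slice t (j + 1) ((j + 1 : ℝ) + m + 1)
          - ∫ x in Set.Ioi ((j : ℝ) + 1), slice t (j + 1) x| := by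
          rw [← abs_two, ← abs_mul, abs_two]; congr 1; ring
      _ ≤ 2 * (2 * (C * t ^ (-(1 / 6) : ℝ) * ((j + 1 : ℕ) : ℝ) ^ (-(4 / 3) : ℝ) * K)) := by
          gcongr
      _ = _ := by ring
  have hs3 := hs2.mul_left (4 * C * K * t ^ (-(1 / 6) : ℝ))
  refine (norm_tsum_le_tsum_norm (f := fun j : ℕ => slice t (j + 1) (j + 1)
      + 2 * ∑' m : ℕ, slice t (j + 1) ((j + m + 1 : ℕ) + 1)
      - 2 * ∫ x in Set.Ioi ((j : ℝ) + 1), slice t (j + 1) x)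
    (hs3.of_nonneg_of_le (fun _ => abs_nonneg _) hterm)).trans ?_
  refine (Summable.tsum_le_tsum hterm (hs3.of_nonneg_of_le (fun _ => abs_nonneg _) hterm)
    hs3).trans ?_
  rw [tsum_mul_left]
  have : 0 < t ^ (-(1 / 6) : ℝ) := by positivity
  calc _ = 4 * C * K * K' * t ^ (-(1 / 6) : ℝ) := by ring
    _ ≤ _ := by gcongr; linarith

/-! ### Separation of variables and the two-term expansion of the double sum. -/

/-- Density of the change of variables `w (w + 1) / 2 = l`. -/
noncomputable def rho (l : ℝ) : ℝ := 2 / √(1 + 8 * l)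

theorem rho_nonneg (l : ℝ) : 0 ≤ rho l := by unfold rho; positivity

theorem measurable_rho : Measurable rho := by unfold rho; fun_prop

theorem image_sliceRatio {J : ℝ} (hJ : 0 < J) :
    (fun x => x * (J + x) / (2 * J ^ 2)) '' Set.Ioi J = Set.Ioi 1 := by
  ext l
  simp only [Set.mem_image, Set.mem_Ioi]
  constructor
  · rintro ⟨x, hx, rfl⟩
    rw [lt_div_iff₀ (by positivity)]
    nlinarith
  · intro hl
    have h3 : 3 < √(1 + 8 * l) := by
      rw [Real.lt_sqrt (by norm_num)]; linarith
    have hsq := Real.sq_sqrt (show 0 ≤ 1 + 8 * l by linarith)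
    refine ⟨J * ((√(1 + 8 * l) - 1) / 2), by nlinarith, ?_⟩
    set r := √(1 + 8 * l)
    rw [div_eq_iff (by positivity)]
    have : J * ((r - 1) / 2) * (J + J * ((r - 1) / 2)) = J ^ 2 * ((r ^ 2 - 1) / 4) := by ring
    rw [this, hsq]; ring

theorem rho_sliceRatio {J x : ℝ} (hJ : 0 < J) (hx : 0 < x) :
    rho (x * (J + x) / (2 * J ^ 2)) = 2 * J / (J + 2 * x) := by
  have : 1 + 8 * (x * (J + x) / (2 * J ^ 2)) = ((J + 2 * x) / J) ^ 2 := by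
    field_simp; ring
  rw [rho, this, Real.sqrt_sq (by positivity)]
  field_simp

/-- With l = x (J + x)/(2J²) the exponent becomes t l J³, and the Jacobian 2J²/(J + 2x) is J times
`rho l`. All dependence on J now sits in the profile, while the range l > 1 no longer depends on J.
-/
theorem setIntegral_slice_eq {t J : ℝ} (hJ : 0 < J) :
    ∫ x in Set.Ioi J, slice t J x = ∫ l in Set.Ioi 1, profile (t * l) J * rho l := by
  have hinj : Set.InjOn (fun x => x * (J + x) / (2 * J ^ 2)) (Set.Ioi J) := by
    refine StrictMonoOn.injOn fun x hx y hy hxy => ?_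
    have hx' : J < x := hx
    refine (div_lt_div_iff_of_pos_right (by positivity)).2 ?_
    nlinarith
  have hder : ∀ x ∈ Set.Ioi J, HasDerivWithinAt (fun x => x * (J + x) / (2 * J ^ 2))
      ((J + 2 * x) / (2 * J ^ 2)) (Set.Ioi J) x := fun x _ => by
    have h := ((hasDerivAt_id x).mul ((hasDerivAt_id x).const_add J)).div_const (2 * J ^ 2)
    refine (HasDerivAt.congr_deriv h ?_).hasDerivWithinAt
    simp
    ring
  rw [← image_sliceRatio hJ, integral_image_eq_integral_abs_deriv_smul measurableSet_Ioi hder hinj]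
  refine setIntegral_congr_fun measurableSet_Ioi fun x hx => ?_
  have hx0 : 0 < x := hJ.trans hx
  simp only [smul_eq_mul]
  rw [rho_sliceRatio hJ hx0, abs_of_pos (by positivity), slice, profile]
  have e : t * (x * (J + x) / (2 * J ^ 2)) * J ^ 3 = t * (J * x * (J + x) / 2) := by
    field_simp
  rw [e]
  field_simp

/-- If l = w (w + 1)/2, then x = 1/(1 + w) satisfies l = (1 - x)/(2x²), and w > 1 corresponds to x <
1/2. -/
theorem image_betaRatio :
    (fun x : ℝ => (1 - x) / (2 * x ^ 2)) '' Set.Ioo 0 (1 / 2) = Set.Ioi 1 := by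
  ext l
  simp only [Set.mem_image, Set.mem_Ioi, Set.mem_Ioo]
  constructor
  · rintro ⟨x, ⟨hx, hx2⟩, rfl⟩
    rw [lt_div_iff₀ (by positivity)]
    nlinarith
  · intro hl
    have h3 : 3 < √(1 + 8 * l) := by
      rw [Real.lt_sqrt (by norm_num)]; linarith
    have hsq := Real.sq_sqrt (show 0 ≤ 1 + 8 * l by linarith)
    set r := √(1 + 8 * l)
    refine ⟨2 / (1 + r), ⟨by positivity, ?_⟩, ?_⟩
    · rw [div_lt_div_iff₀ (by positivity) (by norm_num)]; linarith
    · have h1 : 0 < 1 + r := by linarith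
      have : (1 - 2 / (1 + r)) / (2 * (2 / (1 + r)) ^ 2) = (r ^ 2 - 1) / 8 := by
        field_simp; ring
      rw [this, hsq]; ring

theorem betaIntegral_third :
    ∫ x in (0 : ℝ)..1, x ^ (-(2 / 3) : ℝ) * (1 - x) ^ (-(2 / 3) : ℝ)
      = Real.Gamma (1 / 3) ^ 2 / Real.Gamma (2 / 3) := by
  have h := Complex.Gamma_mul_Gamma_eq_betaIntegral (s := ((1 / 3 : ℝ) : ℂ)) (t := ((1 / 3 : ℝ) : ℂ))
    (by simp) (by simp)
  have hb : Complex.betaIntegral ((1 / 3 : ℝ) : ℂ) ((1 / 3 : ℝ) : ℂ)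
      = ((∫ x in (0 : ℝ)..1, x ^ (-(2 / 3) : ℝ) * (1 - x) ^ (-(2 / 3) : ℝ) : ℝ) : ℂ) := by
    rw [Complex.betaIntegral, ← intervalIntegral.integral_ofReal]
    refine intervalIntegral.integral_congr fun x hx => ?_
    rw [Set.uIcc_of_le zero_le_one] at hx
    rw [Complex.ofReal_mul, Complex.ofReal_cpow hx.1, Complex.ofReal_cpow (sub_nonneg.2 hx.2)]
    push_cast
    norm_num
  rw [hb, ← Complex.ofReal_add, Complex.Gamma_ofReal, Complex.Gamma_ofReal] at h
  norm_cast at h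
  norm_num at h
  have hG : Real.Gamma (2 / 3) ≠ 0 := (Real.Gamma_pos_of_pos (by norm_num)).ne'
  rw [eq_div_iff hG, pow_two]
  norm_num
  linarith

theorem intervalIntegrable_beta_half :
    IntervalIntegrable (fun x : ℝ => x ^ (-(2 / 3) : ℝ) * (1 - x) ^ (-(2 / 3) : ℝ)) volume 0 (1 / 2) := by
  refine (intervalIntegral.intervalIntegrable_rpow' (by norm_num)).mul_continuousOn ?_
  refine ContinuousOn.rpow_const (by fun_prop) fun x hx => Or.inl ?_
  rw [Set.uIcc_of_le (by norm_num)] at hx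
  linarith [hx.2]

/-- Both parameters of the beta integral are 1/3, so the integrand is symmetric about 1/2. -/
theorem betaIntegral_third_half :
    ∫ x in (0 : ℝ)..(1 / 2), x ^ (-(2 / 3) : ℝ) * (1 - x) ^ (-(2 / 3) : ℝ)
      = Real.Gamma (1 / 3) ^ 2 / Real.Gamma (2 / 3) / 2 := by
  set f : ℝ → ℝ := fun x => x ^ (-(2 / 3) : ℝ) * (1 - x) ^ (-(2 / 3) : ℝ) with hf
  have hfs : ∀ x, f (1 - x) = f x := fun x => by simp only [hf, sub_sub_cancel, mul_comm]
  have h1 : ∫ x in (1 / 2 : ℝ)..1, f x = ∫ x in (0 : ℝ)..(1 / 2), f x := by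
    have := intervalIntegral.integral_comp_sub_left (a := 0) (b := 1 / 2) f 1
    simp only [hfs] at this
    rw [this]; norm_num
  have h2 : IntervalIntegrable f volume (1 / 2) 1 := by
    have := (intervalIntegrable_beta_half.comp_sub_left 1).symm
    simp only [sub_sub_cancel] at this
    norm_num at this
    refine this.congr fun x _ => ?_
    simp only [hf]; rw [mul_comm]
  have h3 := intervalIntegral.integral_add_adjacent_intervals intervalIntegrable_beta_half h2
  have h4 := betaIntegral_third
  change ∫ x in (0 : ℝ)..1, f x = _ at h4
  change (∫ x in (0 : ℝ)..(1 / 2), f x) + _ = _ at h3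
  rw [h1, h4] at h3
  linarith

/-- Under l = (1 - x)/(2x²) the discriminant 1 + 8l is the square of (2 - x)/x. The factor 2 - x
cancels between `rho` and the Jacobian, leaving a beta integrand on (0, 1/2). -/
theorem integral_rpow_mul_rho :
    ∫ l in Set.Ioi (1 : ℝ), l ^ (-(2 / 3) : ℝ) * rho l
      = 2 ^ (-(1 / 3) : ℝ) * (Real.Gamma (1 / 3) ^ 2 / Real.Gamma (2 / 3)) := by
  have hinj : Set.InjOn (fun x : ℝ => (1 - x) / (2 * x ^ 2)) (Set.Ioo 0 (1 / 2)) := by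
    refine StrictAntiOn.injOn fun x hx y hy hxy => ?_
    have hx' : 0 < x := hx.1
    have hy' : 0 < y := hy.1
    refine (div_lt_div_iff₀ (by positivity) (by positivity)).2 ?_
    have h1 : x ^ 2 < y ^ 2 := by gcongr
    have h2 : 0 < 1 - y := by linarith [hy.2]
    nlinarith
  have hder : ∀ x ∈ Set.Ioo (0 : ℝ) (1 / 2), HasDerivWithinAt (fun x => (1 - x) / (2 * x ^ 2))
      (-((2 - x) / (2 * x ^ 3))) (Set.Ioo 0 (1 / 2)) x := fun x hx => by
    have hx' : x ≠ 0 := hx.1.ne'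
    have h := ((hasDerivAt_id x).const_sub 1).div (((hasDerivAt_id x).pow 2).const_mul 2)
      (by simpa using hx')
    refine (HasDerivAt.congr_deriv h ?_).hasDerivWithinAt
    simp
    field_simp
    ring
  rw [← image_betaRatio, integral_image_eq_integral_abs_deriv_smul measurableSet_Ioo hder hinj]
  have h2 : ∫ x in Set.Ioo (0 : ℝ) (1 / 2), |-((2 - x) / (2 * x ^ 3))| •
      (((1 - x) / (2 * x ^ 2)) ^ (-(2 / 3) : ℝ) * rho ((1 - x) / (2 * x ^ 2)))
      = ∫ x in Set.Ioo (0 : ℝ) (1 / 2), 2 ^ (2 / 3 : ℝ) *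
        (x ^ (-(2 / 3) : ℝ) * (1 - x) ^ (-(2 / 3) : ℝ)) := by
    refine setIntegral_congr_fun measurableSet_Ioo fun x hx => ?_
    have hx' : 0 < x := hx.1
    have h1 : 0 < 1 - x := by linarith [hx.2]
    have h2 : 0 < 2 - x := by linarith [hx.2]
    have e : 1 + 8 * ((1 - x) / (2 * x ^ 2)) = ((2 - x) / x) ^ 2 := by field_simp; ring
    simp only [smul_eq_mul]
    rw [abs_neg, abs_of_pos (by positivity), rho, e, Real.sqrt_sq (by positivity),
      Real.div_rpow h1.le (by positivity), Real.mul_rpow (by norm_num) (by positivity),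
      ← Real.rpow_natCast x 2, ← Real.rpow_mul hx'.le, Real.rpow_neg (by norm_num : (0 : ℝ) ≤ 2)]
    have e2 : x ^ (-(2 / 3) : ℝ) = (x ^ (((2 : ℕ) : ℝ) * (-(2 / 3))))⁻¹ * (x ^ 2)⁻¹ := by
      rw [← Real.rpow_neg hx'.le, ← Real.rpow_natCast, ← Real.rpow_neg hx'.le, ← Real.rpow_add hx']
      norm_num
    rw [e2]
    field_simp
  rw [h2, ← integral_Ioc_eq_integral_Ioo, integral_const_mul,
    ← intervalIntegral.integral_of_le (by norm_num), betaIntegral_third_half,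
    show (2 / 3 : ℝ) = -(1 / 3) + 1 by norm_num, Real.rpow_add_one (by norm_num)]
  ring

theorem rho_le {l : ℝ} (hl : 0 < l) : rho l ≤ l ^ (-(1 / 2) : ℝ) := by
  rw [rho, Real.rpow_neg hl.le, ← Real.sqrt_eq_rpow, ← one_div,
    div_le_div_iff₀ (by positivity) (by positivity), one_mul]
  refine Real.le_sqrt_of_sq_le ?_
  rw [mul_pow, Real.sq_sqrt hl.le]
  linarith

theorem abs_rho_sub_le {l : ℝ} (hl : 1 ≤ l) :
    |rho l - 2 ^ (-(1 / 2) : ℝ) * l ^ (-(1 / 2) : ℝ)| ≤ l ^ (-1 : ℝ) := by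
  have hl0 : 0 < l := by linarith
  have e : (2 : ℝ) ^ (-(1 / 2) : ℝ) * l ^ (-(1 / 2) : ℝ) = 2 / √(8 * l) := by
    rw [← Real.mul_rpow (by norm_num) hl0.le, Real.rpow_neg (by positivity), ← Real.sqrt_eq_rpow,
      show 8 * l = 2 ^ 2 * (2 * l) by ring, Real.sqrt_mul (x := 2 ^ 2) (by norm_num), Real.sqrt_sq (by norm_num),
      ← div_div, div_self two_ne_zero, one_div]
  rw [e, rho, Real.rpow_neg_one]
  have ha : 0 < √(8 * l) := by positivity
  have ha2 := Real.sq_sqrt (show 0 ≤ 8 * l by positivity)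
  have hb2 := Real.sq_sqrt (show 0 ≤ 1 + 8 * l by positivity)
  have hab : √(8 * l) ≤ √(1 + 8 * l) := Real.sqrt_le_sqrt (by linarith)
  set a := √(8 * l)
  set b := √(1 + 8 * l)
  have hb : 0 < b := by linarith
  have hba : b ≤ a + 1 := by nlinarith
  have hl8 : l⁻¹ = 8 / a ^ 2 := by rw [ha2]; field_simp
  rw [hl8, abs_sub_comm, abs_of_nonneg (sub_nonneg.2 (by gcongr)), div_sub_div _ _ ha.ne' hb.ne',
    div_le_div_iff₀ (by positivity) (by positivity)]
  have h1 : (2 * b - a * 2) * a ^ 2 ≤ 2 * a ^ 2 := by nlinarith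
  nlinarith

theorem aestronglyMeasurable_profileRem_comp {t : ℝ} (ht : 0 < t) :
    AEStronglyMeasurable (fun l => profileRem (t * l)) (volume.restrict (Set.Ioi 0)) :=
  aestronglyMeasurable_of_tendsto_ae atTop (f := fun N l => profileSub N (t * l))
    (fun N => ((measurable_profileSub N).comp (measurable_const_mul t)).aestronglyMeasurable)
    (by
      filter_upwards [ae_restrict_mem measurableSet_Ioi] with l hl
      exact tendsto_profileSub (mul_pos ht hl))

theorem tsum_setIntegral_slice_eq {t : ℝ} (ht : 0 < t) :
    ∑' j : ℕ, ∫ x in Set.Ioi ((j : ℝ) + 1), slice t (j + 1) x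
      = ∫ l in Set.Ioi 1, profileSum (t * l) * rho l := by
  obtain ⟨C, hC, h⟩ := exists_profile_le (p := 2) (by norm_num)
  have hbd : ∀ (j : ℕ), ∀ l ∈ Set.Ioi (1 : ℝ), profile (t * l) (j + 1) * rho l
      ≤ C * t⁻¹ * ((j + 1 : ℕ) : ℝ) ^ (-2 : ℝ) * l ^ (-(3 / 2) : ℝ) := fun j l hl => by
    have hl0 : 0 < l := zero_lt_one.trans hl
    have h1 := h (t * l) (j + 1) (by positivity) (by positivity)
    calc _ ≤ C * ((t * l) ^ (1 - 2 : ℝ) * ((j : ℝ) + 1) ^ (4 - 3 * 2 : ℝ)) * l ^ (-(1 / 2) : ℝ) := by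
          refine mul_le_mul h1 (rho_le hl0) (rho_nonneg l) (by positivity)
      _ = C * t⁻¹ * ((j + 1 : ℕ) : ℝ) ^ (-2 : ℝ) * (l ^ (-1 : ℝ) * l ^ (-(1 / 2) : ℝ)) := by
          norm_num [Real.mul_rpow ht.le hl0.le, Real.rpow_neg_one]
          ring
      _ = _ := by rw [← Real.rpow_add hl0]; norm_num
  have hgi : ∀ j : ℕ, IntegrableOn (fun l : ℝ => C * t⁻¹ * ((j + 1 : ℕ) : ℝ) ^ (-2 : ℝ)
      * l ^ (-(3 / 2) : ℝ)) (Set.Ioi 1) := fun j =>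
    (integrableOn_Ioi_rpow_of_lt (by norm_num) zero_lt_one).const_mul _
  have hnn : ∀ (j : ℕ), ∀ l ∈ Set.Ioi (1 : ℝ), 0 ≤ profile (t * l) (j + 1) * rho l := fun j l hl =>
    mul_nonneg (profile_nonneg (mul_pos ht (zero_lt_one.trans hl)).le _) (rho_nonneg l)
  have hint : ∀ j : ℕ, IntegrableOn (fun l => profile (t * l) (j + 1) * rho l) (Set.Ioi 1) :=
    fun j => by
      refine Integrable.mono' (hgi j) ?_ ?_
      · refine (Measurable.mul ?_ measurable_rho).aestronglyMeasurable
        unfold profile; fun_prop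
      · filter_upwards [ae_restrict_mem measurableSet_Ioi] with l hl
        rw [Real.norm_of_nonneg (hnn j l hl)]
        exact hbd j l hl
  have hs2 : Summable fun m : ℕ => ((m + 1 : ℕ) : ℝ) ^ (-2 : ℝ) :=
    (summable_nat_add_iff 1).2 (Real.summable_nat_rpow.2 (by norm_num))
  have hsum : Summable fun j : ℕ => ∫ l in Set.Ioi (1 : ℝ), ‖profile (t * l) (j + 1) * rho l‖ := by
    refine ((hs2.mul_left (C * t⁻¹)).mul_right (∫ l in Set.Ioi (1 : ℝ), l ^ (-(3 / 2) : ℝ))).of_nonneg_of_le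
      (fun j => integral_nonneg fun _ => norm_nonneg _) fun j => ?_
    rw [← integral_const_mul]
    refine setIntegral_mono_on (hint j).norm (hgi j) measurableSet_Ioi fun l hl => ?_
    rw [Real.norm_of_nonneg (hnn j l hl)]
    exact hbd j l hl
  have key := (hasSum_integral_of_summable_integral_norm hint hsum).tsum_eq
  simp_rw [profileSum, ← tsum_mul_right]
  rw [← key]
  exact tsum_congr fun j => setIntegral_slice_eq (by positivity)

/-- Replacing `rho l` by (2l)^(-1/2) and then the range (1, ∞) by (0, ∞) costs O(t^(-1/6)) each
time, because the remainder at tl is O((tl)^(-1/6)). On the whole half line, rescaling s = tl yields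
t^(-1/2) times the Mellin transform. -/
theorem exists_abs_setIntegral_profileRem_sub_le : ∃ C : ℝ, 0 < C ∧ ∀ t : ℝ, 0 < t →
    IntegrableOn (fun l => profileRem (t * l) * rho l) (Set.Ioi 1) ∧
    |(∫ l in Set.Ioi 1, profileRem (t * l) * rho l)
      - 2 ^ (-(1 / 2) : ℝ) * (Real.Gamma (3 / 2) * (riemannZeta (1 / 2)).re) * t ^ (-(1 / 2) : ℝ)|
      ≤ C * t ^ (-(1 / 6) : ℝ) := by
  obtain ⟨C, hC, h, -⟩ := exists_profileRem_le
  set K1 := ∫ l in Set.Ioi (1 : ℝ), l ^ (-(7 / 6) : ℝ)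
  set K2 := ∫ l in Set.Ioc (0 : ℝ) 1, l ^ (-(2 / 3) : ℝ)
  have hK1 : 0 ≤ K1 := setIntegral_nonneg measurableSet_Ioi fun l hl =>
    Real.rpow_nonneg (zero_lt_one.trans hl).le _
  have hK2 : 0 ≤ K2 := setIntegral_nonneg measurableSet_Ioc fun l hl => Real.rpow_nonneg hl.1.le _
  refine ⟨C * (K1 + K2 + 1), by positivity, fun t ht => ?_⟩
  set k : ℝ := 2 ^ (-(1 / 2) : ℝ) with hk
  have hk0 : 0 < k := by positivity
  have hk1 : k ≤ 1 := Real.rpow_le_one_of_one_le_of_nonpos (by norm_num) (by norm_num)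
  have ht6 : 0 < t ^ (-(1 / 6) : ℝ) := by positivity
  have hm := aestronglyMeasurable_profileRem_comp ht
  have hrem : ∀ l : ℝ, 0 < l → |profileRem (t * l)| ≤ C * t ^ (-(1 / 6) : ℝ) * l ^ (-(1 / 6) : ℝ) :=
    fun l hl => by
      have := h (t * l) (mul_pos ht hl)
      rwa [Real.mul_rpow ht.le hl.le, ← mul_assoc] at this
  -- the comparison integral over the half line
  have eG : ∀ l ∈ Set.Ioi (0 : ℝ), profileRem (t * l) * (k * l ^ (-(1 / 2) : ℝ))
      = k * t ^ (1 / 2 : ℝ) * ((t * l) ^ (-(1 / 2) : ℝ) * profileRem (t * l)) := fun l hl => by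
    have e : t ^ (1 / 2 : ℝ) * t ^ (-(1 / 2) : ℝ) = 1 := by
      rw [← Real.rpow_add ht]; norm_num
    rw [Real.mul_rpow ht.le (le_of_lt hl)]
    linear_combination -(k * l ^ (-(1 / 2) : ℝ) * profileRem (t * l)) * e
  have hGi : IntegrableOn (fun l => profileRem (t * l) * (k * l ^ (-(1 / 2) : ℝ))) (Set.Ioi 0) := by
    refine IntegrableOn.congr_fun ?_ (fun l hl => (eG l hl).symm) measurableSet_Ioi
    have := (integrableOn_Ioi_comp_mul_left_iff
      (fun s => s ^ (-(1 / 2) : ℝ) * profileRem s) 0 ht).2 (by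
        simpa using integrableOn_rpow_mul_profileRem)
    exact this.const_mul _
  have hGint : ∫ l in Set.Ioi 0, profileRem (t * l) * (k * l ^ (-(1 / 2) : ℝ))
      = k * (Real.Gamma (3 / 2) * (riemannZeta (1 / 2)).re) * t ^ (-(1 / 2) : ℝ) := by
    rw [setIntegral_congr_fun measurableSet_Ioi eG, integral_const_mul,
      integral_comp_mul_left_Ioi (fun s => s ^ (-(1 / 2) : ℝ) * profileRem s) 0 ht, mul_zero,
      integral_rpow_mul_profileRem, smul_eq_mul]
    have e : t ^ (1 / 2 : ℝ) * t⁻¹ = t ^ (-(1 / 2) : ℝ) := by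
      rw [← Real.rpow_neg_one, ← Real.rpow_add ht]; norm_num
    rw [← e]; ring
  have hsub1 : Set.Ioi (1 : ℝ) ⊆ Set.Ioi 0 := Set.Ioi_subset_Ioi zero_le_one
  have hG1 := hGi.mono_set hsub1
  have hG0 : IntegrableOn (fun l => profileRem (t * l) * (k * l ^ (-(1 / 2) : ℝ))) (Set.Ioc 0 1) :=
    hGi.mono_set Set.Ioc_subset_Ioi_self
  -- the difference over the outer half line
  have hDb : ∀ l ∈ Set.Ioi (1 : ℝ), |profileRem (t * l) * (rho l - k * l ^ (-(1 / 2) : ℝ))|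
      ≤ C * t ^ (-(1 / 6) : ℝ) * l ^ (-(7 / 6) : ℝ) := fun l hl => by
    have hl0 : 0 < l := zero_lt_one.trans hl
    rw [abs_mul]
    calc _ ≤ C * t ^ (-(1 / 6) : ℝ) * l ^ (-(1 / 6) : ℝ) * l ^ (-1 : ℝ) := by
          gcongr
          · exact hrem l hl0
          · exact abs_rho_sub_le (le_of_lt hl)
      _ = _ := by rw [mul_assoc, ← Real.rpow_add hl0]; norm_num
  have hb1 : IntegrableOn (fun l : ℝ => C * t ^ (-(1 / 6) : ℝ) * l ^ (-(7 / 6) : ℝ)) (Set.Ioi 1) :=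
    (integrableOn_Ioi_rpow_of_lt (by norm_num) zero_lt_one).const_mul _
  have hDi : IntegrableOn (fun l => profileRem (t * l) * (rho l - k * l ^ (-(1 / 2) : ℝ)))
      (Set.Ioi 1) := by
    refine Integrable.mono' hb1 ?_ ?_
    · refine (hm.mono_measure (Measure.restrict_mono hsub1 le_rfl)).mul ?_
      exact (measurable_rho.sub (by fun_prop)).aestronglyMeasurable
    · filter_upwards [ae_restrict_mem measurableSet_Ioi] with l hl using hDb l hl
  have hDle : |∫ l in Set.Ioi 1, profileRem (t * l) * (rho l - k * l ^ (-(1 / 2) : ℝ))|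
      ≤ C * t ^ (-(1 / 6) : ℝ) * K1 := by
    rw [← integral_const_mul]
    rw [← Real.norm_eq_abs]
    refine (norm_integral_le_integral_norm _).trans ?_
    exact setIntegral_mono_on hDi.norm hb1 measurableSet_Ioi hDb
  have h0le : |∫ l in Set.Ioc 0 1, profileRem (t * l) * (k * l ^ (-(1 / 2) : ℝ))|
      ≤ C * t ^ (-(1 / 6) : ℝ) * K2 := by
    have hb0 : IntegrableOn (fun l : ℝ => C * t ^ (-(1 / 6) : ℝ) * l ^ (-(2 / 3) : ℝ)) (Set.Ioc 0 1) := by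
      have := intervalIntegral.intervalIntegrable_rpow' (a := 0) (b := 1) (r := -(2 / 3))
        (by norm_num)
      rw [intervalIntegrable_iff_integrableOn_Ioc_of_le zero_le_one] at this
      exact this.const_mul _
    rw [← integral_const_mul]
    rw [← Real.norm_eq_abs]
    refine (norm_integral_le_integral_norm _).trans ?_
    refine setIntegral_mono_on hG0.norm hb0 measurableSet_Ioc fun l hl => ?_
    have hl0 : 0 < l := hl.1
    rw [Real.norm_eq_abs, abs_mul, abs_of_nonneg (by positivity : 0 ≤ k * l ^ (-(1 / 2) : ℝ))]
    calc _ ≤ C * t ^ (-(1 / 6) : ℝ) * l ^ (-(1 / 6) : ℝ) * (1 * l ^ (-(1 / 2) : ℝ)) := by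
          gcongr
          exact hrem l hl0
      _ = _ := by rw [one_mul, mul_assoc, ← Real.rpow_add hl0]; norm_num
  have e1 : ∀ l, profileRem (t * l) * rho l = profileRem (t * l) * (rho l - k * l ^ (-(1 / 2) : ℝ))
      + profileRem (t * l) * (k * l ^ (-(1 / 2) : ℝ)) := fun l => by ring
  have hsplit : ∫ l in Set.Ioi 0, profileRem (t * l) * (k * l ^ (-(1 / 2) : ℝ))
      = (∫ l in Set.Ioc 0 1, profileRem (t * l) * (k * l ^ (-(1 / 2) : ℝ)))
      + ∫ l in Set.Ioi 1, profileRem (t * l) * (k * l ^ (-(1 / 2) : ℝ)) := by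
    rw [← Set.Ioc_union_Ioi_eq_Ioi (zero_le_one' ℝ),
      setIntegral_union (Set.Ioc_disjoint_Ioi le_rfl) measurableSet_Ioi hG0 hG1]
  simp_rw [e1]
  refine ⟨hDi.add hG1, ?_⟩
  rw [integral_add hDi hG1, ← hGint, hsplit]
  have hfin : C * t ^ (-(1 / 6) : ℝ) * K1 + C * t ^ (-(1 / 6) : ℝ) * K2
      ≤ C * (K1 + K2 + 1) * t ^ (-(1 / 6) : ℝ) := by nlinarith [mul_pos hC ht6]
  rw [abs_le] at *
  constructor <;> linarith [hDle.1, hDle.2, h0le.1, h0le.2]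

/-- Two-term asymptotics, uniform in `t > 0`, of `∑_{j,k} y exp (-y)` at `y = t j k (j + k) / 2`. -/
theorem exists_abs_tsum_slice_sub_main_le : ∃ C : ℝ, 0 < C ∧ ∀ t : ℝ, 0 < t →
    |∑' p : ℕ × ℕ, slice t (p.1 + 1) (p.2 + 1)
      - (2 ^ (5 / 3 : ℝ) / 9 * Real.Gamma (1 / 3) ^ 2 * t ^ (-(2 / 3) : ℝ)
        + 2 ^ (-(1 / 2) : ℝ) * (√Real.pi * (riemannZeta (1 / 2)).re) * t ^ (-(1 / 2) : ℝ))|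
      ≤ C * t ^ (-(1 / 6) : ℝ) := by
  obtain ⟨C, hC, h⟩ := exists_abs_tsum_slice_sub_le
  obtain ⟨D, hD, h'⟩ := exists_abs_setIntegral_profileRem_sub_le
  refine ⟨C + 2 * D, by positivity, fun t ht => ?_⟩
  have h1 := h t ht
  obtain ⟨hi, h2⟩ := h' t ht
  rw [tsum_setIntegral_slice_eq ht] at h1
  have hm : ∀ l ∈ Set.Ioi (1 : ℝ), profileSum (t * l) * rho l = profileRem (t * l) * rho l
      + Real.Gamma (5 / 3) / 3 * t ^ (-(2 / 3) : ℝ) * (l ^ (-(2 / 3) : ℝ) * rho l) := fun l hl => by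
    rw [profileRem, Real.mul_rpow ht.le (zero_lt_one.trans hl).le]; ring
  have hi2 : IntegrableOn (fun l : ℝ => l ^ (-(2 / 3) : ℝ) * rho l) (Set.Ioi 1) := by
    -- A non-integrable function would have integral 0 by convention, whereas the computed value is
    -- positive.
    by_contra hcon
    have := integral_undef hcon
    rw [integral_rpow_mul_rho] at this
    have h3 : 0 < Real.Gamma (1 / 3) := Real.Gamma_pos_of_pos (by norm_num)
    have h4 : 0 < Real.Gamma (2 / 3) := Real.Gamma_pos_of_pos (by norm_num)
    have : 0 < 2 ^ (-(1 / 3) : ℝ) * (Real.Gamma (1 / 3) ^ 2 / Real.Gamma (2 / 3)) := by positivity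
    linarith
  rw [setIntegral_congr_fun measurableSet_Ioi hm, integral_add hi (hi2.const_mul _),
    integral_const_mul, integral_rpow_mul_rho] at h1
  have hG : Real.Gamma (5 / 3) = 2 / 3 * Real.Gamma (2 / 3) := by
    rw [← Real.Gamma_add_one (by norm_num)]; norm_num
  have hG2 : Real.Gamma (3 / 2) = 1 / 2 * √Real.pi := by
    rw [← Real.Gamma_one_half_eq, ← Real.Gamma_add_one (by norm_num)]; norm_num
  have h4 : Real.Gamma (2 / 3) ≠ 0 := (Real.Gamma_pos_of_pos (by norm_num)).ne'
  have e3 : (2 : ℝ) ^ (5 / 3 : ℝ) = 4 * 2 ^ (-(1 / 3) : ℝ) := by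
    rw [show (5 / 3 : ℝ) = 2 + -(1 / 3) by norm_num, Real.rpow_add (by norm_num)]; norm_num
  have e1 : Real.Gamma (5 / 3) / 3 * t ^ (-(2 / 3) : ℝ) *
      (2 ^ (-(1 / 3) : ℝ) * (Real.Gamma (1 / 3) ^ 2 / Real.Gamma (2 / 3)))
      = 2 ^ (5 / 3 : ℝ) / 9 * Real.Gamma (1 / 3) ^ 2 * t ^ (-(2 / 3) : ℝ) / 2 := by
    rw [hG, e3]; field_simp; norm_num
  rw [e1] at h1
  rw [hG2] at h2
  rw [add_mul, abs_le] at *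
  constructor <;> linarith [h1.1, h1.2, h2.1, h2.2]

/-! ### Dimensions, and summability of the moments of the summands. -/

theorem irrepDim_cast (i : ℕ+ × ℕ+) :
    (irrepDim i : ℝ) = (i.1 : ℝ) * (i.2 : ℝ) * ((i.1 : ℝ) + (i.2 : ℝ)) / 2 := by
  have h : ((2 * irrepDim i : ℕ) : ℝ) = _ := congrArg _ (two_mul_irrepDim i)
  push_cast at h
  linarith

theorem irrepDim_pos (i : ℕ+ × ℕ+) : (0 : ℝ) < irrepDim i := by
  rw [irrepDim_cast]
  have h1 : (0 : ℝ) < i.1 := by exact_mod_cast i.1.pos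
  have h2 : (0 : ℝ) < i.2 := by exact_mod_cast i.2.pos
  positivity

/-- Pairs of positive integers as pairs of natural numbers. -/
def pairEquiv : ℕ+ × ℕ+ ≃ ℕ × ℕ := Equiv.prodCongr Equiv.pnatEquivNat Equiv.pnatEquivNat

theorem pairEquiv_fst (i : ℕ+ × ℕ+) : (((pairEquiv i).1 : ℕ) : ℝ) + 1 = (i.1 : ℝ) := by
  have : (pairEquiv i).1 + 1 = (i.1 : ℕ) := PNat.natPred_add_one i.1
  exact_mod_cast this

theorem pairEquiv_snd (i : ℕ+ × ℕ+) : (((pairEquiv i).2 : ℕ) : ℝ) + 1 = (i.2 : ℝ) := by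
  have : (pairEquiv i).2 + 1 = (i.2 : ℕ) := PNat.natPred_add_one i.2
  exact_mod_cast this

theorem rpow_mul_rpow_le_irrepDim (i : ℕ+ × ℕ+) :
    ((i.1 : ℝ) * (i.2 : ℝ)) ^ (3 / 2 : ℝ) ≤ irrepDim i := by
  have h1 : (0 : ℝ) < i.1 := by exact_mod_cast i.1.pos
  have h2 : (0 : ℝ) < i.2 := by exact_mod_cast i.2.pos
  rw [irrepDim_cast, show (3 / 2 : ℝ) = 1 + 1 / 2 by norm_num, Real.rpow_add (by positivity),
    Real.rpow_one, ← Real.sqrt_eq_rpow, mul_div_assoc]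
  gcongr
  refine Real.sqrt_le_iff.2 ⟨by positivity, ?_⟩
  nlinarith [sq_nonneg ((i.1 : ℝ) - i.2)]

/-- The dimension is at least (jk)^(3/2), so each term is at most (jk)^(-5/4). This comparison would
work for any exponent below -2/3. -/
theorem summable_irrepDim_rpow : Summable fun i : ℕ+ × ℕ+ => (irrepDim i : ℝ) ^ (-(5 / 6) : ℝ) := by
  have h := (pairEquiv.summable_iff).2 (summable_rpow_mul_rpow (r := -(5 / 4)) (by norm_num))
  refine h.of_nonneg_of_le (fun i => by positivity) fun i => ?_
  have h1 : (0 : ℝ) < i.1 := by exact_mod_cast i.1.pos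
  have h2 : (0 : ℝ) < i.2 := by exact_mod_cast i.2.pos
  have h3 := Real.rpow_le_rpow_of_nonpos (z := -(5 / 6)) (by positivity)
    (rpow_mul_rpow_le_irrepDim i) (by norm_num)
  rw [← Real.rpow_mul (by positivity), Real.mul_rpow h1.le h2.le] at h3
  simp only [Function.comp]
  push_cast
  rw [pairEquiv_fst, pairEquiv_snd]
  norm_num at h3 ⊢
  exact h3

theorem exists_geom_le {p : ℝ} (hp : 0 ≤ p) : ∃ C : ℝ, 0 < C ∧ ∀ (x : ℝ) (k : ℕ), 0 < x → k ≤ 3 →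
    x ^ k * (Real.exp (-x) / (1 - Real.exp (-x)) ^ k) ≤ C * x ^ (-p) := by
  obtain ⟨C, hC, h⟩ := exists_exp_neg_le hp
  refine ⟨216 * (C * (1 / 2) ^ (-p)), by positivity, fun x k hx hk => ?_⟩
  have hq : Real.exp (-x) < 1 := Real.exp_lt_one_iff.2 (by linarith)
  have h1 : x / (1 + x) ≤ 1 - Real.exp (-x) := by
    have h2 : Real.exp (-x) ≤ 1 / (1 + x) := by
      rw [Real.exp_neg, ← one_div]
      exact one_div_le_one_div_of_le (by positivity) (by linarith [Real.add_one_le_exp x])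
    have : x / (1 + x) = 1 - 1 / (1 + x) := by field_simp; ring
    linarith
  have h2 : (1 + x) ^ k ≤ 216 * Real.exp (x / 2) := by
    calc (1 + x) ^ k ≤ (1 + x) ^ 3 := pow_le_pow_right₀ (by linarith) hk
      _ ≤ (6 * Real.exp (x / 6)) ^ 3 := by
        gcongr
        linarith [Real.add_one_le_exp (x / 6)]
      _ = 216 * Real.exp (x / 2) := by
        rw [mul_pow, ← Real.exp_nat_mul]; norm_num; ring_nf
  calc x ^ k * (Real.exp (-x) / (1 - Real.exp (-x)) ^ k)
      ≤ x ^ k * (Real.exp (-x) / (x / (1 + x)) ^ k) := by gcongr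
    _ = (1 + x) ^ k * Real.exp (-x) := by rw [div_pow]; field_simp
    _ ≤ 216 * Real.exp (x / 2) * Real.exp (-x) := by gcongr
    _ = 216 * Real.exp (-(x / 2)) := by rw [mul_assoc, ← Real.exp_add]; ring_nf
    _ ≤ 216 * (C * (x / 2) ^ (-p)) := by gcongr; exact h _ (by positivity)
    _ = _ := by rw [div_eq_mul_one_div x 2, Real.mul_rpow hx.le (by norm_num)]; ring

/-- The parameter `exp (-d t)` of the geometric distribution of index `i`. -/
noncomputable def ratio (t : ℝ) (i : ℕ+ × ℕ+) : ℝ := Real.exp (-(irrepDim i * t))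

theorem ratio_pos (t : ℝ) (i : ℕ+ × ℕ+) : 0 < ratio t i := Real.exp_pos _

theorem ratio_lt_one {t : ℝ} (ht : 0 < t) (i : ℕ+ × ℕ+) : ratio t i < 1 :=
  Real.exp_lt_one_iff.2 (by have := mul_pos (irrepDim_pos i) ht; linarith)

/-- The mean of the summand of index `i`. -/
noncomputable def termMean (t : ℝ) (i : ℕ+ × ℕ+) : ℝ := irrepDim i * (ratio t i / (1 - ratio t i))

/-- The variance of the summand of index `i`. -/
noncomputable def termVar (t : ℝ) (i : ℕ+ × ℕ+) : ℝ :=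
  (irrepDim i : ℝ) ^ 2 * (ratio t i / (1 - ratio t i) ^ 2)

/-- A majorant of the third absolute centered moment of the summand of index `i`, up to a constant. -/
noncomputable def termThird (t : ℝ) (i : ℕ+ × ℕ+) : ℝ :=
  (irrepDim i : ℝ) ^ 3 * (ratio t i / (1 - ratio t i) ^ 3)

theorem termMean_nonneg {t : ℝ} (ht : 0 < t) (i : ℕ+ × ℕ+) : 0 ≤ termMean t i := by
  have := ratio_lt_one ht i; have := ratio_pos t i
  have : 0 < 1 - ratio t i := by linarith
  unfold termMean; positivity

theorem termVar_nonneg {t : ℝ} (ht : 0 < t) (i : ℕ+ × ℕ+) : 0 ≤ termVar t i := by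
  have := ratio_lt_one ht i; have := ratio_pos t i
  have : 0 < 1 - ratio t i := by linarith
  unfold termVar; positivity

theorem termThird_nonneg {t : ℝ} (ht : 0 < t) (i : ℕ+ × ℕ+) : 0 ≤ termThird t i := by
  have := ratio_lt_one ht i; have := ratio_pos t i
  have : 0 < 1 - ratio t i := by linarith
  unfold termThird; positivity

/-- One bound serves the mean, the variance and the third moment, for k = 1, 2, 3. For k = 3 it
gives t^(-23/6), which is smaller than σ³, of order t^(-4), as Lyapunov's condition requires. -/
theorem exists_term_le : ∃ C : ℝ, 0 < C ∧ ∀ (t : ℝ) (i : ℕ+ × ℕ+) (k : ℕ), 0 < t → k ≤ 3 →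
    (irrepDim i : ℝ) ^ k * (ratio t i / (1 - ratio t i) ^ k)
      ≤ C * t ^ (-(5 / 6) - k : ℝ) * (irrepDim i : ℝ) ^ (-(5 / 6) : ℝ) := by
  obtain ⟨C, hC, h⟩ := exists_geom_le (p := 5 / 6) (by norm_num)
  refine ⟨C, hC, fun t i k ht hk => ?_⟩
  have hd := irrepDim_pos i
  have h1 := h (irrepDim i * t) k (mul_pos hd ht) hk
  rw [Real.mul_rpow hd.le ht.le, mul_pow] at h1
  rw [Real.rpow_sub ht, Real.rpow_natCast, ratio]
  have htk : 0 < t ^ k := by positivity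
  rw [← mul_le_mul_iff_of_pos_right htk]
  calc _ = (irrepDim i : ℝ) ^ k * t ^ k * (Real.exp (-(irrepDim i * t)) /
        (1 - Real.exp (-(irrepDim i * t))) ^ k) := by ring
    _ ≤ _ := h1
    _ = _ := by field_simp

theorem summable_term {t : ℝ} (ht : 0 < t) {k : ℕ} (hk : k ≤ 3) : Summable fun i : ℕ+ × ℕ+ =>
    (irrepDim i : ℝ) ^ k * (ratio t i / (1 - ratio t i) ^ k) := by
  obtain ⟨C, hC, h⟩ := exists_term_le
  refine (summable_irrepDim_rpow.mul_left (C * t ^ (-(5 / 6) - k : ℝ))).of_nonneg_of_le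
    (fun i => ?_) fun i => h t i k ht hk
  have := ratio_lt_one ht i; have := ratio_pos t i
  have : 0 < 1 - ratio t i := by linarith
  positivity

theorem summable_termMean {t : ℝ} (ht : 0 < t) : Summable (termMean t) :=
  (summable_term ht (k := 1) (by norm_num)).congr fun i => by simp [termMean]

theorem summable_termVar {t : ℝ} (ht : 0 < t) : Summable (termVar t) :=
  summable_term ht (k := 2) (by norm_num)

theorem summable_termThird {t : ℝ} (ht : 0 < t) : Summable (termThird t) :=
  summable_term ht (k := 3) (by norm_num)

/-- The mean of the total dimension. -/
noncomputable def totalMean (t : ℝ) : ℝ := ∑' i, termMean t i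

/-- The variance of the total dimension. -/
noncomputable def totalVar (t : ℝ) : ℝ := ∑' i, termVar t i

/-! ### Two-term asymptotics of the mean. -/

theorem tsum_irrepDim_mul_ratio {s : ℝ} (hs : 0 < s) :
    ∑' i, (irrepDim i : ℝ) * ratio s i = s⁻¹ * ∑' p : ℕ × ℕ, slice s (p.1 + 1) (p.2 + 1) := by
  rw [← pairEquiv.tsum_eq, ← tsum_mul_left]
  refine tsum_congr fun i => ?_
  rw [pairEquiv_fst, pairEquiv_snd, slice, ratio, ← irrepDim_cast, mul_comm s]
  field_simp

theorem hasSum_termMean {t : ℝ} (ht : 0 < t) (i : ℕ+ × ℕ+) :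
    HasSum (fun m : ℕ => (irrepDim i : ℝ) * ratio ((m + 1) * t) i) (termMean t i) := by
  have h := ((hasSum_geometric_of_lt_one (ratio_pos t i).le (ratio_lt_one ht i)).mul_left
    (ratio t i)).mul_left (irrepDim i : ℝ)
  refine h.congr_fun fun m => ?_
  rw [← pow_succ', ratio, ratio, ← Real.exp_nat_mul]
  congr 2
  push_cast; ring

/-- Expanding each mean as a geometric series and exchanging the sums gives the double sum at every
multiple of t. This is why its expansion is needed for all positive parameters and not only small
ones. -/
theorem totalMean_eq {t : ℝ} (ht : 0 < t) : Summable (fun m : ℕ => ((m + 1) * t)⁻¹ *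
      ∑' p : ℕ × ℕ, slice ((m + 1) * t) (p.1 + 1) (p.2 + 1)) ∧
    totalMean t = ∑' m : ℕ, ((m + 1) * t)⁻¹ *
      ∑' p : ℕ × ℕ, slice ((m + 1) * t) (p.1 + 1) (p.2 + 1) := by
  have hs : Summable (Function.uncurry fun (i : ℕ+ × ℕ+) (m : ℕ) =>
      (irrepDim i : ℝ) * ratio ((m + 1) * t) i) := by
    refine (summable_prod_of_nonneg fun p => ?_).2 ⟨fun i => (hasSum_termMean ht i).summable, ?_⟩
    · exact mul_nonneg (irrepDim_pos _).le (ratio_pos _ _).le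
    · refine (summable_termMean ht).congr fun i => ?_
      exact (hasSum_termMean ht i).tsum_eq.symm
  have h1 : ∀ m : ℕ, ((m + 1) * t)⁻¹ * ∑' p : ℕ × ℕ, slice ((m + 1) * t) (p.1 + 1) (p.2 + 1)
      = ∑' i, (irrepDim i : ℝ) * ratio ((m + 1) * t) i := fun m =>
    (tsum_irrepDim_mul_ratio (by positivity)).symm
  simp_rw [h1]
  refine ⟨hs.prod_symm.prod, ?_⟩
  rw [totalMean, hs.tsum_comm]
  exact tsum_congr fun i => (hasSum_termMean ht i).tsum_eq.symm

theorem tsum_rpow_eq_zeta {s : ℝ} (hs : 1 < s) :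
    HasSum (fun m : ℕ => ((m : ℝ) + 1) ^ (-s)) (riemannZeta s).re := by
  have hsum : Summable fun m : ℕ => ((m : ℝ) + 1) ^ (-s) := by
    have := (summable_nat_add_iff 1).2 (Real.summable_nat_rpow.2 (by linarith : -s < -1))
    simpa using this
  have h := zeta_eq_tsum_one_div_nat_add_one_cpow (s := s) (by simpa using hs)
  have h2 : riemannZeta s = ((∑' m : ℕ, ((m : ℝ) + 1) ^ (-s) : ℝ) : ℂ) := by
    rw [h, Complex.ofReal_tsum]
    refine tsum_congr fun m => ?_
    rw [Complex.ofReal_cpow (by positivity), one_div, ← Complex.cpow_neg]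
    push_cast; rfl
  rw [h2, Complex.ofReal_re]
  exact hsum.hasSum

theorem constX_pos : 0 < constX := by
  unfold constX
  have h1 : 0 < Real.Gamma (1 / 3) := Real.Gamma_pos_of_pos (by norm_num)
  have h2 : 0 < (riemannZeta (5 / 3)).re := by
    have := riemannZeta_re_pos_of_one_lt (x := 5 / 3) (by norm_num)
    push_cast at this
    exact this
  positivity

theorem constX_rpow : constX ^ (10 / 3 : ℝ)
    = 1 / 9 * Real.Gamma (1 / 3) ^ 2 * (riemannZeta (5 / 3)).re := by
  unfold constX
  have h1 : 0 < Real.Gamma (1 / 3) := Real.Gamma_pos_of_pos (by norm_num)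
  have h2 : 0 < (riemannZeta (5 / 3)).re := by
    have := riemannZeta_re_pos_of_one_lt (x := 5 / 3) (by norm_num)
    push_cast at this
    exact this
  rw [← Real.rpow_mul (by positivity)]
  norm_num

/-- Two-term asymptotics of the mean. -/
theorem exists_abs_totalMean_sub_le : ∃ C : ℝ, 0 < C ∧ ∀ t : ℝ, 0 < t →
    |totalMean t - (2 ^ (5 / 3 : ℝ) * constX ^ (10 / 3 : ℝ) * t ^ (-(5 / 3) : ℝ)
      - 2 ^ (-(1 / 2) : ℝ) * constY * t ^ (-(3 / 2) : ℝ))| ≤ C * t ^ (-(7 / 6) : ℝ) := by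
  obtain ⟨C, hC, h⟩ := exists_abs_tsum_slice_sub_main_le
  set a := 2 ^ (5 / 3 : ℝ) / 9 * Real.Gamma (1 / 3) ^ 2 with ha
  set b := 2 ^ (-(1 / 2) : ℝ) * (√Real.pi * (riemannZeta (1 / 2)).re) with hb
  have z1 := tsum_rpow_eq_zeta (s := 5 / 3) (by norm_num)
  have z2 := tsum_rpow_eq_zeta (s := 3 / 2) (by norm_num)
  -- The error (mt)⁻¹ (mt)^(-1/6) sums over m to ζ(7/6) t^(-7/6).
  have z3 := tsum_rpow_eq_zeta (s := 7 / 6) (by norm_num)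
  have z3p : 0 < (riemannZeta ((7 / 6 : ℝ) : ℂ)).re := riemannZeta_re_pos_of_one_lt (by norm_num)
  refine ⟨C * (riemannZeta ((7 / 6 : ℝ) : ℂ)).re, by positivity, fun t ht => ?_⟩
  obtain ⟨hs, he⟩ := totalMean_eq ht
  have hmain := ((z1.mul_left (a * t ^ (-(5 / 3) : ℝ))).add (z2.mul_left (b * t ^ (-(3 / 2) : ℝ))))
  have hdiff := hs.hasSum.sub hmain
  have hbd := z3.mul_left (C * t ^ (-(7 / 6) : ℝ))
  have e : totalMean t - (2 ^ (5 / 3 : ℝ) * constX ^ (10 / 3 : ℝ) * t ^ (-(5 / 3) : ℝ)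
      - 2 ^ (-(1 / 2) : ℝ) * constY * t ^ (-(3 / 2) : ℝ))
      = totalMean t - (a * t ^ (-(5 / 3) : ℝ) * (riemannZeta ((5 / 3 : ℝ) : ℂ)).re
        + b * t ^ (-(3 / 2) : ℝ) * (riemannZeta ((3 / 2 : ℝ) : ℂ)).re) := by
    rw [constX_rpow, constY, ha, hb]
    push_cast
    ring
  rw [e, he, ← hdiff.tsum_eq]
  have hterm : ∀ m : ℕ, ‖((m + 1) * t)⁻¹ * ∑' p : ℕ × ℕ, slice ((m + 1) * t) (p.1 + 1) (p.2 + 1)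
      - (a * t ^ (-(5 / 3) : ℝ) * ((m : ℝ) + 1) ^ (-(5 / 3) : ℝ)
        + b * t ^ (-(3 / 2) : ℝ) * ((m : ℝ) + 1) ^ (-(3 / 2) : ℝ))‖
      ≤ C * t ^ (-(7 / 6) : ℝ) * ((m : ℝ) + 1) ^ (-(7 / 6) : ℝ) := fun m => by
    have hm : (0 : ℝ) < m + 1 := by positivity
    have hmt : 0 < (m + 1) * t := by positivity
    have h1 := h _ hmt
    have g : ∀ r : ℝ, ((m + 1) * t)⁻¹ * ((m + 1) * t) ^ r = t ^ (r - 1) * ((m : ℝ) + 1) ^ (r - 1) :=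
      fun r => by
        rw [mul_comm (t ^ _), ← Real.mul_rpow hm.le ht.le, Real.rpow_sub_one hmt.ne']
        field_simp
    have g1 := g (-(2 / 3)); have g2 := g (-(1 / 2)); have g3 := g (-(1 / 6))
    norm_num at g1 g2 g3
    calc _ = ‖((m + 1) * t)⁻¹ * (∑' p : ℕ × ℕ, slice ((m + 1) * t) (p.1 + 1) (p.2 + 1)
          - (a * ((m + 1) * t) ^ (-(2 / 3) : ℝ) + b * ((m + 1) * t) ^ (-(1 / 2) : ℝ)))‖ := by
          congr 1
          rw [mul_sub, mul_add]
          congr 1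
          norm_num
          linear_combination -a * g1 - b * g2
      _ ≤ ((m + 1) * t)⁻¹ * (C * ((m + 1) * t) ^ (-(1 / 6) : ℝ)) := by
          rw [norm_mul, Real.norm_of_nonneg (inv_nonneg.2 hmt.le)]
          gcongr
          exact h1
      _ = _ := by
          norm_num
          linear_combination C * g3
  have := tsum_of_norm_bounded hbd hterm
  rw [Real.norm_eq_abs] at this
  refine this.trans (le_of_eq (by ring))

/-! ### Asymptotics of the variance by convexity. -/

/-- Convexity: the mean as a function of the parameter lies above its tangent, whose slope is minus
the variance. No derivative of an infinite sum is needed. -/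
theorem termMean_tangent {s t : ℝ} (hs : 0 < s) (ht : 0 < t) (i : ℕ+ × ℕ+) :
    termMean t i - termVar t i * (s - t) ≤ termMean s i := by
  have hd := irrepDim_pos i
  have hq := ratio_pos t i
  have hr := ratio_pos s i
  have hq1 : 0 < 1 - ratio t i := by linarith [ratio_lt_one ht i]
  have hr1 : 0 < 1 - ratio s i := by linarith [ratio_lt_one hs i]
  have hexp : ratio t i - ratio s i ≤ ratio t i * (irrepDim i * (s - t)) := by
    have h1 : ratio s i = ratio t i * Real.exp (-(irrepDim i * (s - t))) := by
      rw [ratio, ratio, ← Real.exp_add]; ring_nf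
    have h2 := Real.add_one_le_exp (-(irrepDim i * (s - t)))
    rw [h1]
    nlinarith
  unfold termMean termVar
  set q := ratio t i
  set r := ratio s i
  set d : ℝ := (irrepDim i : ℝ)
  have h3 : q / (1 - q) - r / (1 - r) ≤ q * (d * (s - t)) / (1 - q) ^ 2 := by
    have h4 : q / (1 - q) - r / (1 - r) = (q - r) / ((1 - q) * (1 - r)) := by
      field_simp; ring
    -- Replacing 1 - r by 1 - q in the denominator changes the value by a nonnegative square term,
    -- whatever the sign of q - r.
    have h5 : (q - r) / (1 - q) ^ 2 - (q - r) / ((1 - q) * (1 - r))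
        = (q - r) ^ 2 / ((1 - q) ^ 2 * (1 - r)) := by
      field_simp; ring
    have h6 : 0 ≤ (q - r) ^ 2 / ((1 - q) ^ 2 * (1 - r)) := by positivity
    have h7 : (q - r) / (1 - q) ^ 2 ≤ q * (d * (s - t)) / (1 - q) ^ 2 := by gcongr
    linarith
  have h8 := mul_le_mul_of_nonneg_left h3 hd.le
  have h9 : d * (q * (d * (s - t)) / (1 - q) ^ 2) = d ^ 2 * (q / (1 - q) ^ 2) * (s - t) := by ring
  rw [h9, mul_sub] at h8
  linarith

theorem totalMean_tangent {s t : ℝ} (hs : 0 < s) (ht : 0 < t) :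
    totalMean t - totalVar t * (s - t) ≤ totalMean s := by
  unfold totalMean totalVar
  rw [← tsum_mul_right, ← (summable_termMean ht).tsum_sub ((summable_termVar ht).mul_right _)]
  exact Summable.tsum_le_tsum (termMean_tangent hs ht)
    ((summable_termMean ht).sub ((summable_termVar ht).mul_right _)) (summable_termMean hs)

/-- The leading constant of the mean. -/
noncomputable def leadConst : ℝ := 2 ^ (5 / 3 : ℝ) * constX ^ (10 / 3 : ℝ)

theorem leadConst_pos : 0 < leadConst := by
  have := constX_pos
  unfold leadConst; positivity

theorem tendsto_rpow_nhdsGT_zero {p : ℝ} (hp : 0 < p) :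
    Tendsto (fun t : ℝ => t ^ p) (𝓝[>] 0) (𝓝 0) := by
  have := (Real.continuousAt_rpow_const 0 p (Or.inr hp.le)).tendsto
  rw [Real.zero_rpow hp.ne'] at this
  exact this.mono_left nhdsWithin_le_nhds

theorem tendsto_totalMean :
    Tendsto (fun t : ℝ => t ^ (5 / 3 : ℝ) * totalMean t) (𝓝[>] 0) (𝓝 leadConst) := by
  obtain ⟨C, hC, h⟩ := exists_abs_totalMean_sub_le
  set b := 2 ^ (-(1 / 2) : ℝ) * constY with hb
  have h1 : Tendsto (fun t : ℝ => C * t ^ (1 / 2 : ℝ) + |b| * t ^ (1 / 6 : ℝ)) (𝓝[>] 0) (𝓝 0) := by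
    simpa using ((tendsto_rpow_nhdsGT_zero (by norm_num)).const_mul C).add
      ((tendsto_rpow_nhdsGT_zero (by norm_num)).const_mul |b|)
  rw [tendsto_iff_norm_sub_tendsto_zero]
  refine squeeze_zero' (Eventually.of_forall fun _ => norm_nonneg _) ?_ h1
  filter_upwards [self_mem_nhdsWithin] with t ht
  have ht' : (0 : ℝ) < t := ht
  have h2 := h t ht'
  rw [← leadConst] at h2
  have e1 : t ^ (5 / 3 : ℝ) * t ^ (-(5 / 3) : ℝ) = 1 := by rw [← Real.rpow_add ht']; norm_num
  have e2 : t ^ (5 / 3 : ℝ) * t ^ (-(3 / 2) : ℝ) = t ^ (1 / 6 : ℝ) := by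
    rw [← Real.rpow_add ht']; norm_num
  have e3 : t ^ (5 / 3 : ℝ) * t ^ (-(7 / 6) : ℝ) = t ^ (1 / 2 : ℝ) := by
    rw [← Real.rpow_add ht']; norm_num
  have e : t ^ (5 / 3 : ℝ) * totalMean t - leadConst
      = t ^ (5 / 3 : ℝ) * (totalMean t - (leadConst * t ^ (-(5 / 3) : ℝ) - b * t ^ (-(3 / 2) : ℝ)))
        - b * t ^ (1 / 6 : ℝ) := by
    linear_combination leadConst * e1 - b * e2
  rw [e]
  refine (norm_sub_le _ _).trans ?_
  rw [norm_mul, norm_mul, Real.norm_of_nonneg (by positivity : 0 ≤ t ^ (5 / 3 : ℝ)),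
    Real.norm_of_nonneg (by positivity : 0 ≤ t ^ (1 / 6 : ℝ)), Real.norm_eq_abs, Real.norm_eq_abs]
  refine add_le_add ?_ le_rfl
  calc _ ≤ t ^ (5 / 3 : ℝ) * (C * t ^ (-(7 / 6) : ℝ)) := by gcongr
    _ = _ := by rw [← e3]; ring

/-- The secant between t and (1 + h)t has relative length h independent of t, so its slope is
determined by the leading term of the mean alone. Letting h tend to 0 afterwards recovers the
derivative. -/
theorem tendsto_totalMean_slope {h : ℝ} (hh : -1 < h) (h0 : h ≠ 0) :
    Tendsto (fun t : ℝ => t ^ (8 / 3 : ℝ) * (-(totalMean ((1 + h) * t) - totalMean t) / (h * t)))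
      (𝓝[>] 0) (𝓝 (-leadConst * (h⁻¹ * ((1 + h) ^ (-(5 / 3) : ℝ) - 1)))) := by
  have h1 : 0 < 1 + h := by linarith
  have t1 : Tendsto (fun t : ℝ => (1 + h) * t) (𝓝[>] 0) (𝓝[>] 0) := by
    refine tendsto_nhdsWithin_iff.2 ⟨?_, ?_⟩
    · have : Tendsto (fun t : ℝ => (1 + h) * t) (𝓝 0) (𝓝 ((1 + h) * 0)) :=
        (continuous_const_mul _).tendsto 0
      rw [mul_zero] at this
      exact this.mono_left nhdsWithin_le_nhds
    · filter_upwards [self_mem_nhdsWithin] with t ht using mul_pos h1 ht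
  have t2 := ((tendsto_totalMean.comp t1).const_mul ((1 + h) ^ (-(5 / 3) : ℝ))).sub tendsto_totalMean
  have t3 := t2.const_mul (-h⁻¹)
  have e : -leadConst * (h⁻¹ * ((1 + h) ^ (-(5 / 3) : ℝ) - 1))
      = -h⁻¹ * ((1 + h) ^ (-(5 / 3) : ℝ) * leadConst - leadConst) := by ring
  rw [e]
  refine t3.congr' ?_
  filter_upwards [self_mem_nhdsWithin] with t ht
  have ht' : (0 : ℝ) < t := ht
  simp only [Function.comp]
  have e1 : (1 + h) ^ (-(5 / 3) : ℝ) * (1 + h) ^ (5 / 3 : ℝ) = 1 := by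
    rw [← Real.rpow_add h1]; norm_num
  have e2 : t ^ (8 / 3 : ℝ) = t ^ (5 / 3 : ℝ) * t := by
    rw [← Real.rpow_add_one ht'.ne']; norm_num
  rw [Real.mul_rpow h1.le ht'.le, e2]
  have e3 : t ^ (5 / 3 : ℝ) * t * (-(totalMean ((1 + h) * t) - totalMean t) / (h * t))
      = -h⁻¹ * (t ^ (5 / 3 : ℝ) * (totalMean ((1 + h) * t) - totalMean t)) := by
    field_simp
  rw [e3]
  linear_combination -h⁻¹ * t ^ (5 / 3 : ℝ) * totalMean ((1 + h) * t) * e1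

theorem tendsto_slope_rpow : Tendsto (fun h : ℝ => -leadConst * (h⁻¹ * ((1 + h) ^ (-(5 / 3) : ℝ) - 1)))
    (𝓝[≠] 0) (𝓝 (5 / 3 * leadConst)) := by
  have h := Real.hasDerivAt_rpow_const (x := 1) (p := -(5 / 3)) (Or.inl one_ne_zero)
  rw [hasDerivAt_iff_tendsto_slope_zero] at h
  simp only [Real.one_rpow, mul_one, smul_eq_mul] at h
  have := h.const_mul (-leadConst)
  convert! this using 2
  ring

/-- Leading asymptotics of the variance. -/
theorem tendsto_totalVar :
    Tendsto (fun t : ℝ => t ^ (8 / 3 : ℝ) * totalVar t) (𝓝[>] 0) (𝓝 (5 / 3 * leadConst)) := by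
  have key : ∀ h t : ℝ, -1 < h → 0 < t →
      -totalVar t * (h * t) ≤ totalMean ((1 + h) * t) - totalMean t := fun h t hh ht => by
    have := totalMean_tangent (s := (1 + h) * t) (mul_pos (by linarith) ht) ht
    have e : (1 + h) * t - t = h * t := by ring
    rw [e] at this
    linarith
  rw [tendsto_order]
  constructor
  · intro a ha
    -- Secants to the right bound the variance from below, by convexity.
    have h1 := (tendsto_order.1 (tendsto_slope_rpow.mono_left
      (nhdsWithin_mono 0 (fun x (hx : x ∈ Set.Ioi (0 : ℝ)) => (ne_of_gt hx : x ≠ 0))))).1 a ha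
    obtain ⟨h, hah, hh⟩ := (h1.and self_mem_nhdsWithin).exists
    have hh' : (0 : ℝ) < h := hh
    have h2 := (tendsto_order.1 (tendsto_totalMean_slope (by linarith) hh'.ne')).1 a hah
    filter_upwards [h2, self_mem_nhdsWithin] with t h3 ht
    have ht' : (0 : ℝ) < t := ht
    refine h3.trans_le ?_
    gcongr
    rw [div_le_iff₀ (by positivity)]
    linarith [key h t (by linarith) ht']
  · intro a ha
    -- Secants to the left bound it from above.
    have h1 := (tendsto_order.1 (tendsto_slope_rpow.mono_left
      (nhdsWithin_mono 0 (fun x (hx : x ∈ Set.Iio (0 : ℝ)) => (ne_of_lt hx : x ≠ 0))))).2 a ha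
    have hlt : ∀ᶠ h : ℝ in 𝓝[<] 0, -1 < h :=
      nhdsWithin_le_nhds (lt_mem_nhds (by norm_num : (-1 : ℝ) < 0))
    obtain ⟨h, ⟨hah, hh⟩, hh1⟩ := ((h1.and self_mem_nhdsWithin).and hlt).exists
    have hh' : h < 0 := hh
    have h2 := (tendsto_order.1 (tendsto_totalMean_slope hh1 hh'.ne)).2 a hah
    filter_upwards [h2, self_mem_nhdsWithin] with t h3 ht
    have ht' : (0 : ℝ) < t := ht
    refine lt_of_le_of_lt ?_ h3
    gcongr
    rw [le_div_iff_of_neg (by nlinarith)]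
    linarith [key h t hh1 ht']

/-! ### The saddle point sequence. -/

theorem rpow_taylor_two (r : ℝ) :
    (fun z : ℝ => (1 + z) ^ r - 1 - r * z - r * (r - 1) / 2 * z ^ 2) =o[𝓝 0] fun z => z ^ 2 := by
  rw [isLittleO_iff]
  intro c hc
  have h := Real.hasDerivAt_rpow_const (x := 1) (p := r - 1) (Or.inl one_ne_zero)
  rw [hasDerivAt_iff_isLittleO_nhds_zero, isLittleO_iff] at h
  have h1 := h (show 0 < c / (|r| + 1) by positivity)
  simp only [Real.one_rpow, mul_one, smul_eq_mul, Real.norm_eq_abs] at h1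
  have h2 : ∀ᶠ z : ℝ in 𝓝 0, -1 < z := lt_mem_nhds (by norm_num)
  obtain ⟨δ, hδ, hball⟩ := Metric.eventually_nhds_iff_ball.1 (h1.and h2)
  filter_upwards [Metric.ball_mem_nhds (0 : ℝ) hδ] with z hz
  have hsub : ∀ y ∈ Set.uIcc 0 z, y ∈ Metric.ball (0 : ℝ) δ ∧ |y| ≤ |z| := fun y hy => by
    have : |y| ≤ |z| := by
      have := Set.abs_sub_left_of_mem_uIcc hy
      simpa using this
    refine ⟨?_, this⟩
    rw [mem_ball_zero_iff, Real.norm_eq_abs] at *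
    linarith
  have key := (convex_uIcc 0 z).norm_image_sub_le_of_norm_hasDerivWithin_le
    (f := fun z : ℝ => (1 + z) ^ r - 1 - r * z - r * (r - 1) / 2 * z ^ 2)
    (f' := fun z : ℝ => r * ((1 + z) ^ (r - 1) - 1 - z * (r - 1))) (C := c * |z|)
    (fun y hy => by
      have hy1 := (hball y (hsub y hy).1).2
      have d1 := ((hasDerivAt_id y).const_add 1).rpow_const (p := r) (Or.inl (by
        simp only [id]; linarith))
      have d2 := ((d1.sub_const 1).sub ((hasDerivAt_id y).const_mul r)).sub
        (((hasDerivAt_id y).pow 2).const_mul (r * (r - 1) / 2))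
      refine (HasDerivAt.congr_deriv d2 ?_).hasDerivWithinAt
      simp
      ring)
    (fun y hy => by
      have hy1 := (hball y (hsub y hy).1).1
      rw [norm_mul, Real.norm_eq_abs, Real.norm_eq_abs]
      calc _ ≤ (|r| + 1) * (c / (|r| + 1) * |y|) := by gcongr; linarith
        _ = c * |y| := by field_simp
        _ ≤ _ := mul_le_mul_of_nonneg_left (hsub y hy).2 hc.le)
    Set.left_mem_uIcc Set.right_mem_uIcc
  simp only [Real.norm_eq_abs] at key ⊢
  simp only [add_zero, Real.one_rpow, sub_self, mul_zero, sub_zero, ne_eq, OfNat.ofNat_ne_zero,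
    not_false_eq_true, zero_pow] at key
  rwa [abs_pow, pow_two |z|, ← mul_assoc]

theorem tau1_pos : 0 < tau1 := by
  have := constX_pos
  unfold tau1; positivity

/-- The ratio of the two leading terms of the mean along the saddle point sequence. -/
noncomputable def saddleSlope : ℝ := (constX ^ 3)⁻¹ * constY / 4

/-- The relative correction of the saddle point, as a function of `n ^ (-1 / 10)`. -/
noncomputable def saddleCorr (e : ℝ) : ℝ :=
  -(3 / 5 * saddleSlope) * e - 3 / 50 * saddleSlope ^ 2 * e ^ 2

theorem saddlePoint_eq {n : ℕ} (hn : 0 < n) :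
    saddlePoint n = tau1 * (n : ℝ) ^ (-(3 / 5) : ℝ) * (1 + saddleCorr ((n : ℝ) ^ (-(1 / 10) : ℝ))) := by
  have hX := constX_pos.ne'
  have hn0 : (0 : ℝ) < n := by exact_mod_cast hn
  have e1 : (n : ℝ) ^ (-7 / 10 : ℝ) = (n : ℝ) ^ (-(3 / 5) : ℝ) * (n : ℝ) ^ (-(1 / 10) : ℝ) := by
    rw [← Real.rpow_add hn0]; norm_num
  have e2 : (n : ℝ) ^ (-4 / 5 : ℝ) = (n : ℝ) ^ (-(3 / 5) : ℝ) * ((n : ℝ) ^ (-(1 / 10) : ℝ)) ^ 2 := by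
    rw [pow_two, ← Real.rpow_add hn0, ← Real.rpow_add hn0]; norm_num
  rw [saddlePoint, e1, e2, neg_div, saddleCorr, saddleSlope, tau1, tau2, tau3]
  field_simp
  ring

theorem tendsto_saddleCorr : Tendsto saddleCorr (𝓝 0) (𝓝 0) := by
  have : Continuous saddleCorr := by unfold saddleCorr; fun_prop
  simpa [saddleCorr] using this.tendsto 0

theorem tendsto_eps : Tendsto (fun n : ℕ => (n : ℝ) ^ (-(1 / 10) : ℝ)) atTop (𝓝 0) :=
  (tendsto_rpow_neg_atTop (by norm_num)).comp tendsto_natCast_atTop_atTop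

theorem tendsto_one_add_saddleCorr :
    Tendsto (fun n : ℕ => 1 + saddleCorr ((n : ℝ) ^ (-(1 / 10) : ℝ))) atTop (𝓝 1) := by
  simpa using (tendsto_saddleCorr.comp tendsto_eps).const_add 1

theorem tendsto_saddlePoint_mul :
    Tendsto (fun n : ℕ => saddlePoint n * (n : ℝ) ^ (3 / 5 : ℝ)) atTop (𝓝 tau1) := by
  have h := tendsto_one_add_saddleCorr.const_mul tau1
  rw [mul_one] at h
  refine h.congr' ?_
  filter_upwards [eventually_gt_atTop 0] with n hn
  have hn0 : (0 : ℝ) < n := by exact_mod_cast hn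
  have e : (n : ℝ) ^ (-(3 / 5) : ℝ) * (n : ℝ) ^ (3 / 5 : ℝ) = 1 := by
    rw [← Real.rpow_add hn0]; norm_num
  rw [saddlePoint_eq hn]
  linear_combination -tau1 * (1 + saddleCorr ((n : ℝ) ^ (-(1 / 10) : ℝ))) * e

theorem eventually_saddlePoint_pos : ∀ᶠ n : ℕ in atTop, 0 < saddlePoint n := by
  filter_upwards [tendsto_saddlePoint_mul.eventually (lt_mem_nhds tau1_pos),
    eventually_gt_atTop 0] with n hn hn0
  have : (0 : ℝ) < (n : ℝ) ^ (3 / 5 : ℝ) := Real.rpow_pos_of_pos (by exact_mod_cast hn0) _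
  exact pos_of_mul_pos_left hn this.le

theorem tendsto_saddlePoint : Tendsto saddlePoint atTop (𝓝[>] 0) := by
  refine tendsto_nhdsWithin_iff.2 ⟨?_, eventually_saddlePoint_pos⟩
  have h1 : Tendsto (fun n : ℕ => (n : ℝ) ^ (-(3 / 5) : ℝ)) atTop (𝓝 0) :=
    (tendsto_rpow_neg_atTop (by norm_num)).comp tendsto_natCast_atTop_atTop
  have h2 := tendsto_saddlePoint_mul.mul h1
  rw [mul_zero] at h2
  refine h2.congr' ?_
  filter_upwards [eventually_gt_atTop 0] with n hn
  have hn0 : (0 : ℝ) < n := by exact_mod_cast hn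
  rw [mul_assoc, ← Real.rpow_add hn0]
  norm_num

/-- The correction c = -(3/5) b e - (3/50) b² e² is chosen so that the orders e and e² of this
expression cancel: first -(5/3) c against b e, then 1/10 + 4/5 - 9/10 = 0 in front of b² e². -/
theorem saddle_expansion :
    (fun e : ℝ => (1 + saddleCorr e) ^ (-(5 / 3) : ℝ)
      - saddleSlope * e * (1 + saddleCorr e) ^ (-(3 / 2) : ℝ) - 1) =o[𝓝 0] fun e => e ^ 2 := by
  set b := saddleSlope with hb
  have hO : saddleCorr =O[𝓝 0] fun e : ℝ => e := by
    have h1 : (fun e : ℝ => -(3 / 5 * b) * e) =O[𝓝 0] fun e : ℝ => e := (isBigO_refl _ _).const_mul_left _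
    have h2 : (fun e : ℝ => 3 / 50 * b ^ 2 * e ^ 2) =O[𝓝 0] fun e : ℝ => e :=
      ((isLittleO_pow_id one_lt_two).isBigO).const_mul_left _
    exact h1.sub h2
  have hO2 : (fun e => saddleCorr e ^ 2) =O[𝓝 0] fun e : ℝ => e ^ 2 := hO.pow 2
  have r1 := ((rpow_taylor_two (-(5 / 3))).comp_tendsto tendsto_saddleCorr).trans_isBigO hO2
  have r2 := ((rpow_taylor_two (-(3 / 2))).comp_tendsto tendsto_saddleCorr).trans_isBigO hO2
  have c1 : (fun e : ℝ => b * e) =O[𝓝 0] fun _ => (1 : ℝ) := by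
    have : Continuous fun e : ℝ => b * e := by fun_prop
    exact this.continuousAt.isBigO_one ℝ
  have r3 := c1.mul_isLittleO r2
  simp only [one_mul] at r3
  -- The coefficients 20/9 and 15/8 are r(r - 1)/2 for r = -5/3 and r = -3/2. After cancellation the
  -- polynomial is divisible by e³.
  have hpoly : (fun e : ℝ => -(5 / 3) * saddleCorr e + 20 / 9 * saddleCorr e ^ 2
      - b * e * (1 + -(3 / 2) * saddleCorr e + 15 / 8 * saddleCorr e ^ 2)) =o[𝓝 0]
      fun e => e ^ 2 := by
    have h3 : (fun e : ℝ => e ^ 3) =o[𝓝 0] fun e => e ^ 2 := isLittleO_pow_pow (by norm_num)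
    have h4 : (fun e : ℝ => 4 / 25 * b ^ 3 + 20 / 9 * (3 / 50 * b ^ 2) ^ 2 * e
        - (3 / 2) * (3 / 50) * b ^ 3 - 15 / 8 * b * (-(3 / 5 * b) - 3 / 50 * b ^ 2 * e) ^ 2)
        =O[𝓝 0] fun _ => (1 : ℝ) := by
      have : Continuous fun e : ℝ => 4 / 25 * b ^ 3 + 20 / 9 * (3 / 50 * b ^ 2) ^ 2 * e
        - (3 / 2) * (3 / 50) * b ^ 3 - 15 / 8 * b * (-(3 / 5 * b) - 3 / 50 * b ^ 2 * e) ^ 2 := by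
        fun_prop
      exact this.continuousAt.isBigO_one ℝ
    have h5 := h4.mul_isLittleO h3
    simp only [one_mul] at h5
    refine h5.congr_left fun e => ?_
    rw [saddleCorr, ← hb]
    ring
  have := (r1.sub r3).add hpoly
  refine this.congr_left fun e => ?_
  simp only [Function.comp]
  ring

/-- With e = n^(-1/10) the scale n^(4/5) is n e², which is the precision of `saddle_expansion`. The
error t^(-7/6) in the mean has order n^(7/10) and is negligible. -/
theorem tendsto_totalMean_saddlePoint :
    Tendsto (fun n : ℕ => (totalMean (saddlePoint n) - n) / (n : ℝ) ^ (4 / 5 : ℝ)) atTop (𝓝 0) := by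
  obtain ⟨C, hC, h⟩ := exists_abs_totalMean_sub_le
  have hX := constX_pos
  have h1 := (saddle_expansion.comp_tendsto tendsto_eps).tendsto_div_nhds_zero
  have h2 : Tendsto (fun n : ℕ => C * (saddlePoint n * (n : ℝ) ^ (3 / 5 : ℝ)) ^ (-(7 / 6) : ℝ) *
      (n : ℝ) ^ (-(1 / 10) : ℝ)) atTop (𝓝 0) := by
    have := ((tendsto_saddlePoint_mul.rpow_const (p := -(7 / 6)) (Or.inl tau1_pos.ne')).const_mul
      C).mul tendsto_eps
    rwa [mul_zero] at this
  have h3 := h1.norm.add h2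
  rw [norm_zero, add_zero] at h3
  rw [tendsto_zero_iff_norm_tendsto_zero]
  refine squeeze_zero' (Eventually.of_forall fun _ => norm_nonneg _) ?_ h3
  filter_upwards [eventually_gt_atTop 0, eventually_saddlePoint_pos,
    tendsto_one_add_saddleCorr.eventually (lt_mem_nhds zero_lt_one)] with n hn ht hu
  have hn0 : (0 : ℝ) < n := by exact_mod_cast hn
  have hmain := h _ ht
  set e : ℝ := (n : ℝ) ^ (-(1 / 10) : ℝ) with he
  set u : ℝ := 1 + saddleCorr e with hu_def
  set t := saddlePoint n with ht_def
  have hte : t = tau1 * (n : ℝ) ^ (-(3 / 5) : ℝ) * u := saddlePoint_eq hn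
  have htau := tau1_pos
  have p1 : t ^ (-(5 / 3) : ℝ) = tau1 ^ (-(5 / 3) : ℝ) * n * u ^ (-(5 / 3) : ℝ) := by
    rw [hte, Real.mul_rpow (by positivity) hu.le, Real.mul_rpow htau.le (by positivity),
      ← Real.rpow_mul hn0.le]
    norm_num
  have p2 : t ^ (-(3 / 2) : ℝ) = tau1 ^ (-(3 / 2) : ℝ) * (n * e) * u ^ (-(3 / 2) : ℝ) := by
    rw [hte, Real.mul_rpow (by positivity) hu.le, Real.mul_rpow htau.le (by positivity),
      ← Real.rpow_mul hn0.le, he, ← Real.rpow_one_add' hn0.le (by norm_num)]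
    norm_num
  have q1 : 2 ^ (5 / 3 : ℝ) * constX ^ (10 / 3 : ℝ) * tau1 ^ (-(5 / 3) : ℝ) = 1 := by
    rw [tau1, Real.mul_rpow (by norm_num) (by positivity), ← Real.rpow_natCast, ← Real.rpow_mul hX.le]
    have a1 : (2 : ℝ) ^ (5 / 3 : ℝ) * 2 ^ (-(5 / 3) : ℝ) = 1 := by
      rw [← Real.rpow_add (by norm_num)]; norm_num
    have a2 : constX ^ (10 / 3 : ℝ) * constX ^ (((2 : ℕ) : ℝ) * -(5 / 3)) = 1 := by
      rw [← Real.rpow_add hX]; norm_num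
    calc _ = (2 ^ (5 / 3 : ℝ) * 2 ^ (-(5 / 3) : ℝ)) *
          (constX ^ (10 / 3 : ℝ) * constX ^ (((2 : ℕ) : ℝ) * -(5 / 3))) := by ring
      _ = 1 := by rw [a1, a2, one_mul]
  have q2 : 2 ^ (-(1 / 2) : ℝ) * constY * tau1 ^ (-(3 / 2) : ℝ) = saddleSlope := by
    rw [tau1, Real.mul_rpow (by norm_num) (by positivity), ← Real.rpow_natCast, ← Real.rpow_mul hX.le]
    have a1 : (2 : ℝ) ^ (-(1 / 2) : ℝ) * 2 ^ (-(3 / 2) : ℝ) = 1 / 4 := by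
      rw [← Real.rpow_add (by norm_num)]
      norm_num
    have a2 : constX ^ (((2 : ℕ) : ℝ) * -(3 / 2)) = (constX ^ 3)⁻¹ := by
      rw [← Real.rpow_natCast, ← Real.rpow_neg hX.le]; norm_num
    rw [a2, saddleSlope]
    linear_combination constY * (constX ^ 3)⁻¹ * a1
  rw [p1, p2] at hmain
  have e2 : (n : ℝ) ^ (4 / 5 : ℝ) = n * e ^ 2 := by
    rw [he, pow_two, ← Real.rpow_add hn0, ← Real.rpow_one_add' hn0.le (by norm_num)]
    norm_num
  have he0 : 0 < e := by positivity
  have split : (totalMean t - n) / (n : ℝ) ^ (4 / 5 : ℝ)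
      = (u ^ (-(5 / 3) : ℝ) - saddleSlope * e * u ^ (-(3 / 2) : ℝ) - 1) / e ^ 2
      + (totalMean t - (2 ^ (5 / 3 : ℝ) * constX ^ (10 / 3 : ℝ) *
        (tau1 ^ (-(5 / 3) : ℝ) * n * u ^ (-(5 / 3) : ℝ)) - 2 ^ (-(1 / 2) : ℝ) * constY *
        (tau1 ^ (-(3 / 2) : ℝ) * (n * e) * u ^ (-(3 / 2) : ℝ)))) / (n : ℝ) ^ (4 / 5 : ℝ) := by
    have : 2 ^ (5 / 3 : ℝ) * constX ^ (10 / 3 : ℝ) *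
        (tau1 ^ (-(5 / 3) : ℝ) * n * u ^ (-(5 / 3) : ℝ)) - 2 ^ (-(1 / 2) : ℝ) * constY *
        (tau1 ^ (-(3 / 2) : ℝ) * (n * e) * u ^ (-(3 / 2) : ℝ))
        = n * u ^ (-(5 / 3) : ℝ) - saddleSlope * (n * e) * u ^ (-(3 / 2) : ℝ) := by
      linear_combination n * u ^ (-(5 / 3) : ℝ) * q1 - n * e * u ^ (-(3 / 2) : ℝ) * q2
    rw [this, e2]
    field_simp
    ring
  rw [split]
  refine (norm_add_le _ _).trans ?_
  refine add_le_add le_rfl ?_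
  rw [norm_div, Real.norm_of_nonneg (by positivity : 0 ≤ (n : ℝ) ^ (4 / 5 : ℝ)),
    div_le_iff₀ (by positivity)]
  refine hmain.trans (le_of_eq ?_)
  rw [Real.mul_rpow ht.le (by positivity), ← Real.rpow_mul hn0.le, he, mul_assoc C, mul_assoc C,
    mul_assoc, mul_assoc, ← Real.rpow_add hn0, ← Real.rpow_add hn0]
  norm_num

/-! ### Moments and characteristic function of a geometric variable. -/

theorem hasSum_integral_comp_nat {Ω : Type*} [MeasurableSpace Ω] {P : Measure Ω} [IsFiniteMeasure P]
    {E : Type*} [NormedAddCommGroup E] [NormedSpace ℝ E] [CompleteSpace E]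
    {K : Ω → ℕ} (hK : Measurable K) {f : ℕ → E}
    (hs : Summable fun m => P.real {ω | K ω = m} * ‖f m‖) :
    Integrable (fun ω => f (K ω)) P ∧
      HasSum (fun m => P.real {ω | K ω = m} • f m) (∫ ω, f (K ω) ∂P) := by
  have hμ : ∀ m, P.map K {m} = P {ω | K ω = m} := fun m => by
    rw [Measure.map_apply hK (measurableSet_singleton m)]; rfl
  have hfin : ∀ m, P.map K {m} ≠ ∞ := fun m => by rw [hμ]; exact measure_ne_top _ _
  have hs' : Summable fun m => (P.map K {m}).toReal * ‖f m‖ := by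
    simpa only [hμ, ← measureReal_def] using hs
  have h1 := integrable_sum_dirac (x := fun m : ℕ => m) hfin hs'
  have h2 := hasSum_integral_sum_dirac (x := fun m : ℕ => m) hfin hs'
  rw [Measure.sum_smul_dirac] at h1 h2
  rw [integral_map hK.aemeasurable h1.aestronglyMeasurable] at h2
  refine ⟨h1.comp_measurable hK, ?_⟩
  simpa only [hμ, ← measureReal_def] using h2

theorem hasSum_choose_mul_geometric (k : ℕ) {q : ℝ} (hq : 0 < q) (hq1 : q < 1) :
    HasSum (fun m : ℕ => (m.choose k : ℝ) * q ^ m) (q ^ k / (1 - q) ^ (k + 1)) := by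
  have h := (hasSum_choose_mul_geometric_of_norm_lt_one k (r := q)
    (by rwa [Real.norm_of_nonneg hq.le])).mul_left (q ^ k)
  rw [← hasSum_nat_add_iff' k, Finset.sum_eq_zero, sub_zero]
  · refine (h.congr_fun fun m => ?_).trans ?_ |> fun h => h
    · rw [pow_add]; ring
    · rw [mul_one_div]
  · intro m hm
    rw [Nat.choose_eq_zero_of_lt (Finset.mem_range.1 hm)]; simp

section Geometric

variable {Ω : Type*} [MeasurableSpace Ω] {P : Measure Ω} [IsProbabilityMeasure P] {K : Ω → ℕ} {q : ℝ}

/-- Binomial moments of a geometric variable are pure powers of q/(1 - q); the ordinary second and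
third moments follow by expanding in binomials. -/
theorem integral_choose_geometric (hK : Measurable K) (hq : 0 < q) (hq1 : q < 1)
    (hlaw : ∀ m, P.real {ω | K ω = m} = (1 - q) * q ^ m) (k : ℕ) :
    Integrable (fun ω => ((K ω).choose k : ℝ)) P ∧
      ∫ ω, ((K ω).choose k : ℝ) ∂P = q ^ k / (1 - q) ^ k := by
  have h1 := (hasSum_choose_mul_geometric k hq hq1).mul_left (1 - q)
  have h2 : ∀ m : ℕ, (1 - q) * ((m.choose k : ℝ) * q ^ m) = P.real {ω | K ω = m} • (m.choose k : ℝ) :=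
    fun m => by rw [hlaw, smul_eq_mul]; ring
  simp_rw [h2] at h1
  have h3 := hasSum_integral_comp_nat (P := P) hK (f := fun m => (m.choose k : ℝ)) (by
    refine h1.summable.congr fun m => ?_
    rw [Real.norm_of_nonneg (Nat.cast_nonneg _), smul_eq_mul])
  refine ⟨h3.1, (h3.2.unique h1).trans ?_⟩
  have : 1 - q ≠ 0 := by linarith
  rw [pow_succ]
  field_simp

theorem nat_sq_eq_choose (m : ℕ) : (m : ℝ) ^ 2 = 2 * (m.choose 2 : ℝ) + (m.choose 1 : ℝ) := by
  rw [Nat.choose_one_right, Nat.cast_choose_two]; ring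

theorem nat_cube_eq_choose (m : ℕ) :
    (m : ℝ) ^ 3 = 6 * (m.choose 3 : ℝ) + 6 * (m.choose 2 : ℝ) + (m.choose 1 : ℝ) := by
  induction m with
  | zero => simp
  | succ m ih =>
    rw [Nat.choose_succ_succ' m 2, Nat.choose_succ_succ' m 1, Nat.choose_succ_succ' m 0]
    have h2 := Nat.cast_choose_two ℝ m
    push_cast
    simp only [Nat.choose_one_right, Nat.choose_zero_right] at ih ⊢
    rw [h2] at ih ⊢
    push_cast
    linear_combination ih

theorem integral_geometric (hK : Measurable K) (hq : 0 < q) (hq1 : q < 1)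
    (hlaw : ∀ m, P.real {ω | K ω = m} = (1 - q) * q ^ m) :
    Integrable (fun ω => (K ω : ℝ)) P ∧ ∫ ω, (K ω : ℝ) ∂P = q / (1 - q) := by
  have h := integral_choose_geometric hK hq hq1 hlaw 1
  simpa using h

theorem integral_sq_geometric (hK : Measurable K) (hq : 0 < q) (hq1 : q < 1)
    (hlaw : ∀ m, P.real {ω | K ω = m} = (1 - q) * q ^ m) :
    Integrable (fun ω => (K ω : ℝ) ^ 2) P ∧
      ∫ ω, (K ω : ℝ) ^ 2 ∂P = 2 * (q / (1 - q)) ^ 2 + q / (1 - q) := by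
  have h1 := integral_choose_geometric hK hq hq1 hlaw 1
  have h2 := integral_choose_geometric hK hq hq1 hlaw 2
  simp_rw [nat_sq_eq_choose]
  refine ⟨(h2.1.const_mul 2).add h1.1, ?_⟩
  rw [integral_add (h2.1.const_mul 2) h1.1, integral_const_mul, h1.2, h2.2, div_pow]
  simp

theorem integral_cube_geometric (hK : Measurable K) (hq : 0 < q) (hq1 : q < 1)
    (hlaw : ∀ m, P.real {ω | K ω = m} = (1 - q) * q ^ m) :
    Integrable (fun ω => (K ω : ℝ) ^ 3) P ∧
      ∫ ω, (K ω : ℝ) ^ 3 ∂P = 6 * (q / (1 - q)) ^ 3 + 6 * (q / (1 - q)) ^ 2 + q / (1 - q) := by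
  have h1 := integral_choose_geometric hK hq hq1 hlaw 1
  have h2 := integral_choose_geometric hK hq hq1 hlaw 2
  have h3 := integral_choose_geometric hK hq hq1 hlaw 3
  simp_rw [nat_cube_eq_choose]
  refine ⟨((h3.1.const_mul 6).add (h2.1.const_mul 6)).add h1.1, ?_⟩
  have hA : Integrable (fun ω => 6 * ((K ω).choose 3 : ℝ) + 6 * ((K ω).choose 2 : ℝ)) P :=
    (h3.1.const_mul 6).add (h2.1.const_mul 6)
  rw [integral_add hA h1.1,
    integral_add (h3.1.const_mul 6) (h2.1.const_mul 6), integral_const_mul, integral_const_mul,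
    h1.2, h2.2, h3.2, div_pow, div_pow]
  simp

theorem integral_exp_geometric (hK : Measurable K) (hq : 0 < q) (hq1 : q < 1)
    (hlaw : ∀ m, P.real {ω | K ω = m} = (1 - q) * q ^ m) (a : ℝ) :
    ∫ ω, Complex.exp (((a * K ω : ℝ) : ℂ) * Complex.I) ∂P
      = (1 - q : ℂ) / (1 - q * Complex.exp (a * Complex.I)) := by
  have hn : ‖(q : ℂ) * Complex.exp (a * Complex.I)‖ < 1 := by
    rw [norm_mul, Complex.norm_exp_ofReal_mul_I, mul_one, Complex.norm_real,
      Real.norm_of_nonneg hq.le]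
    exact hq1
  have h1 := (hasSum_geometric_of_norm_lt_one hn).mul_left (1 - q : ℂ)
  have h3 := (hasSum_integral_comp_nat (P := P) hK
    (f := fun m : ℕ => Complex.exp (((a * m : ℝ) : ℂ) * Complex.I)) (by
    simp only [Complex.norm_exp_ofReal_mul_I, mul_one, hlaw]
    exact (summable_geometric_of_lt_one hq.le hq1).mul_left _)).2
  rw [div_eq_mul_inv]
  refine h3.unique (h1.congr_fun fun m => ?_)
  rw [hlaw, mul_pow, ← Complex.exp_nat_mul, Complex.real_smul]
  push_cast
  ring_nf

theorem norm_sq_one_sub_mul_exp (q a : ℝ) :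
    ‖(1 : ℂ) - q * Complex.exp (a * Complex.I)‖ ^ 2 = (1 - q) ^ 2 + 4 * q * Real.sin (a / 2) ^ 2 := by
  have h1 := Real.sin_sq_add_cos_sq a
  have h2 := Real.cos_two_mul (a / 2)
  rw [mul_div_cancel₀ a two_ne_zero] at h2
  have h3 := Real.sin_sq_add_cos_sq (a / 2)
  rw [← Complex.normSq_eq_norm_sq, Complex.normSq_apply, Complex.sub_re, Complex.sub_im,
    Complex.re_ofReal_mul, Complex.im_ofReal_mul, Complex.exp_ofReal_mul_I_re,
    Complex.exp_ofReal_mul_I_im, Complex.one_re, Complex.one_im]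
  linear_combination q ^ 2 * h1 - 2 * q * h2 - 4 * q * h3

theorem norm_sq_integral_exp_geometric (hK : Measurable K) (hq : 0 < q) (hq1 : q < 1)
    (hlaw : ∀ m, P.real {ω | K ω = m} = (1 - q) * q ^ m) (a : ℝ) :
    ‖∫ ω, Complex.exp (((a * K ω : ℝ) : ℂ) * Complex.I) ∂P‖ ^ 2
      = (1 + 4 * (q / (1 - q) ^ 2) * Real.sin (a / 2) ^ 2)⁻¹ := by
  rw [integral_exp_geometric hK hq hq1 hlaw, norm_div, div_pow, norm_sq_one_sub_mul_exp]
  have e : ‖(1 - q : ℂ)‖ ^ 2 = (1 - q) ^ 2 := by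
    rw [show (1 - q : ℂ) = ((1 - q : ℝ) : ℂ) by push_cast; rfl, Complex.norm_real, Real.norm_eq_abs,
      sq_abs]
  have h1 : 0 < 1 - q := by linarith
  rw [e]
  field_simp

end Geometric

theorem norm_exp_mul_I_taylor_le (x : ℝ) :
    ‖Complex.exp (x * Complex.I) - (1 + x * Complex.I - x ^ 2 / 2)‖ ≤ 4 * |x| ^ 3 := by
  rcases le_total |x| 1 with h | h
  · have h1 := Complex.exp_bound (x := x * Complex.I) (by simpa using h) (n := 3) (by norm_num)
    have e : ∑ m ∈ Finset.range 3, ((x : ℂ) * Complex.I) ^ m / (m.factorial : ℂ)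
        = 1 + x * Complex.I - x ^ 2 / 2 := by
      simp [Finset.sum_range_succ, mul_pow]
      ring
    rw [e] at h1
    refine h1.trans ?_
    rw [norm_mul, Complex.norm_I, mul_one, Complex.norm_real, Real.norm_eq_abs]
    have : 0 ≤ |x| ^ 3 := by positivity
    norm_num [Nat.factorial]
    linarith
  · have h1 : ‖(1 + x * Complex.I - x ^ 2 / 2 : ℂ)‖ ≤ 1 + |x| + |x| ^ 2 / 2 := by
      refine (norm_sub_le _ _).trans ?_
      refine add_le_add ((norm_add_le _ _).trans ?_) ?_ <;> simp
    refine (norm_sub_le _ _).trans ?_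
    rw [Complex.norm_exp_ofReal_mul_I]
    nlinarith [mul_nonneg (sub_nonneg.2 h) (sub_nonneg.2 h), mul_nonneg (mul_nonneg
      (sub_nonneg.2 h) (sub_nonneg.2 h)) (sub_nonneg.2 h), sub_nonneg.2 h]

section Geometric

variable {Ω : Type*} [MeasurableSpace Ω] {P : Measure Ω} [IsProbabilityMeasure P] {K : Ω → ℕ} {q : ℝ}

/-- Gaussian approximation of the characteristic function of a geometric variable. -/
theorem norm_integral_exp_geometric_sub_le (hK : Measurable K) (hq : 0 < q) (hq1 : q < 1)
    (hlaw : ∀ m, P.real {ω | K ω = m} = (1 - q) * q ^ m) (a : ℝ) :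
    ‖∫ ω, Complex.exp (((a * (K ω - q / (1 - q)) : ℝ) : ℂ) * Complex.I) ∂P
      - ((Real.exp (-(a ^ 2 * (q / (1 - q) ^ 2) / 2)) : ℝ) : ℂ)‖
      ≤ 56 * (|a| ^ 3 * (q / (1 - q) ^ 3)) + (a ^ 2 * (q / (1 - q) ^ 2)) ^ 2 := by
  set μ := q / (1 - q) with hμ
  have hq' : 0 < 1 - q := by linarith
  have hμ0 : 0 < μ := by positivity
  set v := q / (1 - q) ^ 2 with hv
  have hv0 : 0 < v := by positivity
  obtain ⟨i1, m1⟩ := integral_geometric hK hq hq1 hlaw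
  obtain ⟨i2, m2⟩ := integral_sq_geometric hK hq hq1 hlaw
  obtain ⟨i3, m3⟩ := integral_cube_geometric hK hq hq1 hlaw
  have hKr : Measurable fun ω => (K ω : ℝ) := measurable_from_nat.comp hK
  have c1 : Integrable (fun ω => (K ω : ℝ) - μ) P := i1.sub (integrable_const _)
  have c2e : ∀ ω, ((K ω : ℝ) - μ) ^ 2 = (K ω : ℝ) ^ 2 - 2 * μ * K ω + μ ^ 2 := fun ω => by ring
  have c2 : Integrable (fun ω => ((K ω : ℝ) - μ) ^ 2) P := by
    simp_rw [c2e]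
    exact (i2.sub (i1.const_mul _)).add (integrable_const _)
  have e1 : ∫ ω, ((K ω : ℝ) - μ) ∂P = 0 := by
    rw [integral_sub i1 (integrable_const _), m1]; simp [hμ]
  have e2 : ∫ ω, ((K ω : ℝ) - μ) ^ 2 ∂P = v := by
    simp_rw [c2e]
    have hA : Integrable (fun ω => (K ω : ℝ) ^ 2 - 2 * μ * K ω) P := i2.sub (i1.const_mul _)
    rw [integral_add hA (integrable_const _),
      integral_sub i2 (i1.const_mul _), integral_const_mul, m1, m2, ← hμ]
    simp
    rw [hμ, hv]
    field_simp
    ring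
  have hb3 : ∀ ω, |(K ω : ℝ) - μ| ^ 3 ≤ (K ω : ℝ) ^ 3 + μ ^ 3 := fun ω => by
    have hk : (0 : ℝ) ≤ K ω := Nat.cast_nonneg _
    rcases le_total (K ω : ℝ) μ with h | h
    · rw [abs_of_nonpos (by linarith)]
      have : (-((K ω : ℝ) - μ)) ^ 3 ≤ μ ^ 3 := pow_le_pow_left₀ (by linarith) (by linarith) 3
      have : 0 ≤ (K ω : ℝ) ^ 3 := by positivity
      linarith
    · rw [abs_of_nonneg (by linarith)]
      have : ((K ω : ℝ) - μ) ^ 3 ≤ (K ω : ℝ) ^ 3 := pow_le_pow_left₀ (by linarith) (by linarith) 3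
      have : 0 ≤ μ ^ 3 := by positivity
      linarith
  -- The constant is 6 + 6 + 1 from the third moment plus 1 from μ³, each power of μ being at most
  -- q/(1 - q)³. The Taylor constant 4 then gives 56.
  have hint3 : ∫ ω, ((K ω : ℝ) ^ 3 + μ ^ 3) ∂P ≤ 14 * (q / (1 - q) ^ 3) := by
    rw [integral_add i3 (integrable_const _), m3]
    simp
    have h1 : μ ^ 3 ≤ q / (1 - q) ^ 3 := by
      rw [hμ, div_pow]; gcongr
      exact pow_le_of_le_one hq.le hq1.le (by norm_num)
    have h2 : μ ^ 2 ≤ q / (1 - q) ^ 3 := by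
      rw [hμ, div_pow]
      have : q ^ 2 ≤ q := pow_le_of_le_one hq.le hq1.le (by norm_num)
      have : (1 - q) ^ 3 ≤ (1 - q) ^ 2 := pow_le_pow_of_le_one hq'.le (by linarith) (by norm_num)
      gcongr
    have h3 : μ ≤ q / (1 - q) ^ 3 := by
      rw [hμ]
      have : (1 - q) ^ 3 ≤ 1 - q := pow_le_of_le_one hq'.le (by linarith) (by norm_num)
      gcongr
    linarith
  -- Taylor expansion under the integral
  have iT : Integrable (fun ω => (1 + ((a * (K ω - μ) : ℝ) : ℂ) * Complex.I
      - ((a * (K ω - μ) : ℝ) : ℂ) ^ 2 / 2)) P := by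
    refine ((integrable_const _).add (((c1.const_mul a).ofReal).mul_const _)).sub
      (Integrable.div_const ?_ _)
    have := (c2.const_mul (a ^ 2)).ofReal (𝕜 := ℂ)
    refine this.congr (Eventually.of_forall fun ω => ?_)
    simp; ring
  have iE : Integrable (fun ω => Complex.exp (((a * (K ω - μ) : ℝ) : ℂ) * Complex.I)) P := by
    refine Integrable.of_bound (C := 1) ?_ ?_
    · exact (by fun_prop : Measurable fun ω =>
        Complex.exp (((a * (K ω - μ) : ℝ) : ℂ) * Complex.I)).aestronglyMeasurable
    · exact Eventually.of_forall fun ω => (Complex.norm_exp_ofReal_mul_I _).le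
  have eT : ∫ ω, (1 + ((a * (K ω - μ) : ℝ) : ℂ) * Complex.I
      - ((a * (K ω - μ) : ℝ) : ℂ) ^ 2 / 2) ∂P = ((1 - a ^ 2 * v / 2 : ℝ) : ℂ) := by
    have i2' : Integrable (fun ω => ((a * (K ω - μ) : ℝ) : ℂ) ^ 2) P := by
      have := (c2.const_mul (a ^ 2)).ofReal (𝕜 := ℂ)
      refine this.congr (Eventually.of_forall fun ω => ?_)
      simp; ring
    have i1' : Integrable (fun ω => ((a * (K ω - μ) : ℝ) : ℂ) * Complex.I) P :=
      ((c1.const_mul a).ofReal).mul_const _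
    have hA : Integrable (fun ω => 1 + ((a * (K ω - μ) : ℝ) : ℂ) * Complex.I) P :=
      (integrable_const _).add i1'
    rw [integral_sub hA (i2'.div_const _),
      integral_add (integrable_const _) i1', integral_mul_const, integral_div]
    have f1 : ∫ ω, ((a * (K ω - μ) : ℝ) : ℂ) ∂P = 0 := by
      rw [integral_complex_ofReal, integral_const_mul, e1]; simp
    have f2 : ∫ ω, ((a * (K ω - μ) : ℝ) : ℂ) ^ 2 ∂P = ((a ^ 2 * v : ℝ) : ℂ) := by
      simp_rw [← Complex.ofReal_pow, mul_pow]
      rw [integral_complex_ofReal, integral_const_mul, e2]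
    rw [f1, f2]
    simp
  have hmain : ‖∫ ω, Complex.exp (((a * (K ω - μ) : ℝ) : ℂ) * Complex.I) ∂P
      - ((1 - a ^ 2 * v / 2 : ℝ) : ℂ)‖ ≤ 56 * (|a| ^ 3 * (q / (1 - q) ^ 3)) := by
    rw [← eT, ← integral_sub iE iT]
    calc _ ≤ ∫ ω, 4 * |a| ^ 3 * ((K ω : ℝ) ^ 3 + μ ^ 3) ∂P := by
          refine norm_integral_le_of_norm_le ((i3.add (integrable_const _)).const_mul _)
            (Eventually.of_forall fun ω => ?_)
          refine (norm_exp_mul_I_taylor_le _).trans ?_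
          rw [abs_mul, mul_pow, ← mul_assoc]
          gcongr
          exact hb3 ω
      _ ≤ 4 * |a| ^ 3 * (14 * (q / (1 - q) ^ 3)) := by
          rw [integral_const_mul]; gcongr
      _ = _ := by ring
  have hexp : |(1 - a ^ 2 * v / 2) - Real.exp (-(a ^ 2 * v / 2))| ≤ (a ^ 2 * v) ^ 2 := by
    set y := a ^ 2 * v / 2 with hy
    have hy0 : 0 ≤ y := by positivity
    have e : (a ^ 2 * v) ^ 2 = 4 * y ^ 2 := by rw [hy]; ring
    rw [e]
    have h1 := Real.add_one_le_exp (-y)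
    have h2 : Real.exp (-y) ≤ 1 - y + y ^ 2 := by
      have h3 := Real.quadratic_le_exp_of_nonneg hy0
      rw [Real.exp_neg, inv_le_iff_one_le_mul₀ (Real.exp_pos y)]
      have h4 : 0 < 1 - y + y ^ 2 := by nlinarith [sq_nonneg (y - 1)]
      nlinarith [mul_le_mul_of_nonneg_left h3 h4.le, pow_nonneg hy0 3, pow_nonneg hy0 4]
    rw [abs_le]
    constructor <;> nlinarith [sq_nonneg y]
  calc _ ≤ ‖∫ ω, Complex.exp (((a * (K ω - μ) : ℝ) : ℂ) * Complex.I) ∂P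
        - ((1 - a ^ 2 * v / 2 : ℝ) : ℂ)‖ + ‖((1 - a ^ 2 * v / 2 : ℝ) : ℂ)
        - ((Real.exp (-(a ^ 2 * v / 2)) : ℝ) : ℂ)‖ := norm_sub_le_norm_sub_add_norm_sub _ _ _
    _ ≤ _ := by
        refine add_le_add hmain ?_
        rw [← Complex.ofReal_sub, Complex.norm_real, Real.norm_eq_abs]
        exact hexp

end Geometric

/-! ### The total dimension: finiteness, moments, product formula. -/

theorem norm_prod_sub_prod_le {ι : Type*} (S : Finset ι) (f g : ι → ℂ) (hf : ∀ i, ‖f i‖ ≤ 1)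
    (hg : ∀ i, ‖g i‖ ≤ 1) : ‖∏ i ∈ S, f i - ∏ i ∈ S, g i‖ ≤ ∑ i ∈ S, ‖f i - g i‖ := by
  classical
  induction S using Finset.induction with
  | empty => simp
  | insert i S hi ih =>
    rw [Finset.prod_insert hi, Finset.prod_insert hi, Finset.sum_insert hi]
    have hG : ‖∏ j ∈ S, g j‖ ≤ 1 := by
      rw [norm_prod]; exact Finset.prod_le_one (fun _ _ => norm_nonneg _) fun j _ => hg j
    have e : f i * ∏ j ∈ S, f j - g i * ∏ j ∈ S, g j
        = f i * (∏ j ∈ S, f j - ∏ j ∈ S, g j) + (f i - g i) * ∏ j ∈ S, g j := by ring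
    rw [e]
    refine (norm_add_le _ _).trans ?_
    rw [norm_mul, norm_mul, add_comm]
    refine add_le_add (mul_le_of_le_one_right (norm_nonneg _) hG) ?_
    exact (mul_le_of_le_one_left (norm_nonneg _) (hf i)).trans ih

/-- The total dimension as a real number. -/
noncomputable def realDim {Ω : Type*} (M : ℕ+ × ℕ+ → Ω → ℕ) (ω : Ω) : ℝ := (totalDim M ω).toReal

theorem hasSum_realDim {Ω : Type*} {M : ℕ+ × ℕ+ → Ω → ℕ} {ω : Ω}
    (hω : totalDim M ω ≠ ∞) :
    HasSum (fun i => (irrepDim i : ℝ) * M i ω) (realDim M ω) := by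
  have h1 := ENNReal.hasSum_toReal hω
  rw [← ENNReal.tsum_toReal_eq (fun i => ENNReal.ne_top_of_tsum_ne_top hω i)] at h1
  simpa [realDim, totalDim] using h1

/-- The partial sums are natural numbers, and these form a closed subset of the reals. -/
theorem exists_nat_eq_totalDim {Ω : Type*} {M : ℕ+ × ℕ+ → Ω → ℕ} {ω : Ω}
    (hω : totalDim M ω ≠ ∞) : ∃ n : ℕ, totalDim M ω = n := by
  have h1 := hasSum_realDim hω
  have h2 : realDim M ω ∈ Set.range ((↑) : ℕ → ℝ) := by
    refine Nat.isClosedEmbedding_coe_real.isClosed_range.mem_of_tendsto h1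
      (Eventually.of_forall fun S => ⟨∑ i ∈ S, irrepDim i * M i ω, by push_cast; rfl⟩)
  obtain ⟨n, hn⟩ := h2
  refine ⟨n, ?_⟩
  rw [← ENNReal.ofReal_toReal hω, ← ENNReal.ofReal_natCast, hn]
  rfl

section Model

variable {Ω : Type*} [MeasurableSpace Ω] {t : ℝ} {P : Measure Ω} {M : ℕ+ × ℕ+ → Ω → ℕ}

theorem measurable_totalDim (h : IsRandomRepresentation t P M) : Measurable (totalDim M) := by
  refine Measurable.tsum fun i => Measurable.const_mul ?_ _
  exact measurable_from_nat.comp (h.measurable i)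

theorem measurable_realDim (h : IsRandomRepresentation t P M) : Measurable (realDim M) :=
  (measurable_totalDim h).ennreal_toReal

theorem cast_mul_eq_ofReal (a b : ℕ) : (a : ℝ≥0∞) * (b : ℝ≥0∞) = ENNReal.ofReal (a * b) := by
  rw [← Nat.cast_mul, ← Nat.cast_mul, ENNReal.ofReal_natCast]

theorem lintegral_summand (ht : 0 < t) (h : IsRandomRepresentation t P M) (i : ℕ+ × ℕ+) :
    ∫⁻ ω, (irrepDim i : ℝ≥0∞) * (M i ω : ℝ≥0∞) ∂P = ENNReal.ofReal (termMean t i) := by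
  have := h.isProbabilityMeasure
  obtain ⟨h1, h2⟩ := integral_geometric (h.measurable i) (ratio_pos t i) (ratio_lt_one ht i) (h.law i)
  simp_rw [cast_mul_eq_ofReal]
  rw [← ofReal_integral_eq_lintegral_ofReal (h1.const_mul _)
    (Eventually.of_forall fun ω => by positivity), integral_const_mul, h2]
  rfl

theorem lintegral_summand_sq (ht : 0 < t) (h : IsRandomRepresentation t P M) (i : ℕ+ × ℕ+) :
    ∫⁻ ω, ((irrepDim i : ℝ≥0∞) * (M i ω : ℝ≥0∞)) * ((irrepDim i : ℝ≥0∞) * (M i ω : ℝ≥0∞)) ∂P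
      = ENNReal.ofReal (termMean t i) * ENNReal.ofReal (termMean t i) + ENNReal.ofReal (termVar t i) := by
  have := h.isProbabilityMeasure
  obtain ⟨h1, h2⟩ := integral_sq_geometric (h.measurable i) (ratio_pos t i) (ratio_lt_one ht i) (h.law i)
  have e : ∀ ω, ((irrepDim i : ℝ≥0∞) * (M i ω : ℝ≥0∞)) * ((irrepDim i : ℝ≥0∞) * (M i ω : ℝ≥0∞))
      = ENNReal.ofReal ((irrepDim i : ℝ) ^ 2 * (M i ω : ℝ) ^ 2) := fun ω => by
    rw [cast_mul_eq_ofReal, ← ENNReal.ofReal_mul (by positivity)]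
    congr 1; ring
  simp_rw [e]
  rw [← ofReal_integral_eq_lintegral_ofReal (h1.const_mul _)
    (Eventually.of_forall fun ω => by positivity), integral_const_mul, h2,
    ← ENNReal.ofReal_mul (termMean_nonneg ht i), ← ENNReal.ofReal_add
    (mul_nonneg (termMean_nonneg ht i) (termMean_nonneg ht i)) (termVar_nonneg ht i)]
  congr 1
  have : 1 - ratio t i ≠ 0 := by linarith [ratio_lt_one ht i]
  unfold termMean termVar
  field_simp
  ring

theorem lintegral_summand_mul (ht : 0 < t) (h : IsRandomRepresentation t P M) {i j : ℕ+ × ℕ+}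
    (hij : i ≠ j) :
    ∫⁻ ω, ((irrepDim i : ℝ≥0∞) * (M i ω : ℝ≥0∞)) * ((irrepDim j : ℝ≥0∞) * (M j ω : ℝ≥0∞)) ∂P
      = ENNReal.ofReal (termMean t i) * ENNReal.ofReal (termMean t j) := by
  have hm : ∀ i, Measurable fun m : ℕ => (irrepDim i : ℝ≥0∞) * (m : ℝ≥0∞) := fun i => measurable_from_nat
  have hind := (h.indep.indepFun hij).comp (hm i) (hm j)
  have := lintegral_mul_eq_lintegral_mul_lintegral_of_indepFun ((hm i).comp (h.measurable i))
    ((hm j).comp (h.measurable j)) hind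
  rw [← lintegral_summand ht h, ← lintegral_summand ht h]
  exact this

theorem lintegral_totalDim (ht : 0 < t) (h : IsRandomRepresentation t P M) :
    ∫⁻ ω, totalDim M ω ∂P = ENNReal.ofReal (totalMean t) := by
  have hme : ∀ i, AEMeasurable (fun ω => (irrepDim i : ℝ≥0∞) * (M i ω : ℝ≥0∞)) P := fun i =>
    ((measurable_from_nat.comp (h.measurable i)).const_mul _).aemeasurable
  unfold totalDim totalMean
  rw [lintegral_tsum hme,
    ENNReal.ofReal_tsum_of_nonneg (termMean_nonneg ht) (summable_termMean ht)]
  simp_rw [lintegral_summand ht h]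

/-- Working in `[0, ∞]` lets both sums be exchanged with the integral before anything is known to be
finite. Independence makes every off-diagonal term a product of means, so only the diagonal adds
variances. -/
theorem lintegral_totalDim_sq (ht : 0 < t) (h : IsRandomRepresentation t P M) :
    ∫⁻ ω, totalDim M ω * totalDim M ω ∂P
      = ENNReal.ofReal (totalMean t) * ENNReal.ofReal (totalMean t) + ENNReal.ofReal (totalVar t) := by
  classical
  have hme : ∀ i, Measurable fun ω => (irrepDim i : ℝ≥0∞) * (M i ω : ℝ≥0∞) := fun i =>
    (measurable_from_nat.comp (h.measurable i)).const_mul _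
  have key : ∀ i, ∫⁻ ω, ((irrepDim i : ℝ≥0∞) * (M i ω : ℝ≥0∞)) * totalDim M ω ∂P
      = ENNReal.ofReal (termMean t i) * ENNReal.ofReal (totalMean t) + ENNReal.ofReal (termVar t i) := by
    intro i
    have hm2 : ∀ j, AEMeasurable (fun ω => ((irrepDim i : ℝ≥0∞) * (M i ω : ℝ≥0∞)) *
        ((irrepDim j : ℝ≥0∞) * (M j ω : ℝ≥0∞))) P := fun j => ((hme i).mul (hme j)).aemeasurable
    simp_rw [totalDim, ← ENNReal.tsum_mul_left]
    rw [lintegral_tsum hm2]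
    have e : ∀ j, ∫⁻ ω, ((irrepDim i : ℝ≥0∞) * (M i ω : ℝ≥0∞)) * ((irrepDim j : ℝ≥0∞) * (M j ω : ℝ≥0∞)) ∂P
        = ENNReal.ofReal (termMean t i) * ENNReal.ofReal (termMean t j)
          + if j = i then ENNReal.ofReal (termVar t i) else 0 := by
      intro j
      by_cases hij : j = i
      · subst hij; rw [if_pos rfl, lintegral_summand_sq ht h]
      · rw [if_neg hij, add_zero, lintegral_summand_mul ht h (Ne.symm hij)]
    simp_rw [e]
    rw [ENNReal.tsum_add, ENNReal.tsum_mul_left, tsum_ite_eq, totalMean,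
      ENNReal.ofReal_tsum_of_nonneg (termMean_nonneg ht) (summable_termMean ht)]
  have e : ∀ ω, totalDim M ω * totalDim M ω
      = ∑' i, ((irrepDim i : ℝ≥0∞) * (M i ω : ℝ≥0∞)) * totalDim M ω := fun ω => by
    rw [ENNReal.tsum_mul_right]; rfl
  have hm3 : ∀ i, AEMeasurable (fun ω => ((irrepDim i : ℝ≥0∞) * (M i ω : ℝ≥0∞)) * totalDim M ω) P :=
    fun i => ((hme i).mul (measurable_totalDim h)).aemeasurable
  simp_rw [e]
  rw [lintegral_tsum hm3]
  simp_rw [key]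
  rw [ENNReal.tsum_add, ENNReal.tsum_mul_right,
    ← ENNReal.ofReal_tsum_of_nonneg (termMean_nonneg ht) (summable_termMean ht),
    ← ENNReal.ofReal_tsum_of_nonneg (termVar_nonneg ht) (summable_termVar ht)]
  rfl

theorem totalDim_ae_ne_top (ht : 0 < t) (h : IsRandomRepresentation t P M) :
    ∀ᵐ ω ∂P, totalDim M ω ≠ ∞ := by
  have := ae_lt_top (measurable_totalDim h) (by rw [lintegral_totalDim ht h]; exact ENNReal.ofReal_ne_top)
  exact this.mono fun ω hω => hω.ne

theorem totalMean_nonneg (ht : 0 < t) : 0 ≤ totalMean t := tsum_nonneg (termMean_nonneg ht)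

theorem totalVar_nonneg (ht : 0 < t) : 0 ≤ totalVar t := tsum_nonneg (termVar_nonneg ht)

theorem integral_realDim (ht : 0 < t) (h : IsRandomRepresentation t P M) :
    ∫ ω, realDim M ω ∂P = totalMean t := by
  unfold realDim
  rw [integral_toReal (measurable_totalDim h).aemeasurable
    ((totalDim_ae_ne_top ht h).mono fun ω hω => hω.lt_top), lintegral_totalDim ht h,
    ENNReal.toReal_ofReal (totalMean_nonneg ht)]

theorem memLp_realDim (ht : 0 < t) (h : IsRandomRepresentation t P M) : MemLp (realDim M) 2 P := by
  refine (memLp_two_iff_integrable_sq (measurable_realDim h).aestronglyMeasurable).2 ?_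
  have e : (fun ω => realDim M ω ^ 2) = fun ω => (totalDim M ω * totalDim M ω).toReal := by
    funext ω; rw [realDim, ENNReal.toReal_mul, sq]
  rw [e]
  refine integrable_toReal_of_lintegral_ne_top
    ((measurable_totalDim h).mul (measurable_totalDim h)).aemeasurable ?_
  rw [lintegral_totalDim_sq ht h]
  exact ENNReal.add_ne_top.2 ⟨ENNReal.mul_ne_top ENNReal.ofReal_ne_top ENNReal.ofReal_ne_top,
    ENNReal.ofReal_ne_top⟩

theorem variance_realDim (ht : 0 < t) (h : IsRandomRepresentation t P M) :
    variance (realDim M) P = totalVar t := by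
  have := h.isProbabilityMeasure
  rw [variance_eq_sub (memLp_realDim ht h), integral_realDim ht h]
  have e : (realDim M ^ 2) = fun ω => (totalDim M ω * totalDim M ω).toReal := by
    funext ω; rw [Pi.pow_apply, realDim, ENNReal.toReal_mul, sq]
  have hm : AEMeasurable (fun ω => totalDim M ω * totalDim M ω) P :=
    ((measurable_totalDim h).mul (measurable_totalDim h)).aemeasurable
  rw [e, integral_toReal hm
    ((totalDim_ae_ne_top ht h).mono fun ω hω => (ENNReal.mul_ne_top hω hω).lt_top),
    lintegral_totalDim_sq ht h, ← ENNReal.ofReal_mul (totalMean_nonneg ht),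
    ← ENNReal.ofReal_add (mul_nonneg (totalMean_nonneg ht) (totalMean_nonneg ht)) (totalVar_nonneg ht),
    ENNReal.toReal_ofReal
      (add_nonneg (mul_nonneg (totalMean_nonneg ht) (totalMean_nonneg ht)) (totalVar_nonneg ht))]
  ring

theorem integral_exp_finset_sum (h : IsRandomRepresentation t P M) (c : ℕ+ × ℕ+ → ℝ) (θ : ℝ)
    (S : Finset (ℕ+ × ℕ+)) :
    ∫ ω, Complex.exp (((θ * ∑ i ∈ S, (irrepDim i * M i ω - c i) : ℝ) : ℂ) * Complex.I) ∂P
      = ∏ i ∈ S, ∫ ω, Complex.exp (((θ * (irrepDim i * M i ω - c i) : ℝ) : ℂ) * Complex.I) ∂P := by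
  have hm : ∀ i, Measurable fun m : ℕ => (irrepDim i : ℝ) * m - c i := fun i => measurable_from_nat
  have hX : ∀ i, Measurable fun ω => (irrepDim i : ℝ) * M i ω - c i := fun i =>
    (hm i).comp (h.measurable i)
  have hind : iIndepFun (fun i ω => (irrepDim i : ℝ) * M i ω - c i) P := h.indep.comp _ hm
  have h1 := (iIndepFun.charFun_map_fun_finsetSum_eq_prod (s := S)
    (fun i _ => (hX i).aemeasurable) (hind.restrict _))
  have h2 := congrFun h1 θ
  have cf : ∀ X : Ω → ℝ, Measurable X → charFun (P.map X) θ
      = ∫ ω, Complex.exp (((θ * X ω : ℝ) : ℂ) * Complex.I) ∂P := fun X hX => by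
    rw [charFun_apply_real, integral_map hX.aemeasurable (by fun_prop)]
    push_cast; rfl
  rw [Finset.prod_apply, cf _ (Finset.measurable_fun_sum _ fun i _ => hX i)] at h2
  rw [h2]
  exact Finset.prod_congr rfl fun i _ => cf _ (hX i)

/-- The summable centering c allows two uses: c = 0 for upper bounds, and c equal to the means for
the Gaussian comparison. -/
theorem tendsto_prod_integral_exp (ht : 0 < t) (h : IsRandomRepresentation t P M)
    {c : ℕ+ × ℕ+ → ℝ} {C : ℝ} (hc : HasSum c C) (θ : ℝ) :
    Tendsto (fun S : Finset (ℕ+ × ℕ+) =>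
      ∏ i ∈ S, ∫ ω, Complex.exp (((θ * (irrepDim i * M i ω - c i) : ℝ) : ℂ) * Complex.I) ∂P) atTop
      (𝓝 (∫ ω, Complex.exp (((θ * (realDim M ω - C) : ℝ) : ℂ) * Complex.I) ∂P)) := by
  have := h.isProbabilityMeasure
  simp_rw [← integral_exp_finset_sum h]
  have hX : ∀ i, Measurable fun ω => (irrepDim i : ℝ) * M i ω - c i := fun i =>
    (measurable_from_nat (f := fun m : ℕ => (irrepDim i : ℝ) * m - c i)).comp (h.measurable i)
  refine tendsto_integral_filter_of_dominated_convergence (fun _ => 1) ?_ ?_ (integrable_const _) ?_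
  · refine Eventually.of_forall fun S => Measurable.aestronglyMeasurable ?_
    have := Finset.measurable_fun_sum S fun i _ => hX i
    fun_prop
  · exact Eventually.of_forall fun S => Eventually.of_forall fun ω =>
      (Complex.norm_exp_ofReal_mul_I _).le
  · filter_upwards [totalDim_ae_ne_top ht h] with ω hω
    have h1 : Tendsto (fun S : Finset (ℕ+ × ℕ+) => ∑ i ∈ S, ((irrepDim i : ℝ) * M i ω - c i)) atTop
        (𝓝 (realDim M ω - C)) := (hasSum_realDim hω).sub hc
    have h2 : Continuous fun x : ℝ => Complex.exp (((θ * x : ℝ) : ℂ) * Complex.I) := by fun_prop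
    exact (h2.tendsto _).comp h1

/-- Every factor of the infinite product has modulus at most 1, so any convenient finite set of
indices gives an upper bound; the centering only contributes a unimodular phase. -/
theorem norm_integral_exp_le_prod (ht : 0 < t) (h : IsRandomRepresentation t P M) (c θ : ℝ)
    (S : Finset (ℕ+ × ℕ+)) :
    ‖∫ ω, Complex.exp (((θ * (realDim M ω - c) : ℝ) : ℂ) * Complex.I) ∂P‖ ^ 2
      ≤ ∏ i ∈ S, (1 + 4 * (ratio t i / (1 - ratio t i) ^ 2) * Real.sin (θ * irrepDim i / 2) ^ 2)⁻¹ := by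
  have := h.isProbabilityMeasure
  have hle1 : ∀ i, ‖∫ ω, Complex.exp (((θ * (irrepDim i * M i ω - 0) : ℝ) : ℂ) * Complex.I) ∂P‖ ≤ 1 :=
    fun i => (norm_integral_le_of_norm_le_const (C := 1)
      (Eventually.of_forall fun ω => (Complex.norm_exp_ofReal_mul_I _).le)).trans (by simp)
  have e0 : ‖∫ ω, Complex.exp (((θ * (realDim M ω - c) : ℝ) : ℂ) * Complex.I) ∂P‖
      = ‖∫ ω, Complex.exp (((θ * (realDim M ω - 0) : ℝ) : ℂ) * Complex.I) ∂P‖ := by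
    have : ∀ ω, Complex.exp (((θ * (realDim M ω - c) : ℝ) : ℂ) * Complex.I)
        = Complex.exp (((θ * (realDim M ω - 0) : ℝ) : ℂ) * Complex.I)
          * Complex.exp (((-(θ * c) : ℝ) : ℂ) * Complex.I) := fun ω => by
      rw [← Complex.exp_add]; push_cast; ring_nf
    simp_rw [this]
    rw [integral_mul_const, norm_mul, Complex.norm_exp_ofReal_mul_I, mul_one]
  have hfac : ∀ i, ‖∫ ω, Complex.exp (((θ * (irrepDim i * M i ω - 0) : ℝ) : ℂ) * Complex.I) ∂P‖ ^ 2
      = (1 + 4 * (ratio t i / (1 - ratio t i) ^ 2) * Real.sin (θ * irrepDim i / 2) ^ 2)⁻¹ := fun i => by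
    rw [← norm_sq_integral_exp_geometric (h.measurable i) (ratio_pos t i) (ratio_lt_one ht i) (h.law i)]
    simp_rw [sub_zero, mul_assoc]
  rw [e0]
  have hlim := (tendsto_prod_integral_exp ht h hasSum_zero θ).norm.pow 2
  refine le_of_tendsto hlim ?_
  filter_upwards [eventually_ge_atTop S] with T hT
  simp_rw [← hfac]
  rw [norm_prod, Finset.prod_pow]
  refine pow_le_pow_left₀ (by positivity) ?_ 2
  rw [← Finset.prod_sdiff hT]
  exact mul_le_of_le_one_left (Finset.prod_nonneg fun _ _ => norm_nonneg _)
    (Finset.prod_le_one (fun _ _ => norm_nonneg _) fun i _ => hle1 i)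

end Model

/-! ### Decay of the characteristic function. -/

theorem inv_one_add_le_exp {y z : ℝ} (hz : 0 ≤ z) (hz1 : z ≤ 1) (hzy : z ≤ y) :
    (1 + y)⁻¹ ≤ Real.exp (-(z / 2)) := by
  have h1 : Real.exp (z / 2) ≤ 1 + z := by
    have h := Real.abs_exp_sub_one_sub_id_le (x := z / 2) (by rw [abs_of_nonneg (by positivity)]; linarith)
    have := (abs_le.1 h).2
    nlinarith
  rw [Real.exp_neg]
  exact inv_anti₀ (Real.exp_pos _) (by linarith)

theorem exp_neg_div_sq_le {x : ℝ} (hx : 0 < x) :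
    Real.exp (-x) / x ^ 2 ≤ Real.exp (-x) / (1 - Real.exp (-x)) ^ 2 := by
  have h1 : Real.exp (-x) < 1 := Real.exp_lt_one_iff.2 (by linarith)
  have h2 : 1 - Real.exp (-x) ≤ x := by linarith [Real.add_one_le_exp (-x)]
  have h3 : 0 < 1 - Real.exp (-x) := by linarith
  gcongr

theorem exp_neg_le_div {x : ℝ} (hx : 0 < x) :
    Real.exp (-x) ≤ Real.exp (-x) / (1 - Real.exp (-x)) ^ 2 := by
  have h1 : Real.exp (-x) < 1 := Real.exp_lt_one_iff.2 (by linarith)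
  have h0 := Real.exp_pos (-x)
  have h3 : 0 < 1 - Real.exp (-x) := by linarith
  rw [le_div_iff₀ (by positivity)]
  exact mul_le_of_le_one_right h0.le (pow_le_one₀ h3.le (by linarith))

theorem sq_div_four_le_sin_sq {x : ℝ} (hx : |x| ≤ 1) : x ^ 2 / 4 ≤ Real.sin x ^ 2 := by
  have key : ∀ y : ℝ, 0 ≤ y → y ≤ 1 → y ^ 2 / 4 ≤ Real.sin y ^ 2 := fun y hy hy1 => by
    have h1 := Real.mul_le_sin hy (by linarith [Real.pi_gt_three])
    have h2 : 1 / 2 ≤ 2 / Real.pi := by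
      rw [div_le_div_iff₀ (by norm_num) Real.pi_pos]; linarith [Real.pi_le_four]
    have h3 : y / 2 ≤ Real.sin y := by nlinarith
    nlinarith
  rcases le_total 0 x with h | h
  · rw [abs_of_nonneg h] at hx; exact key x h hx
  · rw [abs_of_nonpos h] at hx
    have := key (-x) (by linarith) hx
    rwa [Real.sin_neg, neg_sq, neg_sq] at this

theorem abs_sin_add_le (x y : ℝ) : |Real.sin (x + y)| ≤ |Real.sin x| + |Real.sin y| := by
  rw [Real.sin_add]
  refine (abs_add_le _ _).trans ?_
  rw [abs_mul, abs_mul]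
  exact add_le_add (mul_le_of_le_one_right (abs_nonneg _) (Real.abs_cos_le_one _))
    (mul_le_of_le_one_left (abs_nonneg _) (Real.abs_cos_le_one _))

theorem sin_second_difference_sq_le (x y z : ℝ) :
    Real.sin (z - 2 * y + x) ^ 2 ≤ 4 * (Real.sin z ^ 2 + 2 * Real.sin y ^ 2 + Real.sin x ^ 2) := by
  have h1 : |Real.sin (z - 2 * y + x)| ≤ |Real.sin z| + 2 * |Real.sin y| + |Real.sin x| := by
    have e : z - 2 * y + x = z + (-y + (-y + x)) := by ring
    have f1 := abs_sin_add_le z (-y + (-y + x))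
    have f2 := abs_sin_add_le (-y) (-y + x)
    have f3 := abs_sin_add_le (-y) x
    rw [Real.sin_neg, abs_neg] at f2 f3
    rw [e]; linarith
  rw [← sq_abs (Real.sin (z - 2 * y + x)), ← sq_abs (Real.sin z), ← sq_abs (Real.sin y),
    ← sq_abs (Real.sin x)]
  have h0 := abs_nonneg (Real.sin (z - 2 * y + x))
  generalize |Real.sin (z - 2 * y + x)| = w at *
  generalize |Real.sin z| = a at *
  generalize |Real.sin y| = b at *
  generalize |Real.sin x| = c at *
  calc w ^ 2 ≤ (a + 2 * b + c) ^ 2 := pow_le_pow_left₀ h0 h1 2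
    _ ≤ _ := by nlinarith [sq_nonneg (a - b), sq_nonneg (b - c), sq_nonneg (a - c)]

/-- Quadratic Weyl-type bound: `θ k (k + 1) / 2` is not concentrated near multiples of `2π`. -/
theorem sum_sin_sq_ge {θ : ℝ} (hθ : 0 < θ) (hθ1 : θ ≤ Real.pi) (K : ℕ) :
    ((K : ℝ) - 2 * √(Real.pi / θ)) / 256
      ≤ ∑ k ∈ Finset.range K, Real.sin (θ * ((k + 1) * (k + 2) / 2) / 2) ^ 2 := by
  set s : ℕ → ℝ := fun k => Real.sin (θ * ((k + 1) * (k + 2) / 2) / 2) ^ 2 with hs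
  have hs0 : ∀ k, 0 ≤ s k := fun k => sq_nonneg _
  set R := √(Real.pi / θ) with hR
  have hRsq : R ^ 2 = Real.pi / θ := Real.sq_sqrt (by positivity)
  have hR1 : 1 ≤ R := by
    rw [hR, Real.one_le_sqrt, one_le_div hθ]; exact hθ1
  -- The shift r is about √(π/θ), which puts θ r²/2 between π/8 and π/2, where the sine is at least
  -- 1/4.
  set r := ⌊R⌋₊ with hr
  have hrR : (r : ℝ) ≤ R := Nat.floor_le (by linarith)
  have hr1 : (1 : ℝ) ≤ r := by exact_mod_cast Nat.one_le_floor_iff _ |>.2 hR1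
  have hr2 : R / 2 ≤ r := by
    have := Nat.lt_floor_add_one R
    rw [← hr] at this
    linarith
  have hsin : (1 : ℝ) / 16 ≤ Real.sin (θ * r ^ 2 / 2) ^ 2 := by
    have e : θ * R ^ 2 = Real.pi := by rw [hRsq]; field_simp
    have h1 : θ * r ^ 2 / 2 ≤ Real.pi / 2 := by
      have : θ * (r : ℝ) ^ 2 ≤ θ * R ^ 2 := by gcongr
      linarith
    have h2 : Real.pi / 8 ≤ θ * r ^ 2 / 2 := by
      have : θ * (R / 2) ^ 2 ≤ θ * (r : ℝ) ^ 2 := by gcongr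
      nlinarith
    have h3 := Real.mul_le_sin (x := θ * r ^ 2 / 2) (by positivity) h1
    have h4 : 2 / Real.pi * (Real.pi / 8) ≤ 2 / Real.pi * (θ * r ^ 2 / 2) := by gcongr
    have h5 : 2 / Real.pi * (Real.pi / 8) = 1 / 4 := by field_simp; norm_num
    nlinarith
  -- The second difference with step r of the quadratic phase is the constant θ r²/2. Hence the
  -- three sines cannot all be small.
  have hstep : ∀ m : ℕ, (1 : ℝ) / 16 ≤ 4 * (s (m + 2 * r) + 2 * s (m + r) + s m) := fun m => by
    refine hsin.trans ?_
    have h := sin_second_difference_sq_le (θ * (((m : ℕ) + 1) * ((m : ℕ) + 2) / 2) / 2)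
      (θ * (((m + r : ℕ) + 1) * ((m + r : ℕ) + 2) / 2) / 2)
      (θ * (((m + 2 * r : ℕ) + 1) * ((m + 2 * r : ℕ) + 2) / 2) / 2)
    have e : θ * (((m + 2 * r : ℕ) + 1) * ((m + 2 * r : ℕ) + 2) / 2) / 2
        - 2 * (θ * (((m + r : ℕ) + 1) * ((m + r : ℕ) + 2) / 2) / 2)
        + θ * (((m : ℕ) + 1) * ((m : ℕ) + 2) / 2) / 2 = θ * r ^ 2 / 2 := by
      push_cast; ring
    rw [e] at h
    exact h
  have hshift : ∀ a, a ≤ 2 * r → ∑ m ∈ Finset.range (K - 2 * r), s (m + a) ≤ ∑ k ∈ Finset.range K, s k := by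
    intro a ha
    rw [Finset.range_eq_Ico, Finset.sum_Ico_add', Finset.range_eq_Ico]
    refine Finset.sum_le_sum_of_subset_of_nonneg (fun k hk => ?_) fun k _ _ => hs0 k
    rw [Finset.mem_Ico] at hk ⊢
    omega
  have hsum : ((K - 2 * r : ℕ) : ℝ) * (1 / 16) ≤ 16 * ∑ k ∈ Finset.range K, s k := by
    calc ((K - 2 * r : ℕ) : ℝ) * (1 / 16) = ∑ _m ∈ Finset.range (K - 2 * r), (1 / 16 : ℝ) := by simp
      _ ≤ ∑ m ∈ Finset.range (K - 2 * r), 4 * (s (m + 2 * r) + 2 * s (m + r) + s m) :=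
          Finset.sum_le_sum fun m _ => hstep m
      _ = 4 * (∑ m ∈ Finset.range (K - 2 * r), s (m + 2 * r)
          + 2 * ∑ m ∈ Finset.range (K - 2 * r), s (m + r) + ∑ m ∈ Finset.range (K - 2 * r), s (m + 0)) := by
          rw [← Finset.mul_sum, Finset.sum_add_distrib, Finset.sum_add_distrib, ← Finset.mul_sum]
          simp only [add_zero]
      _ ≤ _ := by
          have f1 := hshift (2 * r) le_rfl
          have f2 := hshift r (by omega)
          have f3 := hshift 0 (by omega)
          linarith
  have hK : (K : ℝ) - 2 * r ≤ ((K - 2 * r : ℕ) : ℝ) := by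
    have : K ≤ (K - 2 * r) + 2 * r := by omega
    have : (K : ℝ) ≤ ((K - 2 * r : ℕ) : ℝ) + 2 * r := by exact_mod_cast this
    linarith
  linarith

section Model

variable {Ω : Type*} [MeasurableSpace Ω] {t : ℝ} {P : Measure Ω} {M : ℕ+ × ℕ+ → Ω → ℕ}

/-- For j, k ≤ T = t^(-1/3) the exponent d t is at most 1, so each geometric variance is comparable
to 1/(d t)² and each phase θd is at most 1. There are at least T²/4 such pairs, each contributing
order θ²/t². -/
theorem norm_integral_exp_central_le (ht : 0 < t) (ht1 : t ≤ 1) (h : IsRandomRepresentation t P M)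
    (c : ℝ) {θ : ℝ} (hθ : |θ| ≤ t) :
    ‖∫ ω, Complex.exp (((θ * (realDim M ω - c) : ℝ) : ℂ) * Complex.I) ∂P‖
      ≤ Real.exp (-(θ ^ 2 * t ^ (-(8 / 3) : ℝ) / 192)) := by
  set T := t ^ (-(1 / 3) : ℝ) with hT
  have hT1 : 1 ≤ T := Real.one_le_rpow_of_pos_of_le_one_of_nonpos ht ht1 (by norm_num)
  have hT3 : T ^ 3 * t = 1 := by
    rw [hT, ← Real.rpow_natCast, ← Real.rpow_mul ht.le]
    norm_num
    rw [Real.rpow_neg_one, inv_mul_cancel₀ ht.ne']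
  set m := ⌊T⌋₊ with hm
  have hmT : (m : ℝ) ≤ T := Nat.floor_le (by linarith)
  have hm2 : T / 2 ≤ m := by
    have h1 : (1 : ℝ) ≤ m := by exact_mod_cast Nat.one_le_floor_iff _ |>.2 hT1
    have := Nat.lt_floor_add_one T
    rw [← hm] at this
    linarith
  set S : Finset (ℕ+ × ℕ+) := (Finset.range m ×ˢ Finset.range m).map pairEquiv.symm.toEmbedding with hS
  have hcard : S.card = m ^ 2 := by simp [hS, sq]
  have hmem : ∀ i ∈ S, (irrepDim i : ℝ) * t ≤ 1 := by
    intro i hi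
    rw [hS, Finset.mem_map_equiv, Equiv.symm_symm, Finset.mem_product, Finset.mem_range,
      Finset.mem_range] at hi
    have h1 : (i.1 : ℝ) ≤ T := by
      rw [← pairEquiv_fst]; refine le_trans ?_ hmT; exact_mod_cast hi.1
    have h2 : (i.2 : ℝ) ≤ T := by
      rw [← pairEquiv_snd]; refine le_trans ?_ hmT; exact_mod_cast hi.2
    have h3 : (irrepDim i : ℝ) ≤ T ^ 3 := by
      rw [irrepDim_cast]
      calc (i.1 : ℝ) * i.2 * (i.1 + i.2) / 2 ≤ T * T * (T + T) / 2 := by gcongr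
        _ = T ^ 3 := by ring
    calc (irrepDim i : ℝ) * t ≤ T ^ 3 * t := by gcongr
      _ = 1 := hT3
  set z := θ ^ 2 / (12 * t ^ 2) with hz
  have hz1 : z ≤ 1 := by
    rw [hz, div_le_one (by positivity)]
    have := pow_le_pow_left₀ (abs_nonneg θ) hθ 2
    rw [sq_abs] at this
    nlinarith [sq_nonneg t]
  have hfac : ∀ i ∈ S, (1 + 4 * (ratio t i / (1 - ratio t i) ^ 2) * Real.sin (θ * irrepDim i / 2) ^ 2)⁻¹
      ≤ Real.exp (-(z / 2)) := by
    intro i hi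
    refine inv_one_add_le_exp (by positivity) hz1 ?_
    have hd := irrepDim_pos i
    set x := (irrepDim i : ℝ) * t with hx
    have hx0 : 0 < x := mul_pos hd ht
    have hx1 : x ≤ 1 := hmem i hi
    have h1 : 1 / 3 / x ^ 2 ≤ ratio t i / (1 - ratio t i) ^ 2 := by
      refine le_trans ?_ (exp_neg_div_sq_le hx0)
      gcongr
      have : Real.exp (-1) ≤ Real.exp (-x) := Real.exp_le_exp.2 (by linarith)
      refine le_trans ?_ this
      rw [Real.exp_neg, ← one_div]
      exact one_div_le_one_div_of_le (Real.exp_pos _) Real.exp_one_lt_three.le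
    have h2 : (θ * irrepDim i / 2) ^ 2 / 4 ≤ Real.sin (θ * irrepDim i / 2) ^ 2 := by
      refine sq_div_four_le_sin_sq ?_
      rw [abs_div, abs_mul, abs_of_pos hd, abs_of_pos (by norm_num : (0 : ℝ) < 2)]
      have : |θ| * irrepDim i ≤ t * irrepDim i := by gcongr
      linarith [mul_comm t (irrepDim i : ℝ)]
    calc z = 4 * (1 / 3 / x ^ 2) * ((θ * irrepDim i / 2) ^ 2 / 4) := by
          rw [hz, hx]; field_simp; ring
      _ ≤ _ := by
          have := ratio_pos t i
          gcongr
  have hprod := (norm_integral_exp_le_prod ht h c θ S).trans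
    (Finset.prod_le_prod (fun i _ => by have := ratio_pos t i; positivity) hfac)
  rw [Finset.prod_const, hcard, ← Real.exp_nat_mul] at hprod
  refine abs_le_of_sq_le_sq' (hprod.trans ?_) (Real.exp_pos _).le |>.2
  rw [← Real.exp_nat_mul, Real.exp_le_exp]
  have e : t ^ (-(8 / 3) : ℝ) = T ^ 2 / t ^ 2 := by
    rw [hT, ← Real.rpow_natCast, ← Real.rpow_natCast, ← Real.rpow_mul ht.le, ← Real.rpow_sub ht]
    norm_num
  have h4 : (T / 2) ^ 2 * z ≤ (m : ℝ) ^ 2 * z := by gcongr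
  rw [e]
  have e2 : (T / 2) ^ 2 * z = 4 * (θ ^ 2 * (T ^ 2 / t ^ 2) / 192) := by
    rw [hz]; field_simp; ring
  push_cast
  linarith

/-- Only the representations with j = 1 are used. Those with second index up to order t^(-1/2) have
d t ≤ 64, hence geometric variance at least exp(-64), and their dimensions are quadratic in k, so
`sum_sin_sq_ge` applies. -/
theorem norm_integral_exp_outer_le (ht : 0 < t) (ht1 : t ≤ 1) (h : IsRandomRepresentation t P M)
    (c : ℝ) {θ : ℝ} (hθ : t ≤ |θ|) (hθ1 : |θ| ≤ Real.pi) :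
    ‖∫ ω, Complex.exp (((θ * (realDim M ω - c) : ℝ) : ℂ) * Complex.I) ∂P‖
      ≤ Real.exp (-(Real.exp (-64) / 512 * t ^ (-(1 / 2) : ℝ))) := by
  set T := t ^ (-(1 / 2) : ℝ) with hT
  have hT1 : 1 ≤ T := Real.one_le_rpow_of_pos_of_le_one_of_nonpos ht ht1 (by norm_num)
  have hT2 : T ^ 2 * t = 1 := by
    rw [hT, ← Real.rpow_natCast, ← Real.rpow_mul ht.le]
    norm_num
    rw [Real.rpow_neg_one, inv_mul_cancel₀ ht.ne']
  have hθ0 : 0 < |θ| := ht.trans_le hθ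
  -- The differencing bound loses 2√(π/|θ|) ≤ 4T, so K close to 8T keeps a positive proportion of
  -- the terms.
  set K := ⌊8 * T⌋₊ with hK
  have hKT : (K : ℝ) ≤ 8 * T := Nat.floor_le (by linarith)
  have hKT' : 8 * T - 1 ≤ K := by
    have := Nat.lt_floor_add_one (8 * T)
    rw [← hK] at this
    linarith
  have hinj : Function.Injective fun k : ℕ => ((1 : ℕ+), k.succPNat) := fun a b hab =>
    Nat.succPNat_injective (Prod.ext_iff.1 hab).2
  set S : Finset (ℕ+ × ℕ+) := (Finset.range K).map ⟨_, hinj⟩ with hS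
  have hdim : ∀ k : ℕ, (irrepDim ((1 : ℕ+), k.succPNat) : ℝ) = (k + 1) * (k + 2) / 2 := fun k => by
    rw [irrepDim_cast, PNat.one_coe, Nat.succPNat_coe]; push_cast; ring
  set ε := Real.exp (-64) with hε
  have hε0 : 0 < ε := Real.exp_pos _
  have hε1 : ε ≤ 1 := Real.exp_le_one_iff.2 (by norm_num)
  have hfac : ∀ k ∈ Finset.range K, (1 + 4 * (ratio t ((1 : ℕ+), k.succPNat) /
      (1 - ratio t ((1 : ℕ+), k.succPNat)) ^ 2) *
      Real.sin (θ * irrepDim ((1 : ℕ+), k.succPNat) / 2) ^ 2)⁻¹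
      ≤ Real.exp (-(ε * Real.sin (|θ| * ((k + 1) * (k + 2) / 2) / 2) ^ 2 / 2)) := by
    intro k hk
    have hs : Real.sin (θ * irrepDim ((1 : ℕ+), k.succPNat) / 2) ^ 2
        = Real.sin (|θ| * ((k + 1) * (k + 2) / 2) / 2) ^ 2 := by
      rw [hdim]
      rcases abs_choice θ with h' | h' <;> rw [h']
      rw [neg_mul, neg_div, Real.sin_neg, neg_sq]
    rw [hs]
    have hsin1 := Real.sin_sq_le_one (|θ| * ((k + 1) * (k + 2) / 2) / 2)
    have hsin0 := sq_nonneg (Real.sin (|θ| * ((k + 1) * (k + 2) / 2) / 2))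
    refine inv_one_add_le_exp (by positivity) (by nlinarith) ?_
    refine mul_le_mul_of_nonneg_right ?_ hsin0
    have hx0 : 0 < (irrepDim ((1 : ℕ+), k.succPNat) : ℝ) * t := mul_pos (irrepDim_pos _) ht
    have h1 := exp_neg_le_div hx0
    have hk1 : ((k : ℝ) + 1) ≤ 8 * T := by
      refine le_trans ?_ hKT
      exact_mod_cast Finset.mem_range.1 hk
    have h2 : (irrepDim ((1 : ℕ+), k.succPNat) : ℝ) * t ≤ 64 := by
      rw [hdim]
      have : ((k : ℝ) + 1) * (k + 2) / 2 ≤ (8 * T) * (16 * T) / 2 := by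
        gcongr; linarith
      calc ((k : ℝ) + 1) * (k + 2) / 2 * t ≤ (8 * T) * (16 * T) / 2 * t := by gcongr
        _ = 64 * (T ^ 2 * t) := by ring
        _ = 64 := by rw [hT2, mul_one]
    have h3 : ε ≤ Real.exp (-((irrepDim ((1 : ℕ+), k.succPNat) : ℝ) * t)) :=
      Real.exp_le_exp.2 (by linarith)
    have h4 := h3.trans h1
    unfold ratio
    linarith
  have hprod := norm_integral_exp_le_prod ht h c θ S
  rw [hS, Finset.prod_map] at hprod
  have hprod2 := hprod.trans (Finset.prod_le_prod (fun k _ => by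
    have := ratio_pos t ((1 : ℕ+), k.succPNat)
    simp only [Function.Embedding.coeFn_mk]
    positivity) hfac)
  rw [← Real.exp_sum] at hprod2
  refine abs_le_of_sq_le_sq' (hprod2.trans ?_) (Real.exp_pos _).le |>.2
  rw [← Real.exp_nat_mul, Real.exp_le_exp, Finset.sum_neg_distrib, ← Finset.sum_div, ← Finset.mul_sum]
  have hw := sum_sin_sq_ge hθ0 hθ1 K
  have hR : √(Real.pi / |θ|) ≤ 2 * T := by
    rw [Real.sqrt_le_left (by positivity)]
    calc Real.pi / |θ| ≤ 4 / t := by gcongr; exact Real.pi_le_four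
      _ = 4 * (T ^ 2 * t) / t := by rw [hT2, mul_one]
      _ = (2 * T) ^ 2 := by field_simp; norm_num
  have hw2 : T / 128 ≤ ∑ k ∈ Finset.range K, Real.sin (|θ| * ((k + 1) * (k + 2) / 2) / 2) ^ 2 := by
    refine le_trans ?_ hw
    linarith
  have hw3 := mul_le_mul_of_nonneg_left hw2 hε0.le
  push_cast
  linarith

end Model

/-! ### Gaussian approximation and Fourier inversion. -/

theorem exists_tsum_termThird_le : ∃ C : ℝ, 0 < C ∧ ∀ t : ℝ, 0 < t →
    ∑' i, termThird t i ≤ C * t ^ (-(23 / 6) : ℝ) := by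
  obtain ⟨C, hC, h⟩ := exists_term_le
  have hs := summable_irrepDim_rpow
  have hpos : 0 < ∑' i : ℕ+ × ℕ+, (irrepDim i : ℝ) ^ (-(5 / 6) : ℝ) :=
    hs.tsum_pos (fun i => (Real.rpow_pos_of_pos (irrepDim_pos i) _).le) (1, 1)
      (Real.rpow_pos_of_pos (irrepDim_pos _) _)
  refine ⟨C * ∑' i : ℕ+ × ℕ+, (irrepDim i : ℝ) ^ (-(5 / 6) : ℝ), by positivity, fun t ht => ?_⟩
  have h1 : ∀ i, termThird t i ≤ C * t ^ (-(23 / 6) : ℝ) * (irrepDim i : ℝ) ^ (-(5 / 6) : ℝ) := fun i => by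
    have := h t i 3 ht le_rfl
    norm_num at this ⊢
    exact this
  calc _ ≤ ∑' i, C * t ^ (-(23 / 6) : ℝ) * (irrepDim i : ℝ) ^ (-(5 / 6) : ℝ) :=
        (summable_termThird ht).tsum_le_tsum h1 (hs.mul_left _)
    _ = _ := by rw [tsum_mul_left]; ring

/-- No single summand dominates: t^(-2) is of lower order than the total variance, of order
t^(-8/3). -/
theorem exists_termVar_le : ∃ C : ℝ, 0 < C ∧ ∀ (t : ℝ) (i : ℕ+ × ℕ+), 0 < t →
    termVar t i ≤ C / t ^ 2 := by
  obtain ⟨C, hC, h⟩ := exists_geom_le (p := 0) le_rfl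
  refine ⟨C, hC, fun t i ht => ?_⟩
  have h1 := h (irrepDim i * t) 2 (mul_pos (irrepDim_pos i) ht) (by norm_num)
  rw [neg_zero, Real.rpow_zero, mul_one, mul_pow] at h1
  rw [le_div_iff₀ (by positivity), termVar, ratio]
  linarith

section Model

variable {Ω : Type*} [MeasurableSpace Ω] {t : ℝ} {P : Measure Ω} {M : ℕ+ × ℕ+ → Ω → ℕ}

/-- Gaussian approximation of the characteristic function of the total dimension. -/
theorem norm_integral_exp_sub_gaussian_le (ht : 0 < t) (h : IsRandomRepresentation t P M) {B : ℝ}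
    (hB : ∀ i, termVar t i ≤ B) (θ : ℝ) :
    ‖∫ ω, Complex.exp (((θ * (realDim M ω - totalMean t) : ℝ) : ℂ) * Complex.I) ∂P
      - ((Real.exp (-(θ ^ 2 * totalVar t / 2)) : ℝ) : ℂ)‖
      ≤ 56 * |θ| ^ 3 * ∑' i, termThird t i + θ ^ 4 * B * totalVar t := by
  have := h.isProbabilityMeasure
  have hlim1 := tendsto_prod_integral_exp ht h (summable_termMean ht).hasSum θ
  have hlim2 : Tendsto (fun S : Finset (ℕ+ × ℕ+) =>
      ∏ i ∈ S, ((Real.exp (-(θ ^ 2 * termVar t i / 2)) : ℝ) : ℂ)) atTop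
      (𝓝 ((Real.exp (-(θ ^ 2 * totalVar t / 2)) : ℝ) : ℂ)) := by
    have h1 : HasSum (fun i => -(θ ^ 2 * termVar t i / 2)) (-(θ ^ 2 * totalVar t / 2)) :=
      (((summable_termVar ht).hasSum.mul_left _).div_const _).neg
    have h2 : Tendsto (fun S : Finset (ℕ+ × ℕ+) =>
        ((Real.exp (∑ i ∈ S, -(θ ^ 2 * termVar t i / 2)) : ℝ) : ℂ)) atTop
        (𝓝 ((Real.exp (-(θ ^ 2 * totalVar t / 2)) : ℝ) : ℂ)) :=
      ((Complex.continuous_ofReal.comp Real.continuous_exp).tendsto _).comp h1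
    refine h2.congr fun S => ?_
    rw [Real.exp_sum]; push_cast; rfl
  refine le_of_tendsto (hlim1.sub hlim2).norm (Eventually.of_forall fun S => ?_)
  refine (norm_prod_sub_prod_le S _ _ (fun i => ?_) fun i => ?_).trans ?_
  · exact (norm_integral_le_of_norm_le_const (C := 1)
      (Eventually.of_forall fun ω => (Complex.norm_exp_ofReal_mul_I _).le)).trans (by simp)
  · rw [Complex.norm_real, Real.norm_of_nonneg (Real.exp_pos _).le, Real.exp_le_one_iff]
    have := termVar_nonneg ht i
    have : 0 ≤ θ ^ 2 * termVar t i / 2 := by positivity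
    linarith
  have hterm : ∀ i, ‖∫ ω, Complex.exp (((θ * (irrepDim i * M i ω - termMean t i) : ℝ) : ℂ) * Complex.I) ∂P
      - ((Real.exp (-(θ ^ 2 * termVar t i / 2)) : ℝ) : ℂ)‖
      ≤ 56 * |θ| ^ 3 * termThird t i + θ ^ 4 * B * termVar t i := by
    intro i
    have h1 := norm_integral_exp_geometric_sub_le (h.measurable i) (ratio_pos t i) (ratio_lt_one ht i)
      (h.law i) (θ * irrepDim i)
    have e1 : ∀ ω, θ * irrepDim i * (M i ω - ratio t i / (1 - ratio t i))
        = θ * (irrepDim i * M i ω - termMean t i) := fun ω => by unfold termMean; ring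
    have e2 : (θ * irrepDim i) ^ 2 * (ratio t i / (1 - ratio t i) ^ 2) = θ ^ 2 * termVar t i := by
      unfold termVar; ring
    have e3 : |θ * irrepDim i| ^ 3 * (ratio t i / (1 - ratio t i) ^ 3) = |θ| ^ 3 * termThird t i := by
      rw [abs_mul, abs_of_pos (irrepDim_pos i)]; unfold termThird; ring
    simp_rw [e1] at h1
    rw [e2, e3] at h1
    refine h1.trans ?_
    -- The uniform bound B makes the squared variances summable against the total variance.
    have h2 : termVar t i * termVar t i ≤ B * termVar t i :=
      mul_le_mul_of_nonneg_right (hB i) (termVar_nonneg ht i)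
    have h3 : θ ^ 4 * (termVar t i * termVar t i) ≤ θ ^ 4 * (B * termVar t i) :=
      mul_le_mul_of_nonneg_left h2 (by positivity)
    nlinarith
  have hB0 : 0 ≤ B := (termVar_nonneg ht (1, 1)).trans (hB _)
  calc _ ≤ ∑ i ∈ S, (56 * |θ| ^ 3 * termThird t i + θ ^ 4 * B * termVar t i) :=
        Finset.sum_le_sum fun i _ => hterm i
    _ ≤ ∑' i, (56 * |θ| ^ 3 * termThird t i + θ ^ 4 * B * termVar t i) := by
        refine Summable.sum_le_tsum S (fun i _ => ?_)
          (((summable_termThird ht).mul_left _).add ((summable_termVar ht).mul_left _))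
        have := termThird_nonneg ht i
        have := termVar_nonneg ht i
        positivity
    _ = _ := by
        rw [Summable.tsum_add ((summable_termThird ht).mul_left _) ((summable_termVar ht).mul_left _),
          tsum_mul_left, tsum_mul_left]
        rfl

theorem integral_exp_int_mul (k : ℤ) :
    ∫ θ in (-Real.pi)..Real.pi, Complex.exp (((θ * k : ℝ) : ℂ) * Complex.I)
      = if k = 0 then (2 * Real.pi : ℂ) else 0 := by
  split_ifs with hk
  · subst hk
    simp
    ring
  · have hc : (k : ℂ) * Complex.I ≠ 0 := mul_ne_zero (by exact_mod_cast hk) Complex.I_ne_zero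
    have e : ∀ θ : ℝ, Complex.exp (((θ * k : ℝ) : ℂ) * Complex.I)
        = Complex.exp ((k : ℂ) * Complex.I * θ) := fun θ => by push_cast; ring_nf
    simp_rw [e]
    rw [integral_exp_mul_complex hc]
    have e2 : Complex.exp ((k : ℂ) * Complex.I * (Real.pi : ℝ))
        = Complex.exp ((k : ℂ) * Complex.I * ((-Real.pi : ℝ) : ℂ)) := by
      rw [Complex.exp_eq_exp_iff_exists_int]
      exact ⟨k, by push_cast; ring⟩
    rw [e2, sub_self, zero_div]

/-- Fourier inversion for the point probabilities of the total dimension. -/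
theorem two_pi_mul_prob_eq (ht : 0 < t) (h : IsRandomRepresentation t P M) (n : ℕ) :
    ((2 * Real.pi * P.real {ω | totalDim M ω = (n : ℝ≥0∞)} : ℝ) : ℂ)
      = ∫ θ in (-Real.pi)..Real.pi,
        ∫ ω, Complex.exp (((θ * (realDim M ω - n) : ℝ) : ℂ) * Complex.I) ∂P := by
  have := h.isProbabilityMeasure
  have hN := measurable_realDim h
  have : IsFiniteMeasure (volume.restrict (Set.uIoc (-Real.pi) Real.pi)) :=
    ⟨by rw [Measure.restrict_apply_univ, Set.uIoc]; exact measure_Ioc_lt_top⟩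
  have hint : Integrable (Function.uncurry fun (θ : ℝ) (ω : Ω) =>
      Complex.exp (((θ * (realDim M ω - n) : ℝ) : ℂ) * Complex.I))
      ((volume.restrict (Set.uIoc (-Real.pi) Real.pi)).prod P) := by
    refine Integrable.of_bound (C := 1) (Measurable.aestronglyMeasurable ?_)
      (Eventually.of_forall fun x => (Complex.norm_exp_ofReal_mul_I _).le)
    unfold Function.uncurry
    fun_prop
  rw [intervalIntegral_integral_swap hint]
  have e : ∀ᵐ ω ∂P, ∫ θ in (-Real.pi)..Real.pi,
      Complex.exp (((θ * (realDim M ω - n) : ℝ) : ℂ) * Complex.I)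
      = {ω | totalDim M ω = (n : ℝ≥0∞)}.indicator (fun _ => (2 * Real.pi : ℂ)) ω := by
    filter_upwards [totalDim_ae_ne_top ht h] with ω hω
    obtain ⟨m, hm⟩ := exists_nat_eq_totalDim hω
    have hr : realDim M ω - n = ((m - n : ℤ) : ℝ) := by
      rw [realDim, hm]; push_cast; rfl
    rw [hr, integral_exp_int_mul]
    by_cases hmn : m = n
    · subst hmn
      simp [hm]
    · rw [if_neg (by omega), Set.indicator_of_notMem]
      simp [hm, hmn]
  have hms : MeasurableSet {ω | totalDim M ω = (n : ℝ≥0∞)} :=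
    measurable_totalDim h (measurableSet_singleton _)
  rw [integral_congr_ae e, integral_indicator_const _ hms,
    Complex.real_smul]
  push_cast
  ring

end Model

/-! ### Domination and the local limit theorem. -/

theorem totalVar_pos {t : ℝ} (ht : 0 < t) : 0 < totalVar t := by
  refine (summable_termVar ht).tsum_pos (termVar_nonneg ht) (1, 1) ?_
  have := ratio_lt_one ht (1, 1); have := ratio_pos t (1, 1); have := irrepDim_pos (1, 1)
  have : 0 < 1 - ratio t (1, 1) := by linarith
  unfold termVar; positivity

theorem tendsto_sqrt_totalVar :
    Tendsto (fun t : ℝ => √(totalVar t) * t ^ (4 / 3 : ℝ)) (𝓝[>] 0) (𝓝 √(5 / 3 * leadConst)) := by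
  refine (tendsto_totalVar.sqrt).congr' ?_
  filter_upwards [self_mem_nhdsWithin] with t (ht : 0 < t)
  rw [Real.sqrt_mul (by positivity), mul_comm]
  congr 1
  rw [Real.sqrt_eq_iff_mul_self_eq (by positivity) (by positivity), ← Real.rpow_add ht]
  norm_num

/-- Domination of the rescaled characteristic function. -/
theorem exists_integrable_bound : ∃ g : ℝ → ℝ, Integrable g ∧ ∀ᶠ t : ℝ in 𝓝[>] 0,
    ∀ {Ω : Type*} [MeasurableSpace Ω] {P : Measure Ω} {M : ℕ+ × ℕ+ → Ω → ℕ},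
    IsRandomRepresentation t P M → ∀ c u : ℝ, |u| ≤ Real.pi * √(totalVar t) →
    ‖∫ ω, Complex.exp (((u / √(totalVar t) * (realDim M ω - c) : ℝ) : ℂ) * Complex.I) ∂P‖ ≤ g u := by
  set L := 5 / 3 * leadConst with hL
  have hL0 : 0 < L := by have := leadConst_pos; positivity
  -- The exponent 16/3 turns exp(-ε t^(-1/2)) into a multiple of t^(8/3). Since |u| ≤ πσ and σ²
  -- t^(8/3) < 2L, that is at most a multiple of 1/(1 + u²).
  obtain ⟨C, hC, hexp⟩ := exists_exp_neg_le (p := 16 / 3) (by norm_num)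
  set ε := Real.exp (-64) / 512 with hε
  have hε0 : 0 < ε := by positivity
  set D := C * ε ^ (-(16 / 3) : ℝ) * (1 + Real.pi ^ 2 * (2 * L)) with hD
  have hD0 : 0 < D := by positivity
  refine ⟨fun u => Real.exp (-(384 * L)⁻¹ * u ^ 2) + D * (1 + u ^ 2)⁻¹,
    (integrable_exp_neg_mul_sq (by positivity)).add (integrable_inv_one_add_sq.const_mul D), ?_⟩
  have hev : ∀ᶠ t : ℝ in 𝓝[>] 0, t ^ (8 / 3 : ℝ) * totalVar t < 2 * L :=
    tendsto_totalVar.eventually_lt_const (by linarith)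
  have hev1 : ∀ᶠ t : ℝ in 𝓝[>] 0, t < 1 := nhdsWithin_le_nhds (eventually_lt_nhds one_pos)
  filter_upwards [hev, hev1, self_mem_nhdsWithin] with t hV ht1 (ht : 0 < t)
  intro Ω _ P M h c u hu
  set σ := √(totalVar t) with hσ
  have hσ0 : 0 < σ := Real.sqrt_pos.2 (totalVar_pos ht)
  have hσ2 : σ ^ 2 = totalVar t := Real.sq_sqrt (totalVar_pos ht).le
  rw [← hσ2] at hV
  have htr : 0 < t ^ (8 / 3 : ℝ) := Real.rpow_pos_of_pos ht _
  have hle1 : t ^ (8 / 3 : ℝ) ≤ 1 := Real.rpow_le_one ht.le ht1.le (by norm_num)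
  have habs : |u / σ| = |u| / σ := by rw [abs_div, abs_of_pos hσ0]
  rcases le_total |u / σ| t with hc | hc
  · refine (norm_integral_exp_central_le ht ht1.le h c hc).trans ?_
    refine le_add_of_le_of_nonneg (Real.exp_le_exp.2 ?_) (by positivity)
    rw [neg_mul, neg_le_neg_iff, Real.rpow_neg ht.le, div_pow]
    have e : u ^ 2 / σ ^ 2 * (t ^ (8 / 3 : ℝ))⁻¹ / 192 = (192 * (t ^ (8 / 3 : ℝ) * σ ^ 2))⁻¹ * u ^ 2 := by
      field_simp
    rw [e]
    refine mul_le_mul_of_nonneg_right (inv_anti₀ (by positivity) (by linarith)) (sq_nonneg u)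
  · have hpi : |u / σ| ≤ Real.pi := by rw [habs, div_le_iff₀ hσ0]; exact hu
    refine (norm_integral_exp_outer_le ht ht1.le h c hc hpi).trans ?_
    refine le_add_of_nonneg_of_le (Real.exp_pos _).le ?_
    have h1 := hexp (ε * t ^ (-(1 / 2) : ℝ)) (by positivity)
    have e : C * (ε * t ^ (-(1 / 2) : ℝ)) ^ (-(16 / 3) : ℝ) = C * ε ^ (-(16 / 3) : ℝ) * t ^ (8 / 3 : ℝ) := by
      rw [Real.mul_rpow hε0.le (by positivity), ← Real.rpow_mul ht.le]
      norm_num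
      ring
    rw [e] at h1
    refine h1.trans ?_
    rw [hD, mul_assoc (C * ε ^ (-(16 / 3) : ℝ))]
    refine mul_le_mul_of_nonneg_left ?_ (by positivity)
    rw [← div_eq_mul_inv, le_div_iff₀ (by positivity)]
    have hu2 : u ^ 2 ≤ Real.pi ^ 2 * σ ^ 2 := by
      rw [← sq_abs u, ← mul_pow]; exact pow_le_pow_left₀ (abs_nonneg u) hu 2
    calc t ^ (8 / 3 : ℝ) * (1 + u ^ 2) ≤ t ^ (8 / 3 : ℝ) * (1 + Real.pi ^ 2 * σ ^ 2) := by gcongr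
      _ = t ^ (8 / 3 : ℝ) + Real.pi ^ 2 * (t ^ (8 / 3 : ℝ) * σ ^ 2) := by ring
      _ ≤ 1 + Real.pi ^ 2 * (2 * L) := by gcongr

section Sequence

variable {Ω : ℕ → Type*} [∀ n, MeasurableSpace (Ω n)] {t : ℕ → ℝ} {P : ∀ n, Measure (Ω n)}
  {M : ∀ n, ℕ+ × ℕ+ → Ω n → ℕ}

/-- Central limit theorem for the total dimension, in terms of characteristic functions. -/
theorem tendsto_integral_exp_gaussian (ht : Tendsto t atTop (𝓝[>] 0))
    (h : ∀ n, 0 < t n → IsRandomRepresentation (t n) (P n) (M n)) (u : ℝ) :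
    Tendsto (fun n => ∫ ω, Complex.exp (((u / √(totalVar (t n)) *
      (realDim (M n) ω - totalMean (t n)) : ℝ) : ℂ) * Complex.I) ∂(P n)) atTop
      (𝓝 ((Real.exp (-(u ^ 2 / 2)) : ℝ) : ℂ)) := by
  obtain ⟨C, hC, hthird⟩ := exists_tsum_termThird_le
  obtain ⟨B, hB, hvar⟩ := exists_termVar_le
  have hL0 : 0 < √(5 / 3 * leadConst) := by have := leadConst_pos; positivity
  rw [tendsto_iff_norm_sub_tendsto_zero]
  have hw := tendsto_sqrt_totalVar
  -- At θ = u/σ the third-moment error has order s^(-23/6) s⁴ = s^(1/6), and the variance error has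
  -- order s^(-2) s^(8/3) = s^(2/3).
  have hlim : Tendsto (fun s : ℝ => 56 * |u| ^ 3 * C * (((√(totalVar s) * s ^ (4 / 3 : ℝ)) ^ 3)⁻¹ *
      s ^ (1 / 6 : ℝ)) + u ^ 4 * B * (((√(totalVar s) * s ^ (4 / 3 : ℝ)) ^ 2)⁻¹ * s ^ (2 / 3 : ℝ)))
      (𝓝[>] 0) (𝓝 0) := by
    have h1 := ((hw.pow 3).inv₀ (pow_pos hL0 3).ne').mul
      (tendsto_rpow_nhdsGT_zero (p := 1 / 6) (by norm_num))
    have h2 := ((hw.pow 2).inv₀ (pow_pos hL0 2).ne').mul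
      (tendsto_rpow_nhdsGT_zero (p := 2 / 3) (by norm_num))
    simpa using (h1.const_mul (56 * |u| ^ 3 * C)).add (h2.const_mul (u ^ 4 * B))
  refine squeeze_zero' (Eventually.of_forall fun n => norm_nonneg _) ?_ (hlim.comp ht)
  filter_upwards [ht.eventually self_mem_nhdsWithin] with n (hn : 0 < t n)
  have hg := norm_integral_exp_sub_gaussian_le hn (h n hn) (fun i => hvar (t n) i hn)
    (u / √(totalVar (t n)))
  have hV := totalVar_pos hn
  set s := t n with hs
  set σ := √(totalVar s) with hσ
  have hσ0 : 0 < σ := Real.sqrt_pos.2 hV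
  have hσ2 : totalVar s = σ ^ 2 := (Real.sq_sqrt hV.le).symm
  have e1 : (u / σ) ^ 2 * totalVar s / 2 = u ^ 2 / 2 := by rw [hσ2]; field_simp
  rw [e1] at hg
  refine hg.trans ?_
  simp only [Function.comp_apply, ← hs, ← hσ]
  have e2 : s ^ (-(23 / 6) : ℝ) = ((s ^ (4 / 3 : ℝ)) ^ 3)⁻¹ * s ^ (1 / 6 : ℝ) := by
    rw [← Real.rpow_natCast, ← Real.rpow_mul hn.le, ← Real.rpow_neg hn.le, ← Real.rpow_add hn]
    norm_num
  have e3 : 1 / s ^ 2 = ((s ^ (4 / 3 : ℝ)) ^ 2)⁻¹ * s ^ (2 / 3 : ℝ) := by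
    rw [one_div, ← Real.rpow_natCast, ← Real.rpow_natCast, ← Real.rpow_mul hn.le, ← Real.rpow_neg hn.le,
      ← Real.rpow_neg hn.le, ← Real.rpow_add hn]
    norm_num
  refine add_le_add ?_ (le_of_eq ?_)
  · calc _ ≤ 56 * |u / σ| ^ 3 * (C * s ^ (-(23 / 6) : ℝ)) := by gcongr; exact hthird s hn
      _ = _ := by
        rw [e2, abs_div, abs_of_pos hσ0, mul_pow]; field_simp
  · rw [hσ2, div_eq_mul_one_div B, e3, mul_pow]; field_simp

theorem sqrt_totalVar_mul_prob (n : ℕ) (ht : 0 < t n)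
    (h : IsRandomRepresentation (t n) (P n) (M n)) :
    ((√(totalVar (t n)) * (2 * Real.pi * (P n).real {ω | totalDim (M n) ω = (n : ℝ≥0∞)}) : ℝ) : ℂ)
      = ∫ u, (Set.Ioc (-(Real.pi * √(totalVar (t n)))) (Real.pi * √(totalVar (t n)))).indicator
        (fun u => ∫ ω, Complex.exp (((u / √(totalVar (t n)) * (realDim (M n) ω - n) : ℝ) : ℂ) *
          Complex.I) ∂(P n)) u := by
  have hσ0 : 0 < √(totalVar (t n)) := Real.sqrt_pos.2 (totalVar_pos ht)
  rw [Complex.ofReal_mul, two_pi_mul_prob_eq ht h n, integral_indicator measurableSet_Ioc,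
    ← intervalIntegral.integral_of_le (by nlinarith [Real.pi_pos])]
  rw [intervalIntegral.integral_comp_div (fun θ => ∫ ω, Complex.exp (((θ * (realDim (M n) ω - n) : ℝ) : ℂ) *
          Complex.I) ∂(P n)) hσ0.ne', neg_div, mul_div_cancel_right₀ _ hσ0.ne', Complex.real_smul]

/-- The local limit theorem along any sequence of parameters for which the mean of the total
dimension is close to `n` on the scale of the standard deviation. -/
theorem tendsto_sqrt_totalVar_mul_prob (ht : Tendsto t atTop (𝓝[>] 0))
    (h : ∀ n, 0 < t n → IsRandomRepresentation (t n) (P n) (M n))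
    (hμ : Tendsto (fun n => (totalMean (t n) - n) / √(totalVar (t n))) atTop (𝓝 0)) :
    Tendsto (fun n => √(totalVar (t n)) * (P n).real {ω | totalDim (M n) ω = (n : ℝ≥0∞)}) atTop
      (𝓝 (1 / √(2 * Real.pi))) := by
  obtain ⟨g, hgint, hg⟩ := exists_integrable_bound
  have htpos : ∀ᶠ n in atTop, 0 < t n := ht.eventually self_mem_nhdsWithin
  have hσ : Tendsto (fun n => √(totalVar (t n))) atTop atTop := by
    have h1 : Tendsto (fun s : ℝ => (s ^ (4 / 3 : ℝ))⁻¹) (𝓝[>] 0) atTop := by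
      refine tendsto_inv_nhdsGT_zero.comp ?_
      refine tendsto_nhdsWithin_iff.2 ⟨tendsto_rpow_nhdsGT_zero (by norm_num), ?_⟩
      filter_upwards [self_mem_nhdsWithin] with s (hs : 0 < s)
      exact Real.rpow_pos_of_pos hs _
    have h2 := tendsto_sqrt_totalVar.pos_mul_atTop (by have := leadConst_pos; positivity) h1
    refine (h2.comp ht).congr' ?_
    filter_upwards [htpos] with n hn
    simp only [Function.comp_apply]
    have := Real.rpow_pos_of_pos hn (4 / 3)
    field_simp
  have hlim : Tendsto (fun n => ∫ u, (Set.Ioc (-(Real.pi * √(totalVar (t n))))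
      (Real.pi * √(totalVar (t n)))).indicator
        (fun u => ∫ ω, Complex.exp (((u / √(totalVar (t n)) * (realDim (M n) ω - n) : ℝ) : ℂ) *
          Complex.I) ∂(P n)) u) atTop (𝓝 (∫ u : ℝ, ((Real.exp (-(u ^ 2 / 2)) : ℝ) : ℂ))) := by
    refine tendsto_integral_filter_of_dominated_convergence (fun u => |g u|) ?_ ?_ hgint.abs ?_
    · filter_upwards [htpos] with n hn
      have := (h n hn).isProbabilityMeasure
      have hN := measurable_realDim (h n hn)
      refine AEStronglyMeasurable.indicator ?_ measurableSet_Ioc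
      refine (StronglyMeasurable.integral_prod_right' (f := fun x : ℝ × Ω n =>
        Complex.exp (((x.1 / √(totalVar (t n)) * (realDim (M n) x.2 - n) : ℝ) : ℂ) * Complex.I))
        (Measurable.stronglyMeasurable ?_)).aestronglyMeasurable
      fun_prop
    · filter_upwards [htpos, ht.eventually hg] with n hn hgn
      refine Eventually.of_forall fun u => ?_
      by_cases hu : u ∈ Set.Ioc (-(Real.pi * √(totalVar (t n)))) (Real.pi * √(totalVar (t n)))
      · rw [Set.indicator_of_mem hu]
        exact (hgn (h n hn) n u (abs_le.2 ⟨hu.1.le, hu.2⟩)).trans (le_abs_self _)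
      · rw [Set.indicator_of_notMem hu, norm_zero]; exact abs_nonneg _
    · refine Eventually.of_forall fun u => ?_
      -- Recentering from the mean to n multiplies the integrand by this phase, which tends to 1
      -- because the mean misses n by o(σ).
      have hphase : Tendsto (fun n => Complex.exp (((u * ((totalMean (t n) - n) / √(totalVar (t n))) : ℝ) : ℂ)
          * Complex.I)) atTop (𝓝 1) := by
        have hc : Continuous fun x : ℝ => Complex.exp (((u * x : ℝ) : ℂ) * Complex.I) := by fun_prop
        have := (hc.tendsto 0).comp hμ
        simpa [Function.comp_def] using this
      have hprod := hphase.mul (tendsto_integral_exp_gaussian ht h u)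
      rw [one_mul] at hprod
      refine hprod.congr' ?_
      filter_upwards [hσ.eventually_gt_atTop |u|] with n hn
      have hmem : u ∈ Set.Ioc (-(Real.pi * √(totalVar (t n)))) (Real.pi * √(totalVar (t n))) := by
        have h3 : √(totalVar (t n)) ≤ Real.pi * √(totalVar (t n)) :=
          le_mul_of_one_le_left (Real.sqrt_nonneg _) (by linarith [Real.pi_gt_three])
        have h4 := abs_lt.1 hn
        exact ⟨by linarith, by linarith⟩
      rw [Set.indicator_of_mem hmem, ← integral_const_mul]
      refine integral_congr_ae (Eventually.of_forall fun ω => ?_)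
      simp only
      rw [← Complex.exp_add]
      push_cast
      ring_nf
  have hgauss : (∫ u : ℝ, ((Real.exp (-(u ^ 2 / 2)) : ℝ) : ℂ)) = ((√(2 * Real.pi) : ℝ) : ℂ) := by
    rw [integral_complex_ofReal]
    have := integral_gaussian (1 / 2)
    rw [show Real.pi / (1 / 2) = 2 * Real.pi by ring] at this
    rw [← this]
    congr 2
    funext u
    ring_nf
  rw [hgauss] at hlim
  have hre := (Complex.continuous_re.tendsto _).comp hlim
  rw [Complex.ofReal_re] at hre
  have hfin := hre.const_mul (1 / (2 * Real.pi))
  have e : 1 / (2 * Real.pi) * √(2 * Real.pi) = 1 / √(2 * Real.pi) := by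
    have h2 : 0 < 2 * Real.pi := by positivity
    have h3 := Real.mul_self_sqrt h2.le
    have h4 := Real.sqrt_pos.2 h2
    rw [div_mul_eq_mul_div, one_mul, div_eq_div_iff h2.ne' h4.ne', h3, one_mul]
  rw [e] at hfin
  refine hfin.congr' ?_
  filter_upwards [htpos] with n hn
  simp only [Function.comp_apply]
  rw [← sqrt_totalVar_mul_prob n hn (h n hn), Complex.ofReal_re]
  field_simp

end Sequence

/-! ### The explicit constant, and the theorem. -/

theorem sqrt_leadConst_div_tau1 : √(5 / 3 * leadConst) / tau1 ^ (4 / 3 : ℝ) = √5 / (√6 * constX) := by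
  have hX := constX_pos
  have hτ := tau1_pos
  have h1 : √(5 / 3 * leadConst) = √(5 / 6) * (2 ^ (4 / 3 : ℝ) * constX ^ (5 / 3 : ℝ)) := by
    rw [Real.sqrt_eq_iff_mul_self_eq (by have := leadConst_pos; positivity) (by positivity)]
    have e1 : (2 : ℝ) ^ (4 / 3 : ℝ) * 2 ^ (4 / 3 : ℝ) = 2 * 2 ^ (5 / 3 : ℝ) := by
      nth_rewrite 3 [← Real.rpow_one 2]
      rw [← Real.rpow_add two_pos, ← Real.rpow_add two_pos]; norm_num
    have e2 : constX ^ (5 / 3 : ℝ) * constX ^ (5 / 3 : ℝ) = constX ^ (10 / 3 : ℝ) := by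
      rw [← Real.rpow_add hX]; norm_num
    have e3 : √(5 / 6 : ℝ) * √(5 / 6) = 5 / 6 := Real.mul_self_sqrt (by norm_num)
    symm
    calc _ = (√(5 / 6 : ℝ) * √(5 / 6)) * ((2 : ℝ) ^ (4 / 3 : ℝ) * 2 ^ (4 / 3 : ℝ)) *
          (constX ^ (5 / 3 : ℝ) * constX ^ (5 / 3 : ℝ)) := by ring
      _ = _ := by rw [e1, e2, e3, leadConst]; ring
  have h2 : tau1 ^ (4 / 3 : ℝ) = 2 ^ (4 / 3 : ℝ) * constX ^ (5 / 3 : ℝ) * constX := by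
    rw [tau1, Real.mul_rpow (by norm_num) (by positivity), ← Real.rpow_natCast, ← Real.rpow_mul hX.le,
      mul_assoc, ← Real.rpow_add_one hX.ne']
    norm_num
  have h3 : 0 < (2 : ℝ) ^ (4 / 3 : ℝ) * constX ^ (5 / 3 : ℝ) := by positivity
  rw [h1, h2, Real.sqrt_div (by norm_num)]
  field_simp

theorem tendsto_sqrt_totalVar_saddlePoint :
    Tendsto (fun n : ℕ => √(totalVar (saddlePoint n)) / (n : ℝ) ^ (4 / 5 : ℝ)) atTop
      (𝓝 (√5 / (√6 * constX))) := by
  have hτ := tau1_pos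
  have h1 := tendsto_sqrt_totalVar.comp tendsto_saddlePoint
  have h2 := tendsto_saddlePoint_mul.rpow_const (p := 4 / 3) (Or.inl hτ.ne')
  have h3 := h1.div h2 (Real.rpow_pos_of_pos hτ _).ne'
  rw [sqrt_leadConst_div_tau1] at h3
  refine h3.congr' ?_
  filter_upwards [eventually_saddlePoint_pos, eventually_gt_atTop 0] with n hs hn
  have hn' : (0 : ℝ) < n := by exact_mod_cast hn
  simp only [Pi.div_apply, Function.comp_apply]
  rw [Real.mul_rpow hs.le (by positivity), ← Real.rpow_mul hn'.le]
  norm_num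
  have := Real.rpow_pos_of_pos hs (4 / 3)
  have := Real.rpow_pos_of_pos hn' (4 / 5)
  field_simp

end SU3

/-- Local central limit theorem for the total dimension `N`. For each `t > 0` the variables
`M t (j, k)` on `(Ω t, P t)` are those of the random representation model with parameter `t`. -/
theorem mainTheorem9 {Ω : ℝ → Type*} [∀ t, MeasurableSpace (Ω t)] (P : ∀ t, Measure (Ω t))
    (M : ∀ t, ℕ+ × ℕ+ → Ω t → ℕ)
    (hM : ∀ t, 0 < t → SU3.IsRandomRepresentation t (P t) (M t)) :
    (∀ t, 0 < t → (∀ᵐ ω ∂(P t), SU3.totalDim (M t) ω ≠ ∞) ∧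
      MemLp (fun ω => (SU3.totalDim (M t) ω).toReal) 2 (P t)) ∧
    (∀ᶠ n : ℕ in atTop, 0 < SU3.saddlePoint n) ∧
    (fun n : ℕ => (P (SU3.saddlePoint n)).real
        {ω | SU3.totalDim (M (SU3.saddlePoint n)) ω = (n : ℝ≥0∞)})
      ~[atTop] (fun n : ℕ => 1 / √(2 * Real.pi *
        variance (fun ω => (SU3.totalDim (M (SU3.saddlePoint n)) ω).toReal)
          (P (SU3.saddlePoint n)))) ∧
    (fun n : ℕ => (P (SU3.saddlePoint n)).real
        {ω | SU3.totalDim (M (SU3.saddlePoint n)) ω = (n : ℝ≥0∞)})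
      ~[atTop] (fun n : ℕ =>
        √3 * SU3.constX / √(5 * Real.pi) * (n : ℝ) ^ (-4 / 5 : ℝ)) := by
  have hpi := Real.pi_pos
  have hX := SU3.constX_pos
  have hσ := SU3.tendsto_sqrt_totalVar_saddlePoint
  have hκ : 0 < √5 / (√6 * SU3.constX) := by positivity
  have hn0 : ∀ᶠ n : ℕ in atTop, (0 : ℝ) < (n : ℝ) ^ (4 / 5 : ℝ) := by
    filter_upwards [eventually_gt_atTop 0] with n hn
    positivity
  -- Both the error in the mean and σ are measured against n^(4/5); σ/n^(4/5) has a positive limit.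
  have hμ : Tendsto (fun n : ℕ => (SU3.totalMean (SU3.saddlePoint n) - n) /
      √(SU3.totalVar (SU3.saddlePoint n))) atTop (𝓝 0) := by
    have h1 := SU3.tendsto_totalMean_saddlePoint.div hσ hκ.ne'
    rw [zero_div] at h1
    refine h1.congr' ?_
    filter_upwards [hn0] with n hn
    exact div_div_div_cancel_right₀ hn.ne' _ _
  have hmain := SU3.tendsto_sqrt_totalVar_mul_prob (Ω := fun n => Ω (SU3.saddlePoint n))
    SU3.tendsto_saddlePoint (fun n hn => hM _ hn) hμ
  have hc : (1 : ℝ) / √(2 * Real.pi) ≠ 0 := by positivity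
  refine ⟨fun t ht => ⟨SU3.totalDim_ae_ne_top ht (hM t ht), SU3.memLp_realDim ht (hM t ht)⟩,
    SU3.eventually_saddlePoint_pos, ?_, ?_⟩
  · have h1 := hmain.div_const (1 / √(2 * Real.pi))
    rw [div_self hc] at h1
    refine isEquivalent_of_tendsto_one (h1.congr' ?_)
    filter_upwards [SU3.eventually_saddlePoint_pos] with n hn
    have hv := SU3.variance_realDim hn (hM _ hn)
    unfold SU3.realDim at hv
    simp only [Pi.div_apply]
    rw [hv, Real.sqrt_mul (show (0 : ℝ) ≤ 2 * Real.pi by positivity) (SU3.totalVar _)]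
    have := Real.sqrt_pos.2 (SU3.totalVar_pos hn)
    field_simp
  · have h1 := (hmain.div hσ hκ.ne').div_const (√3 * SU3.constX / √(5 * Real.pi))
    have e : 1 / √(2 * Real.pi) / (√5 / (√6 * SU3.constX)) = √3 * SU3.constX / √(5 * Real.pi) := by
      have e6 : √(6 : ℝ) = √2 * √3 := by rw [← Real.sqrt_mul (by norm_num)]; norm_num
      rw [Real.sqrt_mul (by norm_num), Real.sqrt_mul (by norm_num), e6]
      field_simp
    rw [e, div_self (by positivity)] at h1
    refine isEquivalent_of_tendsto_one (h1.congr' ?_)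
    filter_upwards [SU3.eventually_saddlePoint_pos, hn0] with n hn hn0
    have := Real.sqrt_pos.2 (SU3.totalVar_pos hn)
    have e2 : (n : ℝ) ^ (-4 / 5 : ℝ) = ((n : ℝ) ^ (4 / 5 : ℝ))⁻¹ := by
      rw [← Real.rpow_neg (Nat.cast_nonneg n)]; norm_num
    simp only [Pi.div_apply]
    rw [e2]
    field_simp
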